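/- A \emph{rational model} of a compact connected topological surface $S$ is a nonsingular projective surface $X$ over $\mathbb{R}$ that is rational over $\mathbb{R}$ and whose set of real points $X(\mathbb{R})$, with its Euclidean topology, is homeomorphic (equivalently, diffeomorphic) to $S$. Two rational models $X$ and $Y$ of $S$ are \emph{isomorphic as rational models of $S$} if there is a sequence $$X=X_0\longleftarrow X_1\longrightarrow X_2\longleftarrow X_3\longrightarrow\cdots\longleftarrow X_{2n-1}\longrightarrow X_{2n}=Y \qquad (n\ge 0)$$ of rational models of $S$ in which each arrow is a blowing-up at a pair of nonreal complex conjugate points (models being identified when they are isomorphic as varieties over $\mathbb{R}$). Let $d\geq 0$ be an integer, and let $\mathbb{F}_d=\mathbb{P}(\mathcal{O}_{\mathbb{P}^1}(d)\oplus\mathcal{O}_{\mathbb{P}^1})$ be the real Hirzebruch surface of degree $d$ over $\mathbb{P}^1=\mathbb{P}^1_{\mathbb{R}}$. 1. If $d$ is even, then $\mathbb{F}_d$ and $\mathbb{P}^1\times\mathbb{P}^1$ are rational models of the torus $S^1\times S^1$, and they are isomorphic as rational models of $S^1\times S^1$. 2. If $d$ is odd, then for every real point $O$ of the projective plane $\mathbb{P}^2$,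 $\mathbb{F}_d$ and the blowing-up $B_O(\mathbb{P}^2)$ of $\mathbb{P}^2$ at $O$ are rational models of the Klein bottle $K$, and they are isomorphic as rational models of $K$. -/

import Mathlib

open CategoryTheory AlgebraicGeometry Limits
open scoped LaurentPolynomial
noncomputable section
namespace RealModel

attribute [local instance] MvPolynomial.gradedAlgebra

/-- The polynomial ring `A[x₀, …, xₙ]`, graded by total degree. -/
abbrev polyGrading (n : ℕ) (A : Type) [CommRing A] :
    ℕ → Submodule A (MvPolynomial (Fin (n + 1)) A) :=
  MvPolynomial.homogeneousSubmodule (Fin (n + 1)) A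

/-- Projective space `ℙⁿ_A = Proj A[x₀, …, xₙ]`. -/
abbrev projSpace (n : ℕ) (A : Type) [CommRing A] : Scheme.{0} := Proj (polyGrading n A)

/-- The structure morphism `ℙⁿ_A ⟶ Spec A`. -/
def projSpaceToSpec (n : ℕ) (A : Type) [CommRing A] :
    projSpace n A ⟶ Spec (CommRingCat.of A) :=
  Proj.toSpecZero (polyGrading n A) ≫
    Spec.map (CommRingCat.ofHom (algebraMap A (polyGrading n A 0)))

open HomogeneousIdeal in
lemma irrelevant_le_map_of_X_mem {n : ℕ} {A B : Type} [CommRing A] [CommRing B]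
    (f : polyGrading n A →+*ᵍ polyGrading n B)
    (h : ∀ i, (MvPolynomial.X i : MvPolynomial (Fin (n + 1)) B) ∈
      ((irrelevant (polyGrading n A)).map f).toIdeal) :
    irrelevant (polyGrading n B) ≤ (irrelevant (polyGrading n A)).map f := by
  have key : Ideal.span (MvPolynomial.X '' (Set.univ : Set (Fin (n+1)))) ≤
      ((irrelevant (polyGrading n A)).map f).toIdeal := by
    rw [Ideal.span_le]
    rintro _ ⟨i, -, rfl⟩
    exact h i
  rw [irrelevant_le]
  intro i hi p hp
  apply key
  rw [MvPolynomial.mem_ideal_span_X_image]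
  intro m hm
  by_contra! hcon
  have hp' : p.IsHomogeneous i := hp
  have := hp'.degree_eq_sum_deg_support hm
  have h0 : m = 0 := by ext j; exact hcon j trivial
  subst h0
  simp at this
  omega

/-- The graded homomorphism `A[x₀, …, xₙ] → B[x₀, …, xₙ]` given by `φ` on coefficients. -/
def baseChange (n : ℕ) {A B : Type} [CommRing A] [CommRing B] (φ : A →+* B) :
    polyGrading n A →+*ᵍ polyGrading n B where
  __ := MvPolynomial.map φ
  map_mem hx := MvPolynomial.IsHomogeneous.map hx φ

lemma baseChange_irrelevant (n : ℕ) {A B : Type} [CommRing A] [CommRing B] (φ : A →+* B) :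
    HomogeneousIdeal.irrelevant (polyGrading n B) ≤
      (HomogeneousIdeal.irrelevant (polyGrading n A)).map (baseChange n φ) := by
  refine irrelevant_le_map_of_X_mem _ fun i ↦ ?_
  have h := Ideal.mem_map_of_mem (baseChange n φ)
    (HomogeneousIdeal.mem_irrelevant_of_mem (polyGrading n A) zero_lt_one
      (MvPolynomial.isHomogeneous_X A i))
  have e : baseChange n φ (MvPolynomial.X i) = MvPolynomial.X i := MvPolynomial.map_X φ i
  rwa [e] at h

/-- The pair `(t x₀, x₁)`. -/
def twistVec {B : Type} [CommRing B] (t : B) : Fin (1 + 1) → MvPolynomial (Fin (1 + 1)) B :=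
  ![MvPolynomial.C t * MvPolynomial.X 0, MvPolynomial.X 1]

/-- The graded homomorphism `A[x₀, x₁] → B[x₀, x₁]` given by `φ` on coefficients and by
`x₀ ↦ t x₀`, `x₁ ↦ x₁`. -/
def twistHom {A B : Type} [CommRing A] [CommRing B] (φ : A →+* B) (t : B) :
    polyGrading 1 A →+*ᵍ polyGrading 1 B where
  __ := MvPolynomial.eval₂Hom (MvPolynomial.C.comp φ) (twistVec t)
  map_mem {i} x hx := by
    have := MvPolynomial.IsHomogeneous.eval₂ (m := i) (n := 1) hx
      (MvPolynomial.C.comp φ) (twistVec t)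
      (fun r ↦ MvPolynomial.isHomogeneous_C _ _)
      (fun j ↦ by
        fin_cases j
        · exact MvPolynomial.isHomogeneous_C_mul_X _ _
        · exact MvPolynomial.isHomogeneous_X _ _)
    rw [one_mul] at this
    exact this

section twistHom

variable {A B : Type} [CommRing A] [CommRing B] (φ : A →+* B) (t : B)

lemma twistHom_C (a : A) : twistHom φ t (MvPolynomial.C a) = MvPolynomial.C (φ a) :=
  MvPolynomial.eval₂_C _ _ a

lemma twistHom_X_zero : twistHom φ t (MvPolynomial.X 0) =
    MvPolynomial.C t * MvPolynomial.X 0 :=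
  MvPolynomial.eval₂_X _ _ 0

lemma twistHom_X_one : twistHom φ t (MvPolynomial.X 1) = MvPolynomial.X 1 :=
  MvPolynomial.eval₂_X _ _ 1

lemma twistHom_twistHom (φ : A →+* A) (t : A) (hφ : ∀ a, φ (φ a) = a) (ht : φ t * t = 1) :
    (twistHom φ t).comp (twistHom φ t) = .id _ := by
  have h : (twistHom φ t).toRingHom.comp (twistHom φ t).toRingHom = .id _ := by
    refine MvPolynomial.ringHom_ext (fun r ↦ ?_) (fun i ↦ ?_)
    · change twistHom φ t (twistHom φ t (MvPolynomial.C r)) = MvPolynomial.C r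
      rw [twistHom_C, twistHom_C, hφ]
    · change twistHom φ t (twistHom φ t _) = _
      fin_cases i
      · change twistHom φ t (twistHom φ t (MvPolynomial.X 0)) = MvPolynomial.X 0
        rw [twistHom_X_zero, map_mul, twistHom_C, twistHom_X_zero, ← mul_assoc, ← map_mul, ht,
          map_one, one_mul]
      · change twistHom φ t (twistHom φ t (MvPolynomial.X 1)) = MvPolynomial.X 1
        rw [twistHom_X_one, twistHom_X_one]
  exact GradedRingHom.ext fun x ↦ congr($h x)

lemma twistHom_irrelevant (ht : IsUnit t) :
    HomogeneousIdeal.irrelevant (polyGrading 1 B) ≤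
      (HomogeneousIdeal.irrelevant (polyGrading 1 A)).map (twistHom φ t) := by
  refine irrelevant_le_map_of_X_mem _ fun i ↦ ?_
  have h := Ideal.mem_map_of_mem (twistHom φ t)
    (HomogeneousIdeal.mem_irrelevant_of_mem (polyGrading 1 A) zero_lt_one
      (MvPolynomial.isHomogeneous_X A i))
  fin_cases i
  · have h : twistHom φ t (MvPolynomial.X 0) ∈ _ := h
    rw [twistHom_X_zero] at h
    exact (Ideal.unit_mul_mem_iff_mem _ (ht.map MvPolynomial.C)).1 h
  · have h : twistHom φ t (MvPolynomial.X 1) ∈ _ := h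
    rw [twistHom_X_one] at h
    exact h

end twistHom


/-- The automorphism `T ↦ T⁻¹` of `ℝ[T, T⁻¹]`. -/
def invertHom : ℝ[T;T⁻¹] →+* ℝ[T;T⁻¹] := (LaurentPolynomial.invert (R := ℝ)).toRingHom

/-- The automorphism of `ℙ¹_{ℝ[T, T⁻¹]}` given by `T ↦ T⁻¹`, `x₀ ↦ T ^ d x₀`, `x₁ ↦ x₁`. -/
def twistMap (d : ℕ) : projSpace 1 ℝ[T;T⁻¹] ⟶ projSpace 1 ℝ[T;T⁻¹] :=
  Proj.map (twistHom invertHom (LaurentPolynomial.T d))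
    (twistHom_irrelevant _ _ (LaurentPolynomial.isUnit_T _))

/-- The open immersion `ℙ¹_{ℝ[T, T⁻¹]} ⟶ ℙ¹_{ℝ[T]}` over `𝔸¹ ∖ {0} ⊆ 𝔸¹`. -/
def overlap : projSpace 1 ℝ[T;T⁻¹] ⟶ projSpace 1 (Polynomial ℝ) :=
  Proj.map (baseChange 1 Polynomial.toLaurent) (baseChange_irrelevant 1 _)

instance (d : ℕ) : IsIso (twistMap d) := by
  have h : twistMap d ≫ twistMap d = 𝟙 _ := by
    rw [twistMap, ← Proj.map_comp, ← Proj.map_id]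
    congr 1
    refine twistHom_twistHom _ _ (fun a ↦ LaurentPolynomial.involutive_invert a) ?_
    change LaurentPolynomial.invert _ * _ = _
    rw [LaurentPolynomial.invert_T, ← LaurentPolynomial.T_add, neg_add_cancel,
      LaurentPolynomial.T_zero]
  exact ⟨twistMap d, h, h⟩

lemma projMap_comp_projSpaceToSpec (n : ℕ) {A B : Type} [CommRing A] [CommRing B] (φ : A →+* B)
    (f : polyGrading n A →+*ᵍ polyGrading n B)
    (hf : HomogeneousIdeal.irrelevant (polyGrading n B) ≤
      (HomogeneousIdeal.irrelevant (polyGrading n A)).map f)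
    (h : ∀ a, f (MvPolynomial.C a) = MvPolynomial.C (φ a)) :
    Proj.map f hf ≫ projSpaceToSpec n A =
      projSpaceToSpec n B ≫ Spec.map (CommRingCat.ofHom φ) := by
  have key (i : ℕ) (hi : 0 < i) (s : MvPolynomial (Fin (n + 1)) A) (hs : s ∈ polyGrading n A i) :
      Proj.awayι (polyGrading n B) (f s) (f.map_mem hs) hi ≫
          (Proj.map f hf ≫ projSpaceToSpec n A) =
        Proj.awayι (polyGrading n B) (f s) (f.map_mem hs) hi ≫
          (projSpaceToSpec n B ≫ Spec.map (CommRingCat.ofHom φ)) := by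
    rw [projSpaceToSpec, projSpaceToSpec, Proj.awayι_comp_map_assoc f hf hi s hs,
      Proj.awayι_toSpecZero_assoc, Category.assoc, Proj.awayι_toSpecZero_assoc, ← Spec.map_comp,
      ← Spec.map_comp, ← Spec.map_comp, ← Spec.map_comp]
    congr 1
    ext a
    have hle : Submonoid.powers s ≤ (Submonoid.powers (f s)).comap f :=
      Submonoid.powers_le.mpr ⟨1, pow_one (f s)⟩
    change (HomogeneousLocalization.map f hle (HomogeneousLocalization.mk
      ⟨0, algebraMap A (polyGrading n A 0) a, 1, one_mem _⟩)).val = _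
    rw [HomogeneousLocalization.map_mk, HomogeneousLocalization.val_mk]
    change Localization.mk (f (MvPolynomial.C a)) _ = Localization.mk (MvPolynomial.C (φ a)) _
    rw [h]
    congr 1
    exact Subtype.ext (map_one f)
  exact (Proj.mapAffineOpenCover f hf).openCover.hom_ext _ _
    fun s ↦ key s.1 s.1.2 s.2 s.2.2

section OpenImmersion

open HomogeneousLocalization

variable {n : ℕ} {A B : Type} [CommRing A] [CommRing B]
  (f : polyGrading n A →+*ᵍ polyGrading n B) (t u : MvPolynomial (Fin (n + 1)) A)

lemma isOpenImmersion_awayMap (ht : t ∈ polyGrading n A 0)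
    (u : MvPolynomial (Fin (n + 1)) B) (hu : u ∈ polyGrading n B 0) (htu : f t * u = 1)
    (hsurj : ∀ b, ∃ (k : ℕ) (a : _), f a = f t ^ k * b)
    (hinj : Function.Injective f)
    {d : ℕ} {s : MvPolynomial (Fin (n + 1)) A} (hs : s ∈ polyGrading n A d) :
    IsOpenImmersion (Spec.map (CommRingCat.ofHom (Away.map f s))) := by
  let _ := (Away.map f s).toAlgebra
  let t' : Away (polyGrading n A) s := Away.mk _ hs 0 t (by simpa using ht)
  have hmap (k : ℕ) (a : MvPolynomial (Fin (n + 1)) A) (ha : a ∈ polyGrading n A (k • d)) :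
      algebraMap (Away (polyGrading n A) s) (Away (polyGrading n B) (f s)) (Away.mk _ hs k a ha) =
        Away.mk _ (f.map_mem hs) k (f a) (f.map_mem ha) :=
    Away.map_mk f s hs k a ha
  have : IsLocalization.Away t' (Away (polyGrading n B) (f s)) := by
    refine ⟨?_, ?_, ?_⟩
    · rintro ⟨_, k, rfl⟩
      rw [map_pow]
      refine IsUnit.pow _ (IsUnit.of_mul_eq_one
        (Away.mk _ (f.map_mem hs) 0 u (by simpa using hu)) ?_)
      rw [hmap]
      apply HomogeneousLocalization.val_injective
      rw [HomogeneousLocalization.val_mul, Away.val_mk, Away.val_mk, Localization.mk_mul,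
        HomogeneousLocalization.val_one, htu, ← Localization.mk_one]
      congr 1
      ext
      simp
    · intro z
      obtain ⟨m, b, hb, rfl⟩ := Away.mk_surjective _ (f.map_mem hs) z
      obtain ⟨k, a, ha⟩ := hsurj b
      have hftb : f t ^ k * b ∈ polyGrading n B (m • d) := by
        have := SetLike.mul_mem_graded (SetLike.pow_mem_graded k (f.map_mem ht)) hb
        simpa using this
      have ha' : a ∈ polyGrading n A (m • d) := by
        have h1 : f (DirectSum.decompose (polyGrading n A) a (m • d)) = f a := by
          rw [GradedRingHom.map_directSumDecompose, ha, DirectSum.decompose_of_mem_same _ hftb]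
        rw [← hinj h1]
        exact SetLike.coe_mem _
      refine ⟨(Away.mk _ hs m a ha', ⟨t' ^ k, k, rfl⟩), ?_⟩
      rw [hmap, map_pow, hmap]
      apply HomogeneousLocalization.val_injective
      rw [HomogeneousLocalization.val_mul, HomogeneousLocalization.val_pow, Away.val_mk,
        Away.val_mk, Away.val_mk, Localization.mk_pow, Localization.mk_mul, ha]
      congr 1
      · ring
      · ext
        simp
    · intro x y hxy
      refine ⟨1, congrArg _ ?_⟩
      obtain ⟨m, a, ha, rfl⟩ := Away.mk_surjective _ hs x
      obtain ⟨m', a', ha', rfl⟩ := Away.mk_surjective _ hs y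
      rw [hmap, hmap] at hxy
      have hv := congrArg HomogeneousLocalization.val hxy
      apply HomogeneousLocalization.val_injective
      rw [Away.val_mk, Away.val_mk, Localization.mk_eq_mk_iff, Localization.r_iff_exists] at hv ⊢
      obtain ⟨⟨_, c, rfl⟩, hc⟩ := hv
      refine ⟨⟨_, c, rfl⟩, hinj ?_⟩
      change f s ^ c * (f s ^ m' * f a) = f s ^ c * (f s ^ m * f a') at hc
      change f (s ^ c * (s ^ m' * a)) = f (s ^ c * (s ^ m * a'))
      simpa only [map_mul, map_pow] using hc
  exact IsOpenImmersion.of_isLocalization t'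

lemma isOpenImmersion_projMap
    (hf : HomogeneousIdeal.irrelevant (polyGrading n B) ≤
      (HomogeneousIdeal.irrelevant (polyGrading n A)).map f)
    (ht : t ∈ polyGrading n A 0)
    (u : MvPolynomial (Fin (n + 1)) B) (hu : u ∈ polyGrading n B 0) (htu : f t * u = 1)
    (hsurj : ∀ b, ∃ (k : ℕ) (a : _), f a = f t ^ k * b)
    (hinj : Function.Injective f) :
    IsOpenImmersion (Proj.map f hf) := by
  refine IsOpenImmersion.of_openCover_source _ (Proj.mapAffineOpenCover f hf).openCover ?_ ?_
  · have key (x y : ProjectiveSpectrum (polyGrading n B))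
        (h : ProjectiveSpectrum.comapFun f hf x = ProjectiveSpectrum.comapFun f hf y) :
        x.asHomogeneousIdeal ≤ y.asHomogeneousIdeal := by
      intro b hb
      obtain ⟨k, a, ha⟩ := hsurj b
      have hax : a ∈ (ProjectiveSpectrum.comapFun f hf x).asHomogeneousIdeal := by
        change f a ∈ x.asHomogeneousIdeal.toIdeal
        rw [ha]
        exact Ideal.mul_mem_left _ _ hb
      rw [h] at hax
      have hay : f a ∈ y.asHomogeneousIdeal.toIdeal := hax
      rw [ha] at hay
      exact (Ideal.unit_mul_mem_iff_mem _ ((IsUnit.of_mul_eq_one _ htu).pow k)).1 hay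
    intro x y h
    exact ProjectiveSpectrum.ext (le_antisymm (key x y h) (key y x h.symm))
  · intro s
    have key (i : ℕ) (hi : 0 < i) (s : MvPolynomial (Fin (n + 1)) A)
        (hs : s ∈ polyGrading n A i) : IsOpenImmersion
          (Proj.awayι (polyGrading n B) (f s) (f.map_mem hs) hi ≫ Proj.map f hf) := by
      have := isOpenImmersion_awayMap f t ht u hu htu hsurj hinj hs
      rw [Proj.awayι_comp_map f hf hi s hs]
      infer_instance
    exact key s.1 s.1.2 s.2 s.2.2

lemma isOpenImmersion_baseChange (φ : A →+* B) (hφ : Function.Injective φ) (t : A) (u : B)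
    (htu : φ t * u = 1) (hsurj : ∀ b, ∃ (k : ℕ) (a : A), φ a = φ t ^ k * b) :
    IsOpenImmersion (Proj.map (baseChange n φ) (baseChange_irrelevant n φ)) := by
  have hC (a : A) : baseChange n φ (MvPolynomial.C a) = MvPolynomial.C (φ a) :=
    MvPolynomial.map_C φ a
  have hX (i) : baseChange n φ (MvPolynomial.X i) = MvPolynomial.X i :=
    MvPolynomial.map_X φ i
  refine isOpenImmersion_projMap _ (MvPolynomial.C t) _
    (MvPolynomial.isHomogeneous_C _ _) (MvPolynomial.C u)
    (MvPolynomial.isHomogeneous_C _ _) ?_ ?_ (MvPolynomial.map_injective φ hφ)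
  · rw [hC, ← map_mul, htu, map_one]
  · intro b
    induction b using MvPolynomial.induction_on with
    | C b =>
      obtain ⟨k, a, h⟩ := hsurj b
      exact ⟨k, MvPolynomial.C a, by rw [hC, hC, h, map_mul, map_pow]⟩
    | add p q hp hq =>
      obtain ⟨k, a, h⟩ := hp
      obtain ⟨l, c, h'⟩ := hq
      refine ⟨k + l, MvPolynomial.C t ^ l * a + MvPolynomial.C t ^ k * c, ?_⟩
      rw [map_add, map_mul, map_mul, map_pow, map_pow, h, h']
      ring
    | mul_X p i hp =>
      obtain ⟨k, a, h⟩ := hp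
      exact ⟨k, a * MvPolynomial.X i, by rw [map_mul, h, hX]; ring⟩

end OpenImmersion

instance : IsOpenImmersion overlap := by
  refine isOpenImmersion_baseChange _ Polynomial.toLaurent_injective Polynomial.X
    (LaurentPolynomial.T (-1)) ?_ fun b ↦ ?_
  · rw [Polynomial.toLaurent_X, ← LaurentPolynomial.T_add, add_neg_cancel, LaurentPolynomial.T_zero]
  · obtain ⟨k, a, h⟩ := LaurentPolynomial.exists_T_pow b
    exact ⟨k, a, by rw [h, Polynomial.toLaurent_X, LaurentPolynomial.T_pow, mul_one, mul_comm]⟩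

/-- The category of schemes over `Spec ℝ`. -/
abbrev RealScheme : Type 1 := Over (Spec (CommRingCat.of ℝ))

/-- Real projective space `ℙⁿ` as a scheme over `ℝ`. -/
def realProjSpace (n : ℕ) : RealScheme := Over.mk (projSpaceToSpec n ℝ)

/-- The surface `ℙ¹ × ℙ¹` over `ℝ`. -/
def realP1xP1 : RealScheme :=
  Over.mk (pullback.fst (projSpaceToSpec 1 ℝ) (projSpaceToSpec 1 ℝ) ≫ projSpaceToSpec 1 ℝ)

/-- The structure morphism `ℙ¹_{ℝ[T]} ⟶ Spec ℝ[T] ⟶ Spec ℝ`. -/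
def chartToSpec : projSpace 1 (Polynomial ℝ) ⟶ Spec (CommRingCat.of ℝ) :=
  projSpaceToSpec 1 (Polynomial ℝ) ≫ Spec.map (CommRingCat.ofHom Polynomial.C)

lemma overlap_chartToSpec (d : ℕ) :
    overlap ≫ chartToSpec = (twistMap d ≫ overlap) ≫ chartToSpec := by
  have h1 : overlap ≫ chartToSpec = projSpaceToSpec 1 ℝ[T;T⁻¹] ≫
      Spec.map (CommRingCat.ofHom LaurentPolynomial.C) := by
    rw [overlap, chartToSpec, ← Category.assoc,
      projMap_comp_projSpaceToSpec 1 Polynomial.toLaurent _ _ (MvPolynomial.map_C _),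
      Category.assoc, ← Spec.map_comp, ← CommRingCat.ofHom_comp]
    congr 3
    ext r
    simp
  rw [Category.assoc, h1, twistMap, ← Category.assoc,
    projMap_comp_projSpaceToSpec 1 invertHom _ _ (twistHom_C _ _), Category.assoc,
    ← Spec.map_comp, ← CommRingCat.ofHom_comp]
  congr 3
  exact RingHom.ext fun r ↦ (LaurentPolynomial.invert_C r).symm

/-- The real Hirzebruch surface `𝔽_d = ℙ(𝒪(d) ⊕ 𝒪)` over `ℙ¹`: the two trivial `ℙ¹`-bundles
over the standard affine charts `Spec ℝ[T]` of `ℙ¹` are glued over the overlap `Spec ℝ[T, T⁻¹]`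
by `T ↦ T⁻¹` on the base and the transition matrix `diag(T ^ d, 1)` of `𝒪(d) ⊕ 𝒪` on the
fibres. -/
def hirzebruch (d : ℕ) : RealScheme :=
  Over.mk (pushout.desc (f := overlap) (g := twistMap d ≫ overlap) chartToSpec chartToSpec
    (overlap_chartToSpec d))

/-- The set `X(ℝ)` of real points. -/
abbrev RealPoint (X : RealScheme) : Type := Over.mk (𝟙 (Spec (CommRingCat.of ℝ))) ⟶ X

/-- The set `X(ℂ)` of complex points. -/
abbrev ComplexPoint (X : RealScheme) : Type :=
  Over.mk (Spec.map (CommRingCat.ofHom (algebraMap ℝ ℂ))) ⟶ X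

/-- A complex point is nonreal if it differs from its complex conjugate. -/
def ComplexPoint.IsNonreal {X : RealScheme} (p : ComplexPoint X) : Prop :=
  Spec.map (CommRingCat.ofHom (starRingEnd ℂ)) ≫ p.left ≠ p.left

/-- The value at a real point `x` of a regular function `f` on an open neighbourhood `U`. -/
def RealPoint.eval {X : RealScheme} (x : RealPoint X) (U : X.left.Opens)
    (h : ⊤ ≤ x.left ⁻¹ᵁ U) (f : Γ(X.left, U)) : ℝ :=
  (Scheme.ΓSpecIso (CommRingCat.of ℝ)).hom (x.left.appLE U ⊤ h f)

/-- The Euclidean topology on `X(ℝ)`: the coarsest one for which `U(ℝ)` is open and regular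
functions `U(ℝ) → ℝ` are continuous, for all Zariski open `U`. -/
@[reducible] def euclideanTopology (X : RealScheme) : TopologicalSpace (RealPoint X) :=
  TopologicalSpace.generateFrom
    {s | ∃ (U : X.left.Opens) (f : Γ(X.left, U)) (V : Set ℝ), IsOpen V ∧
      s = {x | ∃ h : ⊤ ≤ x.left ⁻¹ᵁ U, x.eval U h f ∈ V}}

/-- `X` is a rational model of the topological surface `S`: a nonsingular projective surface
over `ℝ` that is rational over `ℝ` and whose real locus is homeomorphic to `S`. -/
structure IsRationalModel (S : Type) [TopologicalSpace S] (X : RealScheme) : Prop where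
  nonsingular : SmoothOfRelativeDimension 2 X.hom
  projective : ∃ (n : ℕ) (i : X ⟶ realProjSpace n), IsClosedImmersion i.left
  rational : Scheme.IsRationalOver X.hom
  realLocus : letI := euclideanTopology X; Nonempty (RealPoint X ≃ₜ S)

/-- An ideal sheaf is invertible if it is locally generated by one nonzerodivisor. -/
def IsInvertibleIdeal {Z : Scheme.{0}} (I : Z.IdealSheafData) : Prop :=
  ∀ z : Z, ∃ U : Z.affineOpens, z ∈ U.1 ∧
    ∃ f ∈ nonZeroDivisors Γ(Z, U.1), I.ideal U = Ideal.span {f}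

/-- `π : X ⟶ Y` is the blowing-up of `Y` along the ideal sheaf `I`: the inverse image ideal sheaf
`I · 𝒪_X` is invertible, and `π` is universal with this property. -/
structure IsBlowup {X Y : Scheme.{0}} (I : Y.IdealSheafData) (π : X ⟶ Y) : Prop where
  isInvertibleIdeal : IsInvertibleIdeal (I.comap π)
  existsUnique_lift : ∀ (Z : Scheme.{0}) (g : Z ⟶ Y), IsInvertibleIdeal (I.comap g) →
    ∃! h : Z ⟶ X, h ≫ π = g

/-- `π` is the blowing-up at the real point `O`; `O.left.ker` is the ideal sheaf of functions
vanishing at `O`. -/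
def IsBlowupAtRealPoint {X Y : RealScheme} (O : RealPoint Y) (π : X ⟶ Y) : Prop :=
  IsBlowup O.left.ker π.left

/-- `π` is the blowing-up at a pair of nonreal complex conjugate points `p` and `p̄`; `p.left.ker`
is the ideal sheaf of functions (with real coefficients) vanishing at `p`, or equivalently
at `p` and `p̄`. -/
def IsBlowupAtConjugatePair {X Y : RealScheme} (π : X ⟶ Y) : Prop :=
  ∃ p : ComplexPoint Y, p.IsNonreal ∧ IsBlowup p.left.ker π.left

/-- `A` and `B` are isomorphic as rational models of `S`: both are rational models of `S`, and
there is a sequence `A = X₀ ⟵ X₁ ⟶ X₂ ⟵ ⋯ ⟶ X₂ₙ = B` of rational models of `S` in which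
each arrow is a blowing-up at a pair of nonreal complex conjugate points. -/
structure AreIsomorphicModels (S : Type) [TopologicalSpace S] (A B : RealScheme) : Prop where
  isRationalModel_left : IsRationalModel S A
  isRationalModel_right : IsRationalModel S B
  exists_chain : ∃ (n : ℕ) (X : ℕ → RealScheme),
    Nonempty (A ≅ X 0) ∧ Nonempty (X (2 * n) ≅ B) ∧
    (∀ i ≤ 2 * n, IsRationalModel S (X i)) ∧
    ∀ k < n, (∃ f : X (2 * k + 1) ⟶ X (2 * k), IsBlowupAtConjugatePair f) ∧
      ∃ g : X (2 * k + 1) ⟶ X (2 * k + 2), IsBlowupAtConjugatePair g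

/-- The free involution `(z, w) ↦ (-z, w̄)` of the torus `S¹ × S¹`. -/
def kleinInvolution (p : Circle × Circle) : Circle × Circle := (-p.1, p.2⁻¹)

/-- The equivalence relation whose classes are the orbits of `kleinInvolution`. -/
def kleinSetoid : Setoid (Circle × Circle) where
  r p q := q = p ∨ q = kleinInvolution p
  iseqv :=
    { refl := fun p ↦ Or.inl rfl
      symm := by
        rintro p q (rfl | rfl)
        · exact Or.inl rfl
        · exact Or.inr (by simp [kleinInvolution])
      trans := by
        rintro p q r (rfl | rfl) (rfl | rfl)
        · exact Or.inl rfl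
        · exact Or.inr rfl
        · exact Or.inr rfl
        · exact Or.inl (by simp [kleinInvolution]) }

/-- The Klein bottle, as the quotient of the torus by the free involution `(z, w) ↦ (-z, w̄)`. -/
def KleinBottle : Type := Quotient kleinSetoid

instance : TopologicalSpace KleinBottle := inferInstanceAs (TopologicalSpace (Quotient kleinSetoid))

end RealModel
end

noncomputable section

namespace RealModel

set_option linter.unusedSectionVars false

/-! ### Schemes with a chosen generic point -/

section Models

variable {K : Type} [Field K] {X Y : Scheme.{0}}

/-! Everything happens inside one function field `K = ℝ(t, x)`. A surface is treated as a scheme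
with a chosen generic point `Spec K ⟶ X`, and its affine charts are spectra of subrings of `K`.
Since such schemes are reduced with dense generic point, a morphism to a separated target is
determined by its effect on the generic point (`CoveredBy.hom_ext`), and it exists as soon as every
chart ring has a centre on the target (`CoveredBy.exists_hom`). Birational geometry thus becomes a
comparison of subrings of `K` given by explicit generators.

The surface 𝔽_d has the charts (t, x) and (1/t, t^d x), together with those obtained by inverting
the fibre coordinate (`isRuled_hModel`, `exists_hirzebruch_iso`). The heart of the proof is the
elementary transformation at the conjugate pair t = ±i, x = 0: blow up the pair and contract the
strict transforms of the fibres t = ±i. It replaces x by x/(1 + t²). With s = 1/t and y = t^d x one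
has y/(1 + s²) = t^(d+2) x/(1 + t²), so the result is 𝔽_{d+2}. The intermediate surface `eModel` is
the closure of the common generic point in the product of 𝔽_d and 𝔽_{d+2}, embedded by Segre. It has
six charts and is a blowing-up of both surfaces at a conjugate pair (`exists_eModel_hom`,
`exists_eModel_hom_add_two`); the second assertion follows from the first because x ↦ (1 + t²)/x
permutes the six charts (`elemRings_inv`). Induction then links every degree to 0 or 1
(`exists_chain_hModel`).

Blowing-ups are recognized by `isBlowup_of_isBlowupDatum`: over each chart Spec A with centre
generated by G, the rings A[h/g : h ∈ G] must have a centre upstairs, and every chart upstairs must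
contain a chart ring A together with all h/g for some g. The universal property is then proved
locally and glued by uniqueness.

In degree 0 the surface is ℙ¹ × ℙ¹ (`exists_realP1xP1_iso`). In degree 1 it is the blowing-up of ℙ²
at a real point (`exists_isBlowupAtRealPoint`), and uniqueness of blowing-ups covers every other
choice.

Every surface in the chain must also be a rational model. Projectivity is built in. Smoothness holds
because each chart is an affine plane or the quadric xu = 1 + t² (`isSmoothRng_conic`), and
rationality because some chart is an affine plane. Blowing up a nonreal pair does not change the
real locus (`IsBlowupAtConjugatePair.nonempty_homeomorph`), so only degrees 0 and 1 need topology.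
There the real locus is a quotient of a parametrizing torus, and its fibres are computed from
homogeneous coordinates (`torus_fibres`, `klein_fibres`). -/

lemma isDominant_specMap_of_injective {R S : Type} [CommRing R] [CommRing S] (f : R →+* S)
    (hf : Function.Injective f) : IsDominant (Spec.map (CommRingCat.ofHom f)) := by
  refine ⟨(PrimeSpectrum.denseRange_comap_iff_ker_le_nilRadical f).2 ?_⟩
  rw [(RingHom.injective_iff_ker_eq_bot f).1 hf]
  exact bot_le

/-- The generic point of the spectrum of a subring of a field. -/
def genPt (B : Subring K) : Spec (.of K) ⟶ Spec (.of B) := Spec.map (CommRingCat.ofHom B.subtype)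

instance (B : Subring K) : IsDominant (genPt B) :=
  isDominant_specMap_of_injective _ B.subtype_injective

/-- The morphism of spectra of an inclusion of subrings of a field. -/
def specIncl {A B : Subring K} (h : A ≤ B) : Spec (.of B) ⟶ Spec (.of A) :=
  Spec.map (CommRingCat.ofHom (Subring.inclusion h))

@[simp]
lemma genPt_specIncl {A B : Subring K} (h : A ≤ B) : genPt B ≫ specIncl h = genPt A := by
  rw [genPt, specIncl, ← Spec.map_comp]; rfl

@[simp]
lemma genPt_specIncl_assoc {A B : Subring K} (h : A ≤ B) {Z : Scheme.{0}}
    (f : Spec (.of A) ⟶ Z) : genPt B ≫ specIncl h ≫ f = genPt A ≫ f := by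
  rw [← Category.assoc, genPt_specIncl]

/-- The point `η` of `Y` with values in `K` extends to the spectrum of `B ⊆ K`. -/
def HasCenter (η : Spec (.of K) ⟶ Y) (B : Subring K) : Prop :=
  ∃ c : Spec (.of B) ⟶ Y, genPt B ≫ c = η

/-- The morphism `c : Spec B ⟶ X` is an open chart compatible with `η`. -/
structure IsChart (η : Spec (.of K) ⟶ X) (B : Subring K) (c : Spec (.of B) ⟶ X) : Prop where
  isOpenImmersion : IsOpenImmersion c
  genPt_comp : genPt B ≫ c = η

/-- The scheme `X` is covered by open charts that are spectra of members of `𝓑`. -/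
def CoveredBy (η : Spec (.of K) ⟶ X) (𝓑 : Set (Subring K)) : Prop :=
  ∀ x : X, ∃ B ∈ 𝓑, ∃ c : Spec (.of B) ⟶ X, IsChart η B c ∧ x ∈ Set.range c

lemma HasCenter.mono {η : Spec (.of K) ⟶ Y} {A B : Subring K} (hA : HasCenter η A) (h : A ≤ B) :
    HasCenter η B := by
  obtain ⟨c, hc⟩ := hA
  exact ⟨specIncl h ≫ c, by simp [hc]⟩

lemma CoveredBy.mono {η : Spec (.of K) ⟶ X} {𝓐 𝓑 : Set (Subring K)} (h : CoveredBy η 𝓐)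
    (h' : 𝓐 ⊆ 𝓑) : CoveredBy η 𝓑 := fun x ↦ by
  obtain ⟨B, hB, c, hc, hx⟩ := h x
  exact ⟨B, h' hB, c, hc, hx⟩

/-- A chart given by a ring that embeds in `K`. -/
lemma IsChart.of_injective {η : Spec (.of K) ⟶ X} {R : Type} [CommRing R] (ι : R →+* K)
    (hι : Function.Injective ι) (c : Spec (.of R) ⟶ X) [IsOpenImmersion c]
    (hc : Spec.map (CommRingCat.ofHom ι) ≫ c = η) {B : Subring K} (hB : ι.range = B) :
    ∃ c' : Spec (.of B) ⟶ X, IsChart η B c' ∧ Set.range c' = Set.range c := by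
  subst hB
  let e : R ≃+* ι.range := RingEquiv.ofBijective ι.rangeRestrict
    ⟨fun a b h ↦ hι congr(($h : K)), ι.rangeRestrict_surjective⟩
  have he : IsIso (Spec.map (CommRingCat.ofHom (e : R →+* ι.range))) := by
    rw [isIso_SpecMap_iff]; exact e.bijective
  refine ⟨Spec.map (CommRingCat.ofHom (e : R →+* ι.range)) ≫ c, ⟨inferInstance, ?_⟩, ?_⟩
  · rw [genPt, ← Category.assoc, ← Spec.map_comp, ← hc]; rfl
  · rw [Scheme.Hom.comp_base, TopCat.coe_comp, Set.range_comp,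
      (Spec.map (CommRingCat.ofHom (e : R →+* ι.range))).surjective.range_eq, Set.image_univ]

/-- The spectrum of a subring of `K` is reduced and its generic point is dense, so agreement there
forces agreement into a separated scheme. Most identities between morphisms below are checked in
this way. -/
lemma hom_ext_of_genPt [Y.IsSeparated] {B : Subring K} {f g : Spec (.of B) ⟶ Y}
    (h : genPt B ≫ f = genPt B ≫ g) : f = g := by
  have : IsReduced (Spec (.of B)) := inferInstance
  exact ext_of_isDominant (genPt B) h

lemma IsChart.comp_eq [Y.IsSeparated] {ηX : Spec (.of K) ⟶ X} {ηY : Spec (.of K) ⟶ Y}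
    {f : X ⟶ Y} (hf : ηX ≫ f = ηY) {A B : Subring K} (h : A ≤ B) {c : Spec (.of B) ⟶ X}
    (hc : genPt B ≫ c = ηX) {d : Spec (.of A) ⟶ Y} (hd : genPt A ≫ d = ηY) :
    c ≫ f = specIncl h ≫ d := by
  apply hom_ext_of_genPt
  rw [reassoc_of% hc, hf, genPt_specIncl_assoc, hd]

/-- The generic point of the intersection of two charts. -/
def overlapPt {η : Spec (.of K) ⟶ X} {B B' : Subring K} {c : Spec (.of B) ⟶ X}
    {c' : Spec (.of B') ⟶ X} (hc : genPt B ≫ c = η) (hc' : genPt B' ≫ c' = η) :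
    Spec (.of K) ⟶ pullback c c' :=
  pullback.lift (genPt B) (genPt B') (hc.trans hc'.symm)

section overlapPt

variable {η : Spec (.of K) ⟶ X} {B B' : Subring K} {c : Spec (.of B) ⟶ X}
    {c' : Spec (.of B') ⟶ X} (hc : genPt B ≫ c = η) (hc' : genPt B' ≫ c' = η)

@[simp]
lemma overlapPt_fst : overlapPt hc hc' ≫ pullback.fst c c' = genPt B := pullback.lift_fst _ _ _

@[simp]
lemma overlapPt_snd : overlapPt hc hc' ≫ pullback.snd c c' = genPt B' := pullback.lift_snd _ _ _

@[simp]
lemma overlapPt_fst_assoc {Z : Scheme.{0}} (f : Spec (.of B) ⟶ Z) :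
    overlapPt hc hc' ≫ pullback.fst c c' ≫ f = genPt B ≫ f := pullback.lift_fst_assoc _ _ _ _

@[simp]
lemma overlapPt_snd_assoc {Z : Scheme.{0}} (f : Spec (.of B') ⟶ Z) :
    overlapPt hc hc' ≫ pullback.snd c c' ≫ f = genPt B' ≫ f := pullback.lift_snd_assoc _ _ _ _

/-- The overlap is open in `Spec B`, so it inherits the density of the generic point. Together with
reducedness this allows identities on overlaps to be checked in `K`. -/
lemma isDominant_overlapPt [IsOpenImmersion c'] : IsDominant (overlapPt hc hc') := by
  have : IsDominant (overlapPt hc hc' ≫ pullback.fst c c') := by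
    rw [overlapPt_fst]; infer_instance
  exact IsDominant.of_comp_of_isOpenImmersion _ (pullback.fst c c')

lemma isReduced_overlap [IsOpenImmersion c'] : IsReduced (pullback c c') :=
  isReduced_of_isOpenImmersion (pullback.fst c c')

end overlapPt

namespace CoveredBy

variable {ηX : Spec (.of K) ⟶ X} {ηY : Spec (.of K) ⟶ Y} {𝓑 : Set (Subring K)}

lemma isReduced (h : CoveredBy ηX 𝓑) : IsReduced X := by
  choose B hB c hc hx using h
  have (x : X) : IsReduced (Spec (.of (B x))) := inferInstance
  have _ (x : X) : IsOpenImmersion (c x) := (hc x).1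
  refine @isReduced_of_isReduced_stalk X fun x ↦ ?_
  obtain ⟨y, hy⟩ := hx x
  have e := asIso ((c x).stalkMap y)
  rw [hy] at e
  exact isReduced_of_injective e.hom.hom e.commRingCatIsoToRingEquiv.injective

lemma isDominant (h : CoveredBy ηX 𝓑) : IsDominant ηX := by
  refine ⟨fun x ↦ ?_⟩
  obtain ⟨B, hB, c, hc, y, rfl⟩ := h x
  have h1 : y ∈ closure (Set.range (genPt B)) := (genPt B).denseRange y
  have h2 := image_closure_subset_closure_image c.continuous ⟨y, h1, rfl⟩
  rw [← hc.2]
  rwa [← Set.range_comp] at h2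

/-- Morphisms to a separated scheme are determined by the generic point. -/
lemma hom_ext [Y.IsSeparated] (h : CoveredBy ηX 𝓑) {f g : X ⟶ Y} (hfg : ηX ≫ f = ηX ≫ g) :
    f = g := by
  have := h.isReduced
  have := h.isDominant
  exact ext_of_isDominant ηX hfg

/-- Glueing of morphisms to a separated scheme. -/
lemma exists_hom [Y.IsSeparated] (h : CoveredBy ηX 𝓑) (h' : ∀ B ∈ 𝓑, HasCenter ηY B) :
    ∃ f : X ⟶ Y, ηX ≫ f = ηY := by
  obtain ⟨x₀⟩ : Nonempty X := ⟨ηX default⟩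
  choose B hB c hc hx using h
  have _ (x : X) : IsOpenImmersion (c x) := (hc x).1
  choose d hd using fun x ↦ h' (B x) (hB x)
  let 𝒰 : X.OpenCover := {
    I₀ := X, X i := Spec (.of (B i)), f i := c i,
    mem₀ := by
      rw [Scheme.presieve₀_mem_precoverage_iff]
      exact ⟨fun x ↦ ⟨x, hx x⟩, fun x ↦ (hc x).1⟩ }
  -- Both local morphisms extend `ηY`, so they agree on the overlap, where the generic point is
  -- dense.
  have comp (x y : X) : pullback.fst (c x) (c y) ≫ d x = pullback.snd (c x) (c y) ≫ d y := by
    have := isDominant_overlapPt (hc x).2 (hc y).2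
    have := isReduced_overlap (c := c x) (c' := c y)
    apply ext_of_isDominant (overlapPt (hc x).2 (hc y).2)
    simp [hd]
  refine ⟨𝒰.glueMorphisms d comp, ?_⟩
  rw [← (hc x₀).2, Category.assoc]
  erw [𝒰.ι_glueMorphisms d comp x₀]
  exact hd x₀

/-- A model dominated by all the charts of a cover is isomorphic to it if the converse holds. -/
lemma exists_iso [X.IsSeparated] [Y.IsSeparated] {𝓒 : Set (Subring K)} (hX : CoveredBy ηX 𝓑)
    (hY : CoveredBy ηY 𝓒) (h : ∀ B ∈ 𝓑, HasCenter ηY B) (h' : ∀ B ∈ 𝓒, HasCenter ηX B) :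
    ∃ e : X ≅ Y, ηX ≫ e.hom = ηY := by
  obtain ⟨f, hf⟩ := hX.exists_hom h
  obtain ⟨g, hg⟩ := hY.exists_hom h'
  refine ⟨⟨f, g, hX.hom_ext ?_, hY.hom_ext ?_⟩, hf⟩
  · rw [reassoc_of% hf, hg, Category.comp_id]
  · rw [reassoc_of% hg, hf, Category.comp_id]

/-- If every member of a cover contains a chart of the same scheme, these charts already cover. -/
lemma refine_charts [X.IsSeparated] {𝓒 : Set (Subring K)} (h : CoveredBy ηX 𝓑)
    (h𝓒 : ∀ C ∈ 𝓒, ∃ c, IsChart ηX C c) (hle : ∀ B ∈ 𝓑, ∃ C ∈ 𝓒, C ≤ B) : CoveredBy ηX 𝓒 := by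
  intro x
  obtain ⟨B, hB, c, hc, y, rfl⟩ := h x
  obtain ⟨C, hC, hCB⟩ := hle B hB
  obtain ⟨d, hd⟩ := h𝓒 C hC
  have : c = specIncl hCB ≫ d := hom_ext_of_genPt (by rw [hc.2, genPt_specIncl_assoc, hd.2])
  exact ⟨C, hC, d, hd, specIncl hCB y, by rw [this]; rfl⟩

/-- A morphism from a separated scheme covered by charts of the target is injective. -/
lemma injective_of_charts [X.IsSeparated] [Y.IsSeparated] (h : CoveredBy ηX 𝓑)
    (h' : ∀ B ∈ 𝓑, ∃ c, IsChart ηY B c) {f : X ⟶ Y} (hf : ηX ≫ f = ηY) :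
    Function.Injective f := by
  intro p q hpq
  obtain ⟨B, hB, c, hc, p', rfl⟩ := h p
  obtain ⟨C, hC, c', hc', q', rfl⟩ := h q
  obtain ⟨d, hd⟩ := h' B hB
  obtain ⟨d', hd'⟩ := h' C hC
  have e1 : c ≫ f = d := hom_ext_of_genPt (by rw [reassoc_of% hc.2, hf, hd.2])
  have e2 : c' ≫ f = d' := hom_ext_of_genPt (by rw [reassoc_of% hc'.2, hf, hd'.2])
  have := hd.1
  have := hd'.1
  obtain ⟨w, hw1, hw2⟩ := Scheme.Pullback.exists_preimage_pullback p' q'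
    (show d p' = d' q' by rw [← e1, ← e2]; exact hpq)
  have := isDominant_overlapPt hd.2 hd'.2
  have := isReduced_overlap (c := d) (c' := d')
  -- The two points have a common preimage `w` in the overlap formed in `Y`. On that overlap the two
  -- charts of `X` already agree, because they agree generically.
  have key : pullback.fst d d' ≫ c = pullback.snd d d' ≫ c' := by
    apply ext_of_isDominant (overlapPt hd.2 hd'.2)
    simp [hc.2, hc'.2]
  rw [← hw1, ← hw2]
  exact congr($key w)

end CoveredBy

/-- On the intersection of two charts mutually inverse functions do not vanish. -/
lemma IsChart.notMem_of_mul_eq_one {η : Spec (.of K) ⟶ X} {B B' : Subring K}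
    {c : Spec (.of B) ⟶ X} {c' : Spec (.of B') ⟶ X} (hc : IsChart η B c) (hc' : IsChart η B' c')
    {p : Spec (.of B)} {p' : Spec (.of B')} (hp : c p = c' p') (b : B) (b' : B')
    (hbb' : (b : K) * b' = 1) : b ∉ p.asIdeal := by
  have := hc.1
  have := hc'.1
  obtain ⟨w, hw1, hw2⟩ := Scheme.Pullback.exists_preimage_pullback p p' hp
  have := isDominant_overlapPt hc.2 hc'.2
  have := isReduced_overlap (c := c) (c' := c')
  have : (pullback c c').IsSeparated := ⟨by
    rw [← terminal.comp_from (pullback.fst c c')]; infer_instance⟩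
  have : QuasiCompact (overlapPt hc.2 hc'.2) := inferInstance
  have := IsSchemeTheoreticallyDominant.of_isDominant (overlapPt hc.2 hc'.2)
  -- The product of the two functions is 1 on the whole overlap: functions on it inject into `K`,
  -- since the generic point is scheme-theoretically dominant.
  have h1 : (pullback.fst c c').appTop ((Scheme.ΓSpecIso (.of B)).inv b) *
      (pullback.snd c c').appTop ((Scheme.ΓSpecIso (.of B')).inv b') = 1 := by
    apply (overlapPt hc.2 hc'.2).app_injective ⊤
    have e1 : (pullback.fst c c').appTop ≫ (overlapPt hc.2 hc'.2).appTop = (genPt B).appTop := by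
      rw [← Scheme.Hom.comp_appTop, overlapPt_fst]
    have e2 : (pullback.snd c c').appTop ≫ (overlapPt hc.2 hc'.2).appTop = (genPt B').appTop := by
      rw [← Scheme.Hom.comp_appTop, overlapPt_snd]
    rw [map_mul, map_one]
    have e1' := congr($e1 ((Scheme.ΓSpecIso (.of B)).inv b))
    have e2' := congr($e2 ((Scheme.ΓSpecIso (.of B')).inv b'))
    rw [CommRingCat.comp_apply] at e1' e2'
    erw [e1', e2']
    have n1 := congr($(Scheme.ΓSpecIso_inv_naturality (CommRingCat.ofHom B.subtype)) b)
    have n2 := congr($(Scheme.ΓSpecIso_inv_naturality (CommRingCat.ofHom B'.subtype)) b')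
    rw [CommRingCat.comp_apply, CommRingCat.comp_apply] at n1 n2
    rw [genPt, genPt]
    erw [← n1, ← n2, ← map_mul]
    change (Scheme.ΓSpecIso (.of K)).inv ((b : K) * b') = _
    rw [hbb', map_one]
    rfl
  intro hb
  have hu := IsUnit.of_mul_eq_one _ h1
  have h2 : w ∈ (pullback c c').basicOpen
      ((pullback.fst c c').appTop ((Scheme.ΓSpecIso (.of B)).inv b)) := by
    rw [(pullback c c').basicOpen_of_isUnit hu]; trivial
  rw [← Scheme.preimage_basicOpen_top] at h2
  have h3 : p ∈ (Spec (.of B)).basicOpen ((Scheme.ΓSpecIso (.of B)).inv b) := by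
    rw [← hw1]; exact h2
  rw [basicOpen_eq_of_affine] at h3
  exact h3 (by simpa using hb)

end Models

/-! ### Points of `Proj` -/

section ProjPoint

open HomogeneousLocalization

variable {S σ R : Type} [CommRing S] [CommRing R] [SetLike σ S] [AddSubgroupClass σ S]
  (𝒜 : ℕ → σ) [GradedRing 𝒜] (ε : S →+* R) {s s' : S} {m m' : ℕ}

/-- The homomorphism `𝒜_(s) → R` induced by a homomorphism for which the image of `s` is a
unit. -/
def awayEval (s : S) (hu : IsUnit (ε s)) : Away 𝒜 s →+* R :=
  (IsLocalization.Away.lift (S := Localization.Away s) s hu).comp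
    (algebraMap (Away 𝒜 s) (Localization.Away s))

/-- Values are described after clearing denominators, so the inverse of `ε s` never has to be
written. -/
lemma awayEval_mk (hu : IsUnit (ε s)) (hs : s ∈ 𝒜 m) (k : ℕ) (a : S) (ha : a ∈ 𝒜 (k • m)) :
    awayEval 𝒜 ε s hu (Away.mk 𝒜 hs k a ha) * ε s ^ k = ε a := by
  have h : algebraMap S (Localization.Away s) s ^ k *
      (Away.mk 𝒜 hs k a ha).val = algebraMap S (Localization.Away s) a := by
    rw [Away.val_mk, ← map_pow, ← Localization.mk_one_eq_algebraMap, Localization.mk_mul,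
      ← Localization.mk_one_eq_algebraMap, Localization.mk_eq_mk_iff, Localization.r_iff_exists]
    exact ⟨1, by simp⟩
  have h2 := congr(IsLocalization.Away.lift (S := Localization.Away s) s hu $h)
  rw [map_mul, map_pow, IsLocalization.Away.lift_eq, IsLocalization.Away.lift_eq] at h2
  rw [← h2, mul_comm]
  rfl

lemma awayEval_mk_eq (hu : IsUnit (ε s)) (hs : s ∈ 𝒜 m) (k : ℕ) (a : S) (ha : a ∈ 𝒜 (k • m))
    {r : R} (hr : r * ε s ^ k = ε a) : awayEval 𝒜 ε s hu (Away.mk 𝒜 hs k a ha) = r :=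
  (hu.pow k).mul_right_cancel ((awayEval_mk ..).trans hr.symm)

lemma awayEval_eq_iff (hu : IsUnit (ε s)) (hs : s ∈ 𝒜 m) (f : Away 𝒜 s →+* R) :
    f = awayEval 𝒜 ε s hu ↔
      ∀ (k : ℕ) (a : S) (ha : a ∈ 𝒜 (k • m)), f (Away.mk 𝒜 hs k a ha) * ε s ^ k = ε a := by
  refine ⟨fun h k a ha ↦ by rw [h, awayEval_mk], fun h ↦ RingHom.ext fun z ↦ ?_⟩
  obtain ⟨k, a, ha, rfl⟩ := Away.mk_surjective 𝒜 hs z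
  exact (awayEval_mk_eq 𝒜 ε hu hs k a ha (h k a ha)).symm

/-- The `R`-valued point of `Proj 𝒜` given by a homomorphism `ε` to `R` for which the image of some
homogeneous element `s` is a unit. -/
def projPoint (hs : s ∈ 𝒜 m) (hm : 0 < m) (hu : IsUnit (ε s)) : Spec (.of R) ⟶ Proj 𝒜 :=
  Spec.map (CommRingCat.ofHom (awayEval 𝒜 ε s hu)) ≫ Proj.awayι 𝒜 s hs hm

variable {ε}

/-- The point given on `D₊(s)` factors through `D₊(s s')`, and the evaluation there restricts to the
one on `D₊(s)`. Applied twice, this shows that the point does not depend on the denominator chosen.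
-/
lemma projPoint_mul (hs : s ∈ 𝒜 m) (hm : 0 < m) (hu : IsUnit (ε s)) (hs' : s' ∈ 𝒜 m')
    (hu' : IsUnit (ε s')) :
    projPoint 𝒜 ε (SetLike.mul_mem_graded hs hs') (hm.trans_le (m.le_add_right m'))
      (by rw [map_mul]; exact hu.mul hu') = projPoint 𝒜 ε hs hm hu := by
  rw [projPoint, projPoint, ← Proj.SpecMap_awayMap_awayι 𝒜 hs hm hs' rfl, ← Category.assoc,
    ← Spec.map_comp, ← CommRingCat.ofHom_comp]
  congr 3
  rw [awayEval_eq_iff 𝒜 ε hu hs]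
  intro k a ha
  rw [RingHom.comp_apply, awayMap_mk]
  apply (hu'.pow k).mul_right_cancel
  rw [mul_assoc, ← mul_pow, ← map_pow ε s' k, ← map_mul ε a]
  exact (congrArg (fun y ↦ _ * y ^ k) (map_mul ε s s').symm).trans (awayEval_mk 𝒜 ε ..)

lemma projPoint_eq (hs : s ∈ 𝒜 m) (hm : 0 < m) (hu : IsUnit (ε s)) (hs' : s' ∈ 𝒜 m')
    (hm' : 0 < m') (hu' : IsUnit (ε s')) :
    projPoint 𝒜 ε hs hm hu = projPoint 𝒜 ε hs' hm' hu' := by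
  rw [← projPoint_mul 𝒜 hs hm hu hs' hu', ← projPoint_mul 𝒜 hs' hm' hu' hs hu]
  congr! 1
  · exact mul_comm _ _
  · exact add_comm _ _

/-- Numerator and denominator of a fraction of degree zero are scaled by the same power of `u`. No
unit hypothesis on `u` is needed: `u ^ m` is a unit because `ε' s` is. -/
lemma projPoint_congr {ε' : S →+* R} (u : R) (hs : s ∈ 𝒜 m) (hm : 0 < m)
    (hu : IsUnit (ε s)) (hu' : IsUnit (ε' s))
    (h : ∀ k, ∀ a ∈ 𝒜 k, ε' a = u ^ k * ε a) :
    projPoint 𝒜 ε' hs hm hu' = projPoint 𝒜 ε hs hm hu := by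
  rw [projPoint, projPoint]
  congr 3
  rw [awayEval_eq_iff 𝒜 ε hu hs]
  intro k a ha
  have h1 := awayEval_mk 𝒜 ε' hu' hs k a ha
  rw [h _ _ hs, h _ _ ha] at h1
  have hum : IsUnit (u ^ (k • m)) := by
    rw [h _ _ hs] at hu'
    rw [smul_eq_mul, mul_comm, pow_mul]
    exact (isUnit_of_mul_isUnit_left hu').pow k
  apply hum.mul_left_cancel
  rw [← h1]
  ring

lemma specMap_projPoint {R' : Type} [CommRing R'] (φ : R →+* R') (hs : s ∈ 𝒜 m) (hm : 0 < m)
    (hu : IsUnit (ε s)) : Spec.map (CommRingCat.ofHom φ) ≫ projPoint 𝒜 ε hs hm hu =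
      projPoint 𝒜 (φ.comp ε) hs hm (hu.map φ) := by
  rw [projPoint, projPoint, ← Category.assoc, ← Spec.map_comp, ← CommRingCat.ofHom_comp]
  congr 3
  rw [awayEval_eq_iff 𝒜 (φ.comp ε) (hu.map φ) hs]
  intro k a ha
  rw [RingHom.comp_apply, RingHom.comp_apply, RingHom.comp_apply, ← map_pow, ← map_mul,
    awayEval_mk]

variable {T τ : Type} [CommRing T] [SetLike τ T] [AddSubgroupClass τ T]
  {ℬ : ℕ → τ} [GradedRing ℬ]

lemma projPoint_map (f : 𝒜 →+*ᵍ ℬ) (hf : HomogeneousIdeal.irrelevant ℬ ≤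
      (HomogeneousIdeal.irrelevant 𝒜).map f) {δ : T →+* R} (hε : ∀ a, δ (f a) = ε a)
    (hs : s ∈ 𝒜 m) (hm : 0 < m) (hu : IsUnit (ε s)) (hfs : f s ∈ ℬ m) (hu' : IsUnit (δ (f s))) :
    projPoint ℬ δ hfs hm hu' ≫ Proj.map f hf = projPoint 𝒜 ε hs hm hu := by
  have e := Proj.awayι_comp_map f hf hm s hs
  refine (Category.assoc _ _ _).trans ((congrArg _ e).trans ?_)
  rw [projPoint, ← Category.assoc, ← Spec.map_comp, ← CommRingCat.ofHom_comp]
  congr 3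
  rw [awayEval_eq_iff 𝒜 ε hu hs]
  intro k a ha
  rw [RingHom.comp_apply, Away.map_mk, ← hε, ← hε]
  exact awayEval_mk ℬ δ hu' _ k _ _

end ProjPoint

attribute [local instance] MvPolynomial.gradedAlgebra

/-! ### Points and charts of projective space -/

section ProjSpace

open HomogeneousLocalization

variable {n : ℕ} {A R : Type} [CommRing A] [CommRing R]

lemma X_mem (i : Fin (n + 1)) :
    (MvPolynomial.X i : MvPolynomial (Fin (n + 1)) A) ∈ polyGrading n A 1 :=
  MvPolynomial.isHomogeneous_X A i

lemma C_mem (a : A) :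
    (MvPolynomial.C a : MvPolynomial (Fin (n + 1)) A) ∈ polyGrading n A 0 :=
  MvPolynomial.isHomogeneous_C _ a

lemma irrelevant_le_span_X :
    (HomogeneousIdeal.irrelevant (polyGrading n A)).toIdeal ≤
      Ideal.span (Set.range (MvPolynomial.X : Fin (n + 1) → MvPolynomial (Fin (n + 1)) A)) := by
  rw [← Set.image_univ, HomogeneousIdeal.toIdeal_irrelevant_le]
  intro i hi p hp
  change p ∈ Ideal.span _
  rw [MvPolynomial.mem_ideal_span_X_image]
  intro m hm
  by_contra! hcon
  have hp' : p.IsHomogeneous i := hp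
  have := hp'.degree_eq_sum_deg_support hm
  have h0 : m = 0 := by ext j; exact hcon j trivial
  subst h0
  simp at this
  omega

lemma exists_mem_basicOpen_X (x : projSpace n A) :
    ∃ i, x ∈ Proj.basicOpen (polyGrading n A) (MvPolynomial.X i) := by
  have h := (Proj.iSup_basicOpen_eq_top (polyGrading n A) _ irrelevant_le_span_X).ge
    (Set.mem_univ x)
  exact TopologicalSpace.Opens.mem_iSup.1 h

/-- The affine chart `D₊(x_i)` of projective space. -/
abbrev awayX (n : ℕ) (A : Type) [CommRing A] (i : Fin (n + 1)) : Type :=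
  Away (polyGrading n A) (MvPolynomial.X i)

/-- The inclusion of the affine chart `D₊(x_i)`. -/
def chartX (i : Fin (n + 1)) : Spec (.of (awayX n A i)) ⟶ projSpace n A :=
  Proj.awayι (polyGrading n A) (MvPolynomial.X i) (X_mem i) one_pos

instance (i : Fin (n + 1)) : IsOpenImmersion (chartX (A := A) i) := by
  unfold chartX; infer_instance

lemma range_chartX (i : Fin (n + 1)) : Set.range (chartX (A := A) i) =
    Proj.basicOpen (polyGrading n A) (MvPolynomial.X i) :=
  congrArg SetLike.coe (Proj.opensRange_awayι (polyGrading n A) (MvPolynomial.X i)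
    (X_mem i) one_pos)

lemma exists_mem_range_chartX (x : projSpace n A) : ∃ i, x ∈ Set.range (chartX (A := A) i) := by
  obtain ⟨i, hi⟩ := exists_mem_basicOpen_X x
  exact ⟨i, by rwa [range_chartX]⟩

variable (σ : A →+* R) (w : Fin (n + 1) → R)

/-- The homomorphism from the coordinate ring of the chart `D₊(x_i)` given by homogeneous
coordinates. -/
def evalX (i : Fin (n + 1)) (hi : IsUnit (w i)) : awayX n A i →+* R :=
  awayEval (polyGrading n A) (MvPolynomial.eval₂Hom σ w) (MvPolynomial.X i) (by simpa using hi)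

lemma evalX_mk (i : Fin (n + 1)) (hi : IsUnit (w i)) (k : ℕ) (a : MvPolynomial (Fin (n + 1)) A)
    (ha : a ∈ polyGrading n A (k • 1)) :
    evalX σ w i hi (Away.mk _ (X_mem i) k a ha) * w i ^ k =
      MvPolynomial.eval₂ σ w a := by
  have := awayEval_mk (polyGrading n A) (MvPolynomial.eval₂Hom σ w) (s := MvPolynomial.X i)
    (by simpa using hi) (X_mem i) k a ha
  have e : MvPolynomial.eval₂Hom σ w (MvPolynomial.X i) = w i := MvPolynomial.eval₂_X ..
  exact (congrArg (_ * · ^ k) e.symm).trans this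

/-- The point `[w₀ : ⋯ : w_n]` of projective space with values in `R`. -/
def projPt (hw : ∃ i, IsUnit (w i)) : Spec (.of R) ⟶ projSpace n A :=
  Spec.map (CommRingCat.ofHom (evalX σ w hw.choose hw.choose_spec)) ≫ chartX hw.choose

lemma eval₂_mul_of_mem (u : R) {k : ℕ} {a : MvPolynomial (Fin (n + 1)) A}
    (ha : a ∈ polyGrading n A k) :
    MvPolynomial.eval₂ σ (fun i ↦ u * w i) a = u ^ k * MvPolynomial.eval₂ σ w a := by
  rw [MvPolynomial.eval₂_eq, MvPolynomial.eval₂_eq, Finset.mul_sum]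
  refine Finset.sum_congr rfl fun m hm ↦ ?_
  have hd := MvPolynomial.IsHomogeneous.degree_eq_sum_deg_support ha hm
  simp only [mul_pow, Finset.prod_mul_distrib]
  rw [Finset.prod_pow_eq_pow_sum, ← hd]
  ring

variable {σ w}

lemma projPt_eq_projPoint {s : MvPolynomial (Fin (n + 1)) A} {m : ℕ} (hs : s ∈ polyGrading n A m)
    (hm : 0 < m) (hu : IsUnit (MvPolynomial.eval₂Hom σ w s)) (hw : ∃ i, IsUnit (w i)) :
    projPt σ w hw = projPoint (polyGrading n A) (MvPolynomial.eval₂Hom σ w) hs hm hu :=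
  projPoint_eq _ _ _ _ _ _ _

lemma projPt_eq (i : Fin (n + 1)) (hi : IsUnit (w i)) :
    projPt σ w ⟨i, hi⟩ = Spec.map (CommRingCat.ofHom (evalX σ w i hi)) ≫ chartX i :=
  projPt_eq_projPoint (X_mem i) one_pos (by simpa using hi) _

lemma projPt_smul {w' : Fin (n + 1) → R} (u : R) (hw : ∃ i, IsUnit (w i))
    (hw' : ∃ i, IsUnit (w' i)) (h : ∀ i, w' i = u * w i) : projPt σ w' hw' = projPt σ w hw := by
  obtain ⟨i, hi⟩ := hw'
  have hi2 : IsUnit (w i) := by rw [h] at hi; exact isUnit_of_mul_isUnit_right hi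
  rw [projPt_eq_projPoint (X_mem i) one_pos (by simpa using hi) _,
    projPt_eq_projPoint (X_mem i) one_pos (by simpa using hi2) _]
  refine projPoint_congr (polyGrading n A) u _ _ _ _ fun k a ha ↦ ?_
  obtain rfl : w' = fun i ↦ u * w i := funext h
  exact eval₂_mul_of_mem σ w u ha

lemma specMap_projPt {R' : Type} [CommRing R'] (φ : R →+* R') (hw : ∃ i, IsUnit (w i))
    (hw' : ∃ i, IsUnit (φ (w i))) :
    Spec.map (CommRingCat.ofHom φ) ≫ projPt σ w hw = projPt (φ.comp σ) (fun i ↦ φ (w i)) hw' := by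
  obtain ⟨i, hi⟩ := hw
  rw [projPt_eq_projPoint (X_mem i) one_pos (by simpa using hi) _,
    projPt_eq_projPoint (X_mem i) one_pos (by simpa using hi.map φ) _,
    specMap_projPoint]
  congr 1
  ext <;> simp

lemma projPt_map {m : ℕ} {B : Type} [CommRing B] (f : polyGrading n A →+*ᵍ polyGrading m B)
    (hf : HomogeneousIdeal.irrelevant (polyGrading m B) ≤
      (HomogeneousIdeal.irrelevant (polyGrading n A)).map f) {τ : B →+* R} {v : Fin (m + 1) → R}
    (hv : ∃ i, IsUnit (v i)) (hw : ∃ i, IsUnit (w i))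
    (hC : ∀ a, MvPolynomial.eval₂ τ v (f (MvPolynomial.C a)) = σ a)
    (hX : ∀ i, MvPolynomial.eval₂ τ v (f (MvPolynomial.X i)) = w i) :
    projPt τ v hv ≫ Proj.map f hf = projPt σ w hw := by
  obtain ⟨i, hi⟩ := hw
  have hi' : IsUnit (MvPolynomial.eval₂Hom τ v (f (MvPolynomial.X i))) := by
    rw [MvPolynomial.coe_eval₂Hom, hX]; exact hi
  rw [projPt_eq_projPoint (X_mem i) one_pos (by simpa using hi) _,
    projPt_eq_projPoint (f.map_mem (X_mem i)) one_pos hi' hv]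
  refine projPoint_map _ f hf ?_ _ _ _ _ _
  have : (MvPolynomial.eval₂Hom τ v).comp (f : _ →+* _) = MvPolynomial.eval₂Hom σ w := by
    ext j
    · simpa using hC _
    · simpa using hX j
  exact fun a ↦ congr($this a)

lemma chartX_toSpec (i : Fin (n + 1)) : chartX i ≫ projSpaceToSpec n A =
    Spec.map (CommRingCat.ofHom ((fromZeroRingHom (polyGrading n A) _).comp
      (algebraMap A (polyGrading n A 0)))) := by
  rw [chartX, projSpaceToSpec, Proj.awayι_toSpecZero_assoc, ← Spec.map_comp]
  rfl

lemma projPt_toSpec (hw : ∃ i, IsUnit (w i)) :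
    projPt σ w hw ≫ projSpaceToSpec n A = Spec.map (CommRingCat.ofHom σ) := by
  obtain ⟨i, hi⟩ := hw
  rw [projPt_eq i hi, Category.assoc, chartX_toSpec, ← Spec.map_comp, ← CommRingCat.ofHom_comp]
  congr 2
  ext a
  have := evalX_mk σ w i hi 0 (MvPolynomial.C a) (by simp)
  rw [pow_zero, mul_one, MvPolynomial.eval₂_C] at this
  rw [← this]
  rw [RingHom.comp_apply]
  congr 1

end ProjSpace

/-! ### Projective models -/

section

open HomogeneousLocalization

variable {n : ℕ} {A K : Type} [CommRing A] [Field K] (σ : A →+* K) (w : Fin (n + 1) → K)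

lemma range_evalX_le {i : Fin (n + 1)} (hi : IsUnit (w i)) {B : Subring K} (hσ : ∀ a, σ a ∈ B)
    (hw : ∀ j, w j / w i ∈ B) : (evalX σ w i hi).range ≤ B := by
  rintro _ ⟨z, rfl⟩
  obtain ⟨k, a, ha, rfl⟩ := Away.mk_surjective _ (X_mem i) z
  have h1 := evalX_mk σ w i hi k a ha
  have h2 := eval₂_mul_of_mem σ (fun j ↦ w j / w i) (w i) ha
  have e : (fun j ↦ w i * (w j / w i)) = w := funext fun j ↦ mul_div_cancel₀ _ hi.ne_zero
  rw [e] at h2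
  rw [h2, mul_comm, smul_eq_mul, mul_one] at h1
  rw [mul_left_cancel₀ (pow_ne_zero k hi.ne_zero) h1]
  exact MvPolynomial.eval₂_mem (fun _ _ ↦ hσ _) hw

lemma div_mem_range_evalX (i : Fin (n + 1)) (hi : IsUnit (w i)) (j : Fin (n + 1)) :
    w j / w i ∈ (evalX σ w i hi).range := by
  refine ⟨Away.mk _ (X_mem i) 1 (MvPolynomial.X j) (by rw [one_smul]; exact X_mem j), ?_⟩
  rw [eq_div_iff hi.ne_zero, ← pow_one (w i), evalX_mk, MvPolynomial.eval₂_X]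

lemma map_mem_range_evalX (i : Fin (n + 1)) (hi : IsUnit (w i)) (a : A) :
    σ a ∈ (evalX σ w i hi).range := by
  refine ⟨Away.mk _ (X_mem i) 0 (MvPolynomial.C a) (by rw [zero_smul]; exact C_mem a), ?_⟩
  rw [← mul_one (evalX _ _ _ _ _), ← pow_zero (w i), evalX_mk, MvPolynomial.eval₂_C]

variable {σ w}

/-- A point of `Spec K` is the zero ideal, so lying in `D₊(x_i)` means that the value `w i / w j` of
the coordinate function on a chart `D₊(x_j)` containing the point is nonzero. -/
lemma mem_range_chartX_iff (hw : ∃ i, IsUnit (w i)) (x : Spec (.of K)) (i : Fin (n + 1)) :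
    projPt σ w hw x ∈ Set.range (chartX (A := A) i) ↔ w i ≠ 0 := by
  obtain ⟨j, hj⟩ := hw
  rw [range_chartX, projPt_eq j hj, SetLike.mem_coe]
  change Spec.map (CommRingCat.ofHom (evalX σ w j hj)) x ∈ chartX j ⁻¹ᵁ (Proj.basicOpen (polyGrading n A) (MvPolynomial.X i)) ↔ _
  have h := Proj.awayι_preimage_basicOpen (polyGrading n A) (X_mem j) one_pos (X_mem i) one_pos
  have h0 : x.asIdeal = ⊥ := (Ideal.eq_bot_or_top x.asIdeal).resolve_right x.2.ne_top
  rw [chartX, h]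
  change evalX σ w j hj _ ∉ x.asIdeal ↔ _
  rw [h0, Ideal.mem_bot]
  have h1 := evalX_mk σ w j hj 1 (MvPolynomial.X i ^ 1) (by rw [one_smul, pow_one]; exact X_mem i)
  rw [MvPolynomial.eval₂_pow, MvPolynomial.eval₂_X] at h1
  refine not_congr (Iff.trans ?_ (pow_eq_zero_iff one_ne_zero))
  rw [← h1]
  exact (mul_eq_zero_iff_right (pow_ne_zero 1 hj.ne_zero)).symm

lemma hasCenter_projPt (hw : ∃ i, IsUnit (w i)) {B : Subring K} (i : Fin (n + 1)) (hi : w i ≠ 0)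
    (hσ : ∀ a, σ a ∈ B) (hB : ∀ j, w j / w i ∈ B) : HasCenter (projPt σ w hw) B := by
  have h := range_evalX_le σ w (i := i) hi.isUnit hσ hB
  refine ⟨Spec.map (CommRingCat.ofHom ((evalX σ w i hi.isUnit).codRestrict B
    fun z ↦ h ⟨z, rfl⟩)) ≫ chartX i, ?_⟩
  rw [projPt_eq i hi.isUnit, genPt, ← Category.assoc, ← Spec.map_comp]
  rfl

/-- The hypothesis says that no nonzero form vanishes at `w`, that is, `w` is a generic point of
projective space. -/
lemma evalX_injective (i : Fin (n + 1)) (hi : IsUnit (w i))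
    (h : ∀ k, ∀ a ∈ polyGrading n A k, MvPolynomial.eval₂ σ w a = 0 → a = 0) :
    Function.Injective (evalX σ w i hi) := by
  rw [injective_iff_map_eq_zero]
  intro z hz
  obtain ⟨k, a, ha, rfl⟩ := Away.mk_surjective _ (X_mem i) z
  have h1 := evalX_mk σ w i hi k a ha
  rw [hz, zero_mul] at h1
  obtain rfl := h _ a ha h1.symm
  apply HomogeneousLocalization.val_injective
  rw [Away.val_mk, HomogeneousLocalization.val_zero, Localization.mk_zero]

lemma isChart_projSpace (h : ∀ k, ∀ a ∈ polyGrading n A k, MvPolynomial.eval₂ σ w a = 0 → a = 0)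
    (i : Fin (n + 1)) (hi : IsUnit (w i)) :
    ∃ c, IsChart (projPt σ w ⟨i, hi⟩) (evalX σ w i hi).range c ∧
      Set.range c = Set.range (chartX (A := A) i) :=
  IsChart.of_injective _ (evalX_injective i hi h) (chartX i) (projPt_eq i hi).symm rfl

lemma coveredBy_projSpace (h : ∀ k, ∀ a ∈ polyGrading n A k, MvPolynomial.eval₂ σ w a = 0 → a = 0)
    (hw : ∀ i, IsUnit (w i)) :
    CoveredBy (projPt σ w ⟨0, hw 0⟩) (Set.range fun i ↦ (evalX σ w i (hw i)).range) := fun x ↦ by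
  obtain ⟨i, hi⟩ := exists_mem_range_chartX x
  obtain ⟨c, hc, hc'⟩ := isChart_projSpace h i (hw i)
  exact ⟨_, ⟨i, rfl⟩, c, hc, hc' ▸ hi⟩

end

/-- Functions on the image inject into functions on the source, so the map onto the image is
scheme-theoretically dominant and reducedness descends. -/
lemma isReduced_image {X Y : Scheme.{0}} (f : X ⟶ Y) [QuasiCompact f] [IsReduced X] :
    IsReduced f.image := by
  have : IsSchemeTheoreticallyDominant f.toImage := by
    refine ⟨Scheme.IdealSheafData.ext_of_iSup_eq_top
      (fun U : Y.affineOpens ↦ ⟨f.imageι ⁻¹ᵁ U.1, U.2.preimage f.imageι⟩) ?_ fun U ↦ ?_⟩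
    · rw [← Scheme.Hom.preimage_iSup, iSup_affineOpens_eq_top]; rfl
    · rw [Scheme.Hom.ker_apply]
      exact (RingHom.injective_iff_ker_eq_bot _).1 (f.toImage_app_injective U)
  exact IsSchemeTheoreticallyDominant.isReduced f.toImage

section ProjModel

variable {n : ℕ} {K : Type} [Field K] [Algebra ℝ K] (w : Fin (n + 1) → K)
  (hw : ∃ i, IsUnit (w i))

/-- The projective variety with generic point `[w₀ : ⋯ : w_n]`. -/
def projModel : RealScheme :=
  Over.mk ((projPt (algebraMap ℝ K) w hw).imageι ≫ projSpaceToSpec n ℝ)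

/-- The generic point of `projModel`. -/
def projModelPt : Spec (.of K) ⟶ (projModel w hw).left := (projPt (algebraMap ℝ K) w hw).toImage

/-- The embedding of `projModel` in projective space. -/
def projModelι : projModel w hw ⟶ realProjSpace n :=
  Over.homMk (projPt (algebraMap ℝ K) w hw).imageι rfl

instance : IsClosedImmersion (projModelι w hw).left :=
  inferInstanceAs (IsClosedImmersion (projPt (algebraMap ℝ K) w hw).imageι)

@[simp]
lemma projModelPt_ι : projModelPt w hw ≫ (projModelι w hw).left = projPt (algebraMap ℝ K) w hw :=
  Scheme.Hom.toImage_imageι _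

instance : (projModel w hw).left.IsSeparated := ⟨by
  let ι : (projModel w hw).left ⟶ projSpace n ℝ := (projModelι w hw).left
  have : IsClosedImmersion ι := inferInstanceAs (IsClosedImmersion (projModelι w hw).left)
  rw [← terminal.comp_from ι]
  infer_instance⟩

instance : IsDominant (projModelPt w hw) :=
  inferInstanceAs (IsDominant (projPt (algebraMap ℝ K) w hw).toImage)

/-- Inside `D₊(x_i)` the closed image is the spectrum of a quotient of the chart ring. The generic
point embeds this quotient in `K`, and the image of the embedding is that of the whole chart ring.
-/
lemma isChart_projModel (i : Fin (n + 1)) (hi : IsUnit (w i)) :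
    ∃ c, IsChart (projModelPt w hw) (evalX (algebraMap ℝ K) w i hi).range c ∧
      Set.range c = (projModelι w hw).left ⁻¹' Set.range (chartX (A := ℝ) i) := by
  let ι : (projModel w hw).left ⟶ projSpace n ℝ := (projModelι w hw).left
  have hcl : IsClosedImmersion ι := inferInstanceAs (IsClosedImmersion (projModelι w hw).left)
  have : IsReduced (projModel w hw).left := isReduced_image (projPt (algebraMap ℝ K) w hw)
  have : IsReduced (pullback ι (chartX (A := ℝ) i)) :=
    isReduced_of_isOpenImmersion (pullback.fst ι (chartX i))
  have hcl2 : IsClosedImmersion (pullback.snd ι (chartX (A := ℝ) i)) := inferInstance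
  obtain ⟨I, e, he⟩ := IsClosedImmersion.Spec_iff.1 hcl2
  have hred : IsReduced (Spec (.of (awayX n ℝ i ⧸ I))) := isReduced_of_isOpenImmersion e.inv
  have hη : projModelPt w hw ≫ ι =
      Spec.map (CommRingCat.ofHom (evalX (algebraMap ℝ K) w i hi)) ≫ chartX i := by
    rw [← projPt_eq i hi]; exact projModelPt_ι w hw
  let q : Spec (.of K) ⟶ pullback ι (chartX (A := ℝ) i) := pullback.lift _ _ hη
  have hq : IsDominant q := by
    have : IsDominant (q ≫ pullback.fst ι (chartX (A := ℝ) i)) := by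
      rw [pullback.lift_fst]; infer_instance
    exact IsDominant.of_comp_of_isOpenImmersion _ (pullback.fst ι (chartX (A := ℝ) i))
  let ψ := Spec.preimage (q ≫ e.hom)
  have hψ : Spec.map ψ = q ≫ e.hom := Spec.map_preimage _
  have hψ1 : Spec.map (CommRingCat.ofHom (Ideal.Quotient.mk I) ≫ ψ) =
      Spec.map (CommRingCat.ofHom (evalX (algebraMap ℝ K) w i hi)) := by
    rw [Spec.map_comp, hψ, Category.assoc, ← he]
    exact pullback.lift_snd _ _ _
  have hψ2 : ψ.hom.comp (Ideal.Quotient.mk I) = evalX (algebraMap ℝ K) w i hi :=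
    congr(($(Spec.map_injective hψ1)).hom)
  -- Dominance puts the kernel inside the nilradical, which vanishes because the image is reduced.
  have hinj : Function.Injective ψ.hom := by
    have hd : IsDominant (Spec.map ψ) := by rw [hψ]; infer_instance
    have h1 := (PrimeSpectrum.denseRange_comap_iff_ker_le_nilRadical ψ.hom).1 hd.1
    have hr : _root_.IsReduced (awayX n ℝ i ⧸ I) := by
      have := (affine_isReduced_iff (.of (awayX n ℝ i ⧸ I))).1 hred
      exact this
    rw [nilradical_eq_zero] at h1
    exact (RingHom.injective_iff_ker_eq_bot _).2 (le_bot_iff.1 h1)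
  have hrange : ψ.hom.range = (evalX (algebraMap ℝ K) w i hi).range := by
    rw [← hψ2, RingHom.range_eq_map, RingHom.range_eq_map, ← Subring.map_map,
      ← RingHom.range_eq_map (Ideal.Quotient.mk I),
      RingHom.range_eq_top.2 Ideal.Quotient.mk_surjective]
  obtain ⟨c, hc, hc'⟩ := IsChart.of_injective (η := projModelPt w hw) ψ.hom hinj
    (e.inv ≫ pullback.fst ι (chartX (A := ℝ) i)) (by
      change Spec.map ψ ≫ _ = _
      rw [hψ, Category.assoc, e.hom_inv_id_assoc]
      exact pullback.lift_fst _ _ _) hrange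
  refine ⟨c, hc, hc'.trans ?_⟩
  rw [Scheme.Hom.comp_base, TopCat.coe_comp, Set.range_comp, e.inv.surjective.range_eq,
    Set.image_univ, IsOpenImmersion.range_pullbackFst]
  rfl

/-- Indices with `w i = 0` contribute nothing: a nonempty preimage of `D₊(x_i)` is open, so it
contains the dense generic point, which forces `w i ≠ 0`. -/
lemma coveredBy_projModel : CoveredBy (projModelPt w hw)
    {B | ∃ (i : Fin (n + 1)) (hi : IsUnit (w i)), B = (evalX (algebraMap ℝ K) w i hi).range} := by
  intro x
  obtain ⟨i, hi⟩ := exists_mem_range_chartX ((projModelι w hw).left x)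
  have hi' : w i ≠ 0 := by
    have hU : IsOpen ((projModelι w hw).left ⁻¹' Set.range (chartX (A := ℝ) i)) :=
      (chartX (A := ℝ) i).isOpenEmbedding.isOpen_range.preimage (projModelι w hw).left.continuous
    obtain ⟨y, hy, z, rfl⟩ := (projModelPt w hw).denseRange.inter_open_nonempty _ hU ⟨x, hi⟩
    rw [← mem_range_chartX_iff (σ := algebraMap ℝ K) hw z i, ← projModelPt_ι w hw]
    exact hy
  obtain ⟨c, hc, hc'⟩ := isChart_projModel w hw i hi'.isUnit
  exact ⟨_, ⟨i, hi'.isUnit, rfl⟩, c, hc, hc' ▸ hi⟩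

end ProjModel

/-! ### Rings of functions -/

section Rings

variable {K : Type} [Field K] [Algebra ℝ K]

/-- The subring of `K` generated over `ℝ` by `s`. -/
def rng (s : Set K) : Subring K := (Algebra.adjoin ℝ s).toSubring

lemma mem_rng {s : Set K} {a : K} (h : a ∈ s) : a ∈ rng s := Algebra.subset_adjoin h

lemma algebraMap_mem_rng (s : Set K) (r : ℝ) : algebraMap ℝ K r ∈ rng s :=
  (Algebra.adjoin ℝ s).algebraMap_mem r

lemma rng_le {s : Set K} {B : Subring K} (hr : ∀ r, algebraMap ℝ K r ∈ B) (h : s ⊆ B) :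
    rng s ≤ B := by
  let S : Subalgebra ℝ K := { B with algebraMap_mem' := hr }
  exact fun a ha ↦ (Algebra.adjoin_le h : Algebra.adjoin ℝ s ≤ S) ha

lemma rng_le_rng {s s' : Set K} (h : s ⊆ rng s') : rng s ≤ rng s' :=
  rng_le (algebraMap_mem_rng s') h

lemma rng_mono {s s' : Set K} (h : s ⊆ s') : rng s ≤ rng s' :=
  rng_le_rng fun _ ha ↦ mem_rng (h ha)

/-- Most chart functions below are monomials in two generators, so membership is proved by naming
the two exponents. -/
lemma pow_mul_pow_mem {B : Subring K} {a b : K} (ha : a ∈ B) (hb : b ∈ B) (m n : ℕ) {c : K}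
    (hc : c = a ^ m * b ^ n) : c ∈ B := by
  rw [hc]; exact B.mul_mem (B.pow_mem ha m) (B.pow_mem hb n)

lemma mem_rng_left (a b : K) : a ∈ rng {a, b} := mem_rng (by simp)

lemma mem_rng_right (a b : K) : b ∈ rng {a, b} := mem_rng (by simp)

lemma mem_rng_pair {a b : K} (m n : ℕ) {c : K} (hc : c = a ^ m * b ^ n) : c ∈ rng {a, b} :=
  pow_mul_pow_mem (mem_rng_left a b) (mem_rng_right a b) m n hc

lemma pair_subset {B : Subring K} {a b : K} (ha : a ∈ B) (hb : b ∈ B) : {a, b} ⊆ (B : Set K) := by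
  rintro _ (rfl | rfl) <;> assumption

lemma triple_subset {B : Subring K} {a b c : K} (ha : a ∈ B) (hb : b ∈ B) (hc : c ∈ B) :
    {a, b, c} ⊆ (B : Set K) := by
  rintro _ (rfl | rfl | rfl) <;> assumption

variable {n : ℕ} (w : Fin (n + 1) → K)

lemma range_evalX_eq (i : Fin (n + 1)) (hi : IsUnit (w i)) :
    (evalX (algebraMap ℝ K) w i hi).range = rng (Set.range fun j ↦ w j / w i) := by
  refine le_antisymm (range_evalX_le _ _ hi (algebraMap_mem_rng _) fun j ↦ mem_rng ⟨j, rfl⟩)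
    (rng_le (map_mem_range_evalX _ _ i hi) ?_)
  rintro _ ⟨j, rfl⟩
  exact div_mem_range_evalX _ _ i hi j

lemma div_mem_rng (i j : Fin (n + 1)) : w j / w i ∈ rng (Set.range fun j ↦ w j / w i) :=
  mem_rng ⟨j, rfl⟩

lemma exists_isChart_projModel (hw : ∃ i, IsUnit (w i)) (i : Fin (n + 1)) (hi : w i ≠ 0) {s : Set K}
    (hs : s ⊆ rng (Set.range fun j ↦ w j / w i)) (hs' : ∀ j, w j / w i ∈ rng s) :
    ∃ c, IsChart (projModelPt w hw) (rng s) c := by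
  obtain ⟨c, hc, -⟩ := isChart_projModel w hw i hi.isUnit
  have e : (evalX (algebraMap ℝ K) w i hi.isUnit).range = rng s := by
    rw [range_evalX_eq]
    refine le_antisymm (rng_le_rng ?_) (rng_le_rng hs)
    rintro _ ⟨j, rfl⟩
    exact hs' j
  exact e ▸ ⟨c, hc⟩

/-- A larger ring gives a smaller open set, so charts whose rings contain the ring of a retained
chart are redundant. -/
lemma coveredBy_projModel_of (hw : ∃ i, IsUnit (w i)) {𝓑 : Set (Subring K)}
    (h𝓑 : ∀ B ∈ 𝓑, ∃ c, IsChart (projModelPt w hw) B c)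
    (h : ∀ i, w i ≠ 0 → ∃ B ∈ 𝓑, B ≤ rng (Set.range fun j ↦ w j / w i)) :
    CoveredBy (projModelPt w hw) 𝓑 := by
  refine (coveredBy_projModel w hw).refine_charts h𝓑 ?_
  rintro _ ⟨i, hi, rfl⟩
  rw [range_evalX_eq]
  exact h i hi.ne_zero

/-- The elements `a` and `b` form a transcendence basis. -/
def Coords (a b : K) : Prop := IsTranscendenceBasis ℝ ![a, b]

namespace Coords

variable {a b t x : K}

lemma isAlgebraic_left (a b : K) : IsAlgebraic (Algebra.adjoin ℝ (Set.range ![a, b])) a :=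
  isAlgebraic_algebraMap (⟨a, Algebra.subset_adjoin ⟨0, rfl⟩⟩ :
    Algebra.adjoin ℝ (Set.range ![a, b]))

lemma isAlgebraic_right (a b : K) : IsAlgebraic (Algebra.adjoin ℝ (Set.range ![a, b])) b :=
  isAlgebraic_algebraMap (⟨b, Algebra.subset_adjoin ⟨1, rfl⟩⟩ :
    Algebra.adjoin ℝ (Set.range ![a, b]))

/-- The pair `t, x` shows that the transcendence degree is two, so two elements over which `K` is
algebraic must be independent. -/
lemma of_isAlgebraic (h : Coords t x)
    (ht : IsAlgebraic (Algebra.adjoin ℝ (Set.range ![a, b])) t)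
    (hx : IsAlgebraic (Algebra.adjoin ℝ (Set.range ![a, b])) x) : Coords a b := by
  have : Algebra.IsAlgebraic (Algebra.adjoin ℝ (Set.range ![a, b])) K := by
    refine (IsTranscendenceBasis.isAlgebraic_iff h).2 fun i ↦ ?_
    fin_cases i
    exacts [ht, hx]
  exact Algebra.IsAlgebraic.isTranscendenceBasis_of_le_trdeg_of_finite ℝ _ (IsTranscendenceBasis.cardinalMk_eq_trdeg h).le

lemma right_ne_zero (h : Coords t x) : x ≠ 0 := h.1.ne_zero 1

lemma left_ne_zero (h : Coords t x) : t ≠ 0 := h.1.ne_zero 0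

lemma eq_zero_of_aeval (h : Coords t x) {p : MvPolynomial (Fin 2) ℝ}
    (hp : MvPolynomial.aeval ![t, x] p = 0) : p = 0 :=
  (injective_iff_map_eq_zero _).1 h.1 p hp

lemma transcendental_left (h : Coords t x) : Transcendental ℝ t := h.1.transcendental 0

lemma one_add_sq_ne_zero (h : Coords t x) : 1 + t ^ 2 ≠ 0 := by
  intro h0
  refine h.transcendental_left ⟨1 + Polynomial.X ^ 2, ?_, by simpa using h0⟩
  intro h1
  have := congrArg (Polynomial.eval 0) h1
  simp at this

end Coords

end Rings

/-! ### Ruled surfaces over the projective line -/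

section Ruled

variable {K : Type} [Field K] [Algebra ℝ K]

/-- The functions `t`, `s = 1/t` are coordinates on the base of a ruled surface and the functions
`x`, `y = t ^ k x` are coordinates on its fibres. -/
structure IsRuledData (t s x y : K) : Prop where
  coords : Coords t x
  mul_eq_one : t * s = 1
  exists_zpow : ∃ k : ℤ, y = t ^ k * x

namespace IsRuledData

variable {t s x y : K} (h : IsRuledData t s x y)

include h

lemma t_ne_zero : t ≠ 0 := left_ne_zero_of_mul_eq_one h.mul_eq_one

lemma x_ne_zero : x ≠ 0 := h.coords.right_ne_zero

lemma s_eq : s = t⁻¹ := eq_inv_of_mul_eq_one_right h.mul_eq_one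

lemma y_ne_zero : y ≠ 0 := by
  obtain ⟨k, rfl⟩ := h.exists_zpow
  exact mul_ne_zero (zpow_ne_zero _ h.t_ne_zero) h.x_ne_zero

/-- This exchanges the two halves of the base. Since `x = s ^ k * y`, the same exponent `k` serves.
-/
lemma symm : IsRuledData s t y x := by
  obtain ⟨k, hk⟩ := h.exists_zpow
  have hx : x = s ^ k * y := by
    rw [hk, ← mul_assoc, ← mul_zpow, mul_comm s, h.mul_eq_one, one_zpow, one_mul]
  have hs := Coords.isAlgebraic_left s y
  have hy := Coords.isAlgebraic_right s y
  have hsk : IsAlgebraic (Algebra.adjoin ℝ (Set.range ![s, y])) (s ^ k) := by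
    cases k with
    | ofNat k => rw [Int.ofNat_eq_natCast, zpow_natCast]; exact hs.pow k
    | negSucc k => rw [zpow_negSucc]; exact (hs.pow _).inv
  refine ⟨h.coords.of_isAlgebraic ?_ ?_, by rw [mul_comm, h.mul_eq_one], k, hx⟩
  · have : t = s⁻¹ := eq_inv_of_mul_eq_one_left h.mul_eq_one
    rw [this]; exact hs.inv
  · rw [hx]; exact hsk.mul hy

/-- Inverting the fibre coordinate exchanges the zero section and the section at infinity and
changes the sign of the exponent. -/
lemma inv : IsRuledData t s x⁻¹ y⁻¹ := by
  refine ⟨h.coords.of_isAlgebraic (Coords.isAlgebraic_left _ _) ?_, h.mul_eq_one, ?_⟩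
  · simpa using (Coords.isAlgebraic_right t x⁻¹).inv
  · obtain ⟨k, hk⟩ := h.exists_zpow
    exact ⟨-k, by rw [hk, mul_inv, zpow_neg]⟩

/-- The elementary transformation. -/
lemma elem : IsRuledData t s (x / (1 + t ^ 2)) (y / (1 + s ^ 2)) := by
  have ht := Coords.isAlgebraic_left t (x / (1 + t ^ 2))
  have h0 := h.coords.one_add_sq_ne_zero
  refine ⟨h.coords.of_isAlgebraic ht ?_, h.mul_eq_one, ?_⟩
  · have := (Coords.isAlgebraic_right t (x / (1 + t ^ 2))).mul (isAlgebraic_one.add (ht.pow 2))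
    rwa [div_mul_cancel₀ _ h0] at this
  · obtain ⟨k, hk⟩ := h.exists_zpow
    have h1 := h.symm.coords.one_add_sq_ne_zero
    -- The exponent rises by two because `1 + t ^ 2 = t ^ 2 * (1 + s ^ 2)`. This is how 𝔽_d turns
    -- into 𝔽_{d+2}.
    refine ⟨k + 2, ?_⟩
    have h2 : 1 + t ^ 2 = t ^ 2 * (1 + s ^ 2) := by
      linear_combination (-(t * s) - 1) * h.mul_eq_one
    have ht0 := h.t_ne_zero
    rw [hk, h2, zpow_add₀ h.t_ne_zero, zpow_ofNat]
    field_simp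

end IsRuledData

/-- The rings of functions on the four charts of a ruled surface over the projective line. -/
def ruledRings (t s x y : K) : Set (Subring K) :=
  {rng {t, x}, rng {s, y}, rng {t, x⁻¹}, rng {s, y⁻¹}}

/-- A scheme with the charts of a ruled surface over the projective line. -/
structure IsRuled {X : Scheme.{0}} (η : Spec (.of K) ⟶ X) (t s x y : K) : Prop where
  coveredBy : CoveredBy η (ruledRings t s x y)
  isChart : ∀ B ∈ ruledRings t s x y, ∃ c, IsChart η B c

lemma ruledRings_inv (t s x y : K) : ruledRings t s x⁻¹ y⁻¹ = ruledRings t s x y := by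
  ext B
  simp only [ruledRings, inv_inv, Set.mem_insert_iff, Set.mem_singleton_iff]
  tauto

/-- The rings of functions on the six charts of the blowing-up of a ruled surface at a pair of
conjugate points. -/
def elemRings (t s x y : K) : Set (Subring K) :=
  {rng {t, x / (1 + t ^ 2)}, rng {t, x, (1 + t ^ 2) / x}, rng {t, x⁻¹},
    rng {s, y / (1 + s ^ 2)}, rng {s, y, (1 + s ^ 2) / y}, rng {s, y⁻¹}}

/-- A scheme with the charts of the blowing-up of a ruled surface at a pair of conjugate points. -/
structure IsElem {X : Scheme.{0}} (η : Spec (.of K) ⟶ X) (t s x y : K) : Prop where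
  coveredBy : CoveredBy η (elemRings t s x y)
  isChart : ∀ B ∈ elemRings t s x y, ∃ c, IsChart η B c

/-- The map `x ↦ (1 + t ^ 2) / x` is an involution. Over each half of the base it preserves the
middle chart and exchanges the two outer ones, so the blown-up surface looks the same from either
end of the elementary transformation. -/
lemma elemRings_inv {t s x y : K} (h : IsRuledData t s x y) :
    elemRings t s (x / (1 + t ^ 2))⁻¹ (y / (1 + s ^ 2))⁻¹ = elemRings t s x y := by
  have key {t x : K} (h0 : 1 + t ^ 2 ≠ 0) : (x / (1 + t ^ 2))⁻¹ / (1 + t ^ 2) = x⁻¹ ∧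
      (1 + t ^ 2) / (x / (1 + t ^ 2))⁻¹ = x ∧
      ({t, (x / (1 + t ^ 2))⁻¹, x} : Set K) = {t, x, (1 + t ^ 2) / x} := by
    refine ⟨by rw [inv_div]; field_simp, by field_simp, ?_⟩
    rw [inv_div, Set.pair_comm]
  obtain ⟨h1, h2, h3⟩ := key (x := x) h.coords.one_add_sq_ne_zero
  obtain ⟨h4, h5, h6⟩ := key (x := y) h.symm.coords.one_add_sq_ne_zero
  ext B
  simp only [elemRings, h1, h2, h3, h4, h5, h6, inv_inv, Set.mem_insert_iff,
    Set.mem_singleton_iff]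
  tauto

/-- Homogeneous coordinates of the generic point of the Hirzebruch surface of degree `d`. -/
def hVec (d : ℕ) (t x : K) : Fin (5 + 1) → K :=
  ![1, t, x, x * t, x * t ^ d, x * t ^ (d + 1)]

lemma exists_isUnit_hVec (d : ℕ) (t x : K) : ∃ i, IsUnit (hVec d t x i) := ⟨0, isUnit_one⟩

section hVec

variable {t x : K} (ht : t ≠ 0) (hx : x ≠ 0) (d : ℕ)

include ht hx

/-- The six coordinates are monomials in a lattice trapezoid. The indices 0, 1, 2, 5 are its
vertices and give the four charts of the ruled surface. -/
lemma hVec_div_mem_zero (j : Fin 6) : hVec d t x j / hVec d t x 0 ∈ rng {t, x} := by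
  fin_cases j
  · exact mem_rng_pair 0 0 (by simp [hVec])
  · exact mem_rng_pair 1 0 (by simp [hVec])
  · exact mem_rng_pair 0 1 (by simp [hVec])
  · exact mem_rng_pair 1 1 (by simp [hVec, mul_comm])
  · exact mem_rng_pair d 1 (by simp [hVec, mul_comm])
  · exact mem_rng_pair (d + 1) 1 (by simp [hVec, mul_comm])

lemma hVec_div_mem_one (j : Fin 6) :
    hVec d t x j / hVec d t x 1 ∈ rng {t⁻¹, t ^ d * x} := by
  fin_cases j
  · exact mem_rng_pair 1 0 (by simp [hVec])
  · exact mem_rng_pair 0 0 (by simp [hVec, ht])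
  · exact mem_rng_pair (d + 1) 1 (by simp [hVec, pow_succ]; field_simp)
  · exact mem_rng_pair d 1 (by simp [hVec, pow_succ]; field_simp)
  · exact mem_rng_pair 1 1 (by simp [hVec, pow_succ]; field_simp)
  · exact mem_rng_pair 0 1 (by simp [hVec, pow_succ]; field_simp)

lemma hVec_div_mem_two (j : Fin 6) : hVec d t x j / hVec d t x 2 ∈ rng {t, x⁻¹} := by
  fin_cases j
  · exact mem_rng_pair 0 1 (by simp [hVec])
  · exact mem_rng_pair 1 1 (by simp [hVec, pow_succ]; field_simp)
  · exact mem_rng_pair 0 0 (by simp [hVec, hx])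
  · exact mem_rng_pair 1 0 (by simp [hVec, hx])
  · exact mem_rng_pair d 0 (by simp [hVec, hx])
  · exact mem_rng_pair (d + 1) 0 (by simp [hVec, hx])

lemma hVec_div_mem_five (j : Fin 6) :
    hVec d t x j / hVec d t x 5 ∈ rng {t⁻¹, (t ^ d * x)⁻¹} := by
  fin_cases j
  · exact mem_rng_pair 1 1 (by simp [hVec, pow_succ]; field_simp)
  · exact mem_rng_pair 0 1 (by simp [hVec, pow_succ]; field_simp)
  · exact mem_rng_pair (d + 1) 0 (by simp [hVec, pow_succ]; field_simp)
  · exact mem_rng_pair d 0 (by simp [hVec, pow_succ]; field_simp)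
  · exact mem_rng_pair 1 0 (by simp [hVec, pow_succ]; field_simp)
  · exact mem_rng_pair 0 0 (by simp [hVec, hx, ht])

lemma hVec_ne_zero (j : Fin 6) : hVec d t x j ≠ 0 := by
  fin_cases j <;> simp [hVec, hx, ht]

lemma hVec_zero_le {B : Subring K} (hB : ∀ j, hVec d t x j / hVec d t x 0 ∈ B) :
    t ∈ B ∧ x ∈ B :=
  ⟨by simpa [hVec] using hB 1, by simpa [hVec] using hB 2⟩

lemma hVec_one_le {B : Subring K} (hB : ∀ j, hVec d t x j / hVec d t x 1 ∈ B) :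
    t⁻¹ ∈ B ∧ t ^ d * x ∈ B := by
  refine ⟨by simpa [hVec] using hB 0, ?_⟩
  have := hB 5
  have e : hVec d t x 5 / hVec d t x 1 = t ^ d * x := by simp [hVec, pow_succ]; field_simp
  rwa [e] at this

lemma hVec_two_le {B : Subring K} (hB : ∀ j, hVec d t x j / hVec d t x 2 ∈ B) :
    t ∈ B ∧ x⁻¹ ∈ B :=
  ⟨by simpa [hVec, hx] using hB 3, by simpa [hVec, hx] using hB 0⟩

lemma hVec_five_le {B : Subring K} (hB : ∀ j, hVec d t x j / hVec d t x 5 ∈ B) :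
    t⁻¹ ∈ B ∧ (t ^ d * x)⁻¹ ∈ B := by
  constructor
  · have e : hVec d t x 4 / hVec d t x 5 = t⁻¹ := by simp [hVec, pow_succ]; field_simp
    have := hB 4
    rwa [e] at this
  · have e : hVec d t x 1 / hVec d t x 5 = (t ^ d * x)⁻¹ := by simp [hVec, pow_succ]; field_simp
    have := hB 1
    rwa [e] at this

/-- Every chart of the Hirzebruch surface contains one of four charts. -/
lemma hVec_cases (i : Fin 6) {B : Subring K} (hB : ∀ j, hVec d t x j / hVec d t x i ∈ B) :
    (t ∈ B ∧ x ∈ B) ∨ (t⁻¹ ∈ B ∧ t ^ d * x ∈ B) ∨ (t ∈ B ∧ x⁻¹ ∈ B) ∨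
      (t⁻¹ ∈ B ∧ (t ^ d * x)⁻¹ ∈ B) := by
  fin_cases i
  · exact Or.inl (hVec_zero_le ht hx d hB)
  · exact Or.inr (Or.inl (hVec_one_le ht hx d hB))
  · exact Or.inr (Or.inr (Or.inl (hVec_two_le ht hx d hB)))
  · have e0 : hVec d t x 0 / hVec d t x 3 = x⁻¹ * t⁻¹ := by simp [hVec, pow_succ]; field_simp
    have e1 : hVec d t x 1 / hVec d t x 3 = x⁻¹ := by simp [hVec, pow_succ]; field_simp
    have e2 : hVec d t x 2 / hVec d t x 3 = t⁻¹ := by simp [hVec, pow_succ]; field_simp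
    have e5 : hVec d t x 5 / hVec d t x 3 = t ^ d := by simp [hVec, pow_succ]; field_simp
    have h1 := hB 1
    have h2 := hB 2
    have h5 := hB 5
    simp only [Fin.reduceFinMk] at h1 h2 h5
    rw [e1] at h1
    rw [e2] at h2
    rw [e5] at h5
    -- For `d = 0` the monomial `x t` is itself a vertex. For `d > 0` it is interior to an edge, so
    -- the ring contains both `t⁻¹` and a power of `t` from which `t` is recovered.
    cases d with
    | zero => exact Or.inr (Or.inr (Or.inr ⟨h2, by simpa using h1⟩))
    | succ d =>
      refine Or.inr (Or.inr (Or.inl ⟨?_, h1⟩))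
      exact pow_mul_pow_mem h2 h5 d 1
        (by rw [inv_pow, pow_one, pow_succ, inv_mul_cancel_left₀ (pow_ne_zero _ ht)])
  · have e0 : hVec d t x 0 / hVec d t x 4 = (t ^ d * x)⁻¹ := by simp [hVec, pow_succ]; field_simp
    have e2 : hVec d t x 2 / hVec d t x 4 = t⁻¹ ^ d := by simp [hVec, pow_succ]; field_simp
    have e5 : hVec d t x 5 / hVec d t x 4 = t := by simp [hVec, pow_succ]; field_simp
    have h0 := hB 0
    have h2 := hB 2
    have h5 := hB 5
    simp only [Fin.reduceFinMk] at h0 h2 h5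
    rw [e0] at h0
    rw [e2] at h2
    rw [e5] at h5
    -- Likewise `x t ^ d` is the vertex `x` when `d = 0` and interior to an edge otherwise.
    cases d with
    | zero => exact Or.inr (Or.inr (Or.inl ⟨h5, by simpa using h0⟩))
    | succ d =>
      refine Or.inr (Or.inr (Or.inr ⟨?_, h0⟩))
      exact pow_mul_pow_mem h5 h2 d 1 (by
        rw [pow_one, pow_succ t⁻¹, ← mul_assoc, ← mul_pow, mul_inv_cancel₀ ht, one_pow, one_mul])
  · exact Or.inr (Or.inr (Or.inr (hVec_five_le ht hx d hB)))

end hVec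

/-- The Hirzebruch surface of degree `d` as a projective variety. -/
def hModel (d : ℕ) (t x : K) : RealScheme := projModel (hVec d t x) (exists_isUnit_hVec d t x)

/-- The generic point of `hModel`. -/
def hModelPt (d : ℕ) (t x : K) : Spec (.of K) ⟶ (hModel d t x).left :=
  projModelPt (hVec d t x) (exists_isUnit_hVec d t x)

lemma isRuled_hModel {t x : K} (ht : t ≠ 0) (hx : x ≠ 0) (d : ℕ) :
    IsRuled (hModelPt d t x) t t⁻¹ x (t ^ d * x) := by
  have key : ∀ B ∈ ruledRings t t⁻¹ x (t ^ d * x), ∃ c, IsChart (hModelPt d t x) B c := by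
    rintro _ (rfl | rfl | rfl | rfl)
    · refine exists_isChart_projModel _ _ 0 (hVec_ne_zero ht hx d 0) ?_
        (hVec_div_mem_zero ht hx d)
      have := hVec_zero_le ht hx d (div_mem_rng _ _)
      exact pair_subset this.1 this.2
    · refine exists_isChart_projModel _ _ 1 (hVec_ne_zero ht hx d 1) ?_
        (hVec_div_mem_one ht hx d)
      have := hVec_one_le ht hx d (div_mem_rng _ _)
      exact pair_subset this.1 this.2
    · refine exists_isChart_projModel _ _ 2 (hVec_ne_zero ht hx d 2) ?_
        (hVec_div_mem_two ht hx d)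
      have := hVec_two_le ht hx d (div_mem_rng _ _)
      exact pair_subset this.1 this.2
    · refine exists_isChart_projModel _ _ 5 (hVec_ne_zero ht hx d 5) ?_
        (hVec_div_mem_five ht hx d)
      have := hVec_five_le ht hx d (div_mem_rng _ _)
      exact pair_subset this.1 this.2
  refine ⟨coveredBy_projModel_of _ _ key fun i _ ↦ ?_, key⟩
  obtain h | h | h | h := hVec_cases ht hx d i (div_mem_rng _ _)
  · exact ⟨_, Or.inl rfl, rng_le_rng (pair_subset h.1 h.2)⟩
  · exact ⟨_, Or.inr (Or.inl rfl), rng_le_rng (pair_subset h.1 h.2)⟩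
  · exact ⟨_, Or.inr (Or.inr (Or.inl rfl)), rng_le_rng (pair_subset h.1 h.2)⟩
  · exact ⟨_, Or.inr (Or.inr (Or.inr rfl)), rng_le_rng (pair_subset h.1 h.2)⟩

end Ruled

/-! ### The surface dominating 𝔽_d and 𝔽_{d+2} -/

section ElemModel

variable {K : Type} [Field K] [Algebra ℝ K]

/-- The indices of products of coordinates. -/
def eEquiv : Fin 6 × Fin 6 ≃ Fin (35 + 1) := finProdFinEquiv

/-- Homogeneous coordinates of the generic point of a surface dominating the Hirzebruch surfaces
of degrees `d` and `d + 2`. -/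
def eVec (d : ℕ) (t x : K) (i : Fin (35 + 1)) : K :=
  hVec d t x (eEquiv.symm i).1 *
    hVec (d + 2) t (x / (1 + t ^ 2)) (eEquiv.symm i).2

/-- The index of a product of coordinates. -/
def eIdx (i j : Fin 6) : Fin (35 + 1) := eEquiv (i, j)

lemma eVec_eIdx (d : ℕ) (t x : K) (i j : Fin 6) : eVec d t x (eIdx i j) =
    hVec d t x i * hVec (d + 2) t (x / (1 + t ^ 2)) j := by
  rw [eVec, eIdx, Equiv.symm_apply_apply]

lemma exists_eIdx (k : Fin (35 + 1)) : ∃ i j, k = eIdx i j :=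
  ⟨(eEquiv.symm k).1, (eEquiv.symm k).2,
    (eEquiv.apply_symm_apply k).symm⟩

lemma exists_isUnit_eVec {d : ℕ} {t x : K} : ∃ i, IsUnit (eVec d t x i) :=
  ⟨eIdx 0 0, by rw [eVec_eIdx]; exact isUnit_one.mul isUnit_one⟩

section

variable {t x : K} (ht : t ≠ 0) (hx : x ≠ 0) (h0 : 1 + t ^ 2 ≠ 0) (d : ℕ)

include ht hx h0

/-- The coordinates are all products of coordinates of the two surfaces, as in a Segre embedding, so
a chart ring is generated by one chart ring of each factor. -/
lemma eVec_div_mem {i j : Fin 6} {B : Subring K} (h : ∀ k, hVec d t x k / hVec d t x i ∈ B)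
    (h' : ∀ k, hVec (d + 2) t (x / (1 + t ^ 2)) k / hVec (d + 2) t (x / (1 + t ^ 2)) j ∈ B)
    (k : Fin 36) : eVec d t x k / eVec d t x (eIdx i j) ∈ B := by
  obtain ⟨k, l, rfl⟩ := exists_eIdx k
  rw [eVec_eIdx, eVec_eIdx, mul_div_mul_comm]
  exact B.mul_mem (h k) (h' l)

lemma eVec_div_le {i j : Fin 6} {B : Subring K}
    (h : ∀ k, eVec d t x k / eVec d t x (eIdx i j) ∈ B) :
    (∀ k, hVec d t x k / hVec d t x i ∈ B) ∧
    ∀ k, hVec (d + 2) t (x / (1 + t ^ 2)) k / hVec (d + 2) t (x / (1 + t ^ 2)) j ∈ B := by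
  have hx' : x / (1 + t ^ 2) ≠ 0 := div_ne_zero hx h0
  refine ⟨fun k ↦ ?_, fun k ↦ ?_⟩
  · have := h (eIdx k j)
    rwa [eVec_eIdx, eVec_eIdx, mul_div_mul_right _ _ (hVec_ne_zero ht hx' (d + 2) j)] at this
  · have := h (eIdx i k)
    rwa [eVec_eIdx, eVec_eIdx, mul_div_mul_left _ _ (hVec_ne_zero ht hx d i)] at this

lemma eVec_ne_zero (k : Fin 36) : eVec d t x k ≠ 0 := by
  obtain ⟨i, j, rfl⟩ := exists_eIdx k
  rw [eVec_eIdx]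
  exact mul_ne_zero (hVec_ne_zero ht hx d i) (hVec_ne_zero ht (div_ne_zero hx h0) (d + 2) j)

end

/-- A surface dominating the Hirzebruch surfaces of degrees `d` and `d + 2`. -/
def eModel (d : ℕ) (t x : K) : RealScheme := projModel (eVec d t x) exists_isUnit_eVec

/-- The generic point of `eModel`. -/
def eModelPt (d : ℕ) (t x : K) : Spec (.of K) ⟶ (eModel d t x).left :=
  projModelPt (eVec d t x) exists_isUnit_eVec

/-- Each chart ring contains one of four rings from 𝔽_d and one of four rings from 𝔽_{d+2}. Six of
these pairs give the listed charts, and each of the sixteen combinations contains one of the six. -/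
lemma isElem_eModel {t x : K} (ht : t ≠ 0) (hx : x ≠ 0) (h0 : 1 + t ^ 2 ≠ 0) (d : ℕ) :
    IsElem (eModelPt d t x) t t⁻¹ x (t ^ d * x) := by
  have hx' : x / (1 + t ^ 2) ≠ 0 := div_ne_zero hx h0
  have h1 : 1 + t⁻¹ ^ 2 ≠ 0 := by
    intro h
    apply h0
    field_simp at h
    linear_combination h
  have ey : t ^ d * x / (1 + t⁻¹ ^ 2) = t ^ (d + 2) * (x / (1 + t ^ 2)) := by
    have e : 1 + t⁻¹ ^ 2 = (1 + t ^ 2) / t ^ 2 := by field_simp; ring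
    rw [e, pow_add]
    field_simp
  have hxinv : (x / (1 + t ^ 2))⁻¹ = (1 + t ^ 2) / x := inv_div _ _
  have hyinv : (t ^ (d + 2) * (x / (1 + t ^ 2)))⁻¹ = (1 + t⁻¹ ^ 2) / (t ^ d * x) := by
    rw [← ey, inv_div]
  have mem_sq {B : Subring K} {a : K} (ha : a ∈ B) : 1 + a ^ 2 ∈ B :=
    B.add_mem B.one_mem (B.pow_mem ha 2)
  have key : ∀ B ∈ elemRings t t⁻¹ x (t ^ d * x), ∃ c, IsChart (eModelPt d t x) B c := by
    -- The index `i` selects a chart of 𝔽_d and `j` one of 𝔽_{d+2}. The indices 0, 2, 1, 5 stand for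
    -- base coordinate `t` with the fibre coordinate or its inverse, then base coordinate `t⁻¹` with
    -- the same two choices.
    have of_pair (i j : Fin 6) {s : Set K}
        (h : ∀ B : Subring K, (∀ r, algebraMap ℝ K r ∈ B) →
          (∀ k, hVec d t x k / hVec d t x i ∈ B) →
          (∀ k, hVec (d + 2) t (x / (1 + t ^ 2)) k / hVec (d + 2) t (x / (1 + t ^ 2)) j ∈ B) →
          s ⊆ B)
        (h' : ∀ k, hVec d t x k / hVec d t x i ∈ rng s)
        (h'' : ∀ k, hVec (d + 2) t (x / (1 + t ^ 2)) k / hVec (d + 2) t (x / (1 + t ^ 2)) j ∈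
          rng s) : ∃ c, IsChart (eModelPt d t x) (rng s) c := by
      have := eVec_div_le ht hx h0 d (i := i) (j := j) (div_mem_rng _ _)
      exact exists_isChart_projModel _ _ (eIdx i j) (eVec_ne_zero ht hx h0 d _)
        (h _ (algebraMap_mem_rng _) this.1 this.2) (eVec_div_mem ht hx h0 d h' h'')
    rintro _ (rfl | rfl | rfl | rfl | rfl | rfl)
    · refine of_pair 0 0 (fun B hr h h' ↦ ?_) (fun k ↦ ?_) (hVec_div_mem_zero ht hx' _)
      · exact pair_subset (hVec_zero_le ht hx d h).1 (hVec_zero_le ht hx' _ h').2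
      · refine rng_le_rng (pair_subset (mem_rng_left _ _) ?_) (hVec_div_mem_zero ht hx d k)
        have := Subring.mul_mem _ (mem_sq (mem_rng_left t (x / (1 + t ^ 2)))) (mem_rng_right _ _)
        rwa [mul_div_cancel₀ _ h0] at this
    · refine of_pair 0 2 (fun B hr h h' ↦ ?_) (fun k ↦ ?_) (fun k ↦ ?_)
      · exact triple_subset (hVec_zero_le ht hx d h).1 (hVec_zero_le ht hx d h).2
          (hxinv ▸ (hVec_two_le ht hx' _ h').2)
      · exact rng_mono (by simp [Set.insert_subset_iff]) (hVec_div_mem_zero ht hx d k)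
      · refine rng_le_rng (pair_subset (mem_rng (by simp)) ?_) (hVec_div_mem_two ht hx' _ k)
        exact hxinv ▸ mem_rng (by simp)
    · refine of_pair 2 2 (fun B hr h h' ↦ ?_) (hVec_div_mem_two ht hx d) (fun k ↦ ?_)
      · exact pair_subset (hVec_two_le ht hx d h).1 (hVec_two_le ht hx d h).2
      · refine rng_le_rng (pair_subset (mem_rng (by simp)) ?_) (hVec_div_mem_two ht hx' _ k)
        rw [hxinv, div_eq_mul_inv]
        exact Subring.mul_mem _ (mem_sq (mem_rng_left _ _)) (mem_rng_right _ _)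
    · rw [ey]
      refine of_pair 1 1 (fun B hr h h' ↦ ?_) (fun k ↦ ?_) (hVec_div_mem_one ht hx' _)
      · exact pair_subset (hVec_one_le ht hx d h).1 (hVec_one_le ht hx' _ h').2
      · refine rng_le_rng (pair_subset (mem_rng_left _ _) ?_) (hVec_div_mem_one ht hx d k)
        have := Subring.mul_mem _ (mem_sq (mem_rng_left t⁻¹ (t ^ (d + 2) * (x / (1 + t ^ 2)))))
          (mem_rng_right _ _)
        rwa [← ey, mul_div_cancel₀ _ h1, ey] at this
    · refine of_pair 1 5 (fun B hr h h' ↦ ?_) (fun k ↦ ?_) (fun k ↦ ?_)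
      · exact triple_subset (hVec_one_le ht hx d h).1 (hVec_one_le ht hx d h).2
          (hyinv ▸ (hVec_five_le ht hx' _ h').2)
      · exact rng_mono (by simp [Set.insert_subset_iff]) (hVec_div_mem_one ht hx d k)
      · refine rng_le_rng (pair_subset (mem_rng (by simp)) ?_) (hVec_div_mem_five ht hx' _ k)
        exact hyinv ▸ mem_rng (by simp)
    · refine of_pair 5 5 (fun B hr h h' ↦ ?_) (hVec_div_mem_five ht hx d) (fun k ↦ ?_)
      · exact pair_subset (hVec_five_le ht hx d h).1 (hVec_five_le ht hx d h).2
      · refine rng_le_rng (pair_subset (mem_rng (by simp)) ?_) (hVec_div_mem_five ht hx' _ k)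
        rw [hyinv, div_eq_mul_inv]
        exact Subring.mul_mem _ (mem_sq (mem_rng_left _ _)) (mem_rng_right _ _)
  refine ⟨coveredBy_projModel_of _ _ key fun k _ ↦ ?_, key⟩
  obtain ⟨i, j, rfl⟩ := exists_eIdx k
  generalize hB : rng (Set.range fun k ↦ eVec d t x k / eVec d t x (eIdx i j)) = B
  have hAB (s : Set K) (hs : s ⊆ B) : rng s ≤ B := hB ▸ rng_le_rng (hB ▸ hs)
  have h := eVec_div_le ht hx h0 d (i := i) (j := j) (B := B) (hB ▸ div_mem_rng _ _)
  have H1 (h1 : t ∈ B) (h2 : x / (1 + t ^ 2) ∈ B) :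
      ∃ C ∈ elemRings t t⁻¹ x (t ^ d * x), C ≤ B :=
    ⟨_, Or.inl rfl, hAB _ (pair_subset h1 h2)⟩
  have H2 (h1 : t ∈ B) (h2 : x ∈ B) (h3 : (x / (1 + t ^ 2))⁻¹ ∈ B) :
      ∃ C ∈ elemRings t t⁻¹ x (t ^ d * x), C ≤ B :=
    ⟨_, Or.inr (Or.inl rfl), hAB _ (triple_subset h1 h2 (hxinv ▸ h3))⟩
  have H3 (h1 : t ∈ B) (h2 : x⁻¹ ∈ B) : ∃ C ∈ elemRings t t⁻¹ x (t ^ d * x), C ≤ B :=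
    ⟨_, Or.inr (Or.inr (Or.inl rfl)), hAB _ (pair_subset h1 h2)⟩
  have H4 (h1 : t⁻¹ ∈ B) (h2 : t ^ (d + 2) * (x / (1 + t ^ 2)) ∈ B) :
      ∃ C ∈ elemRings t t⁻¹ x (t ^ d * x), C ≤ B :=
    ⟨_, Or.inr (Or.inr (Or.inr (Or.inl rfl))), hAB _ (pair_subset h1 (ey ▸ h2))⟩
  have H5 (h1 : t⁻¹ ∈ B) (h2 : t ^ d * x ∈ B) (h3 : (t ^ (d + 2) * (x / (1 + t ^ 2)))⁻¹ ∈ B) :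
      ∃ C ∈ elemRings t t⁻¹ x (t ^ d * x), C ≤ B :=
    ⟨_, Or.inr (Or.inr (Or.inr (Or.inr (Or.inl rfl)))), hAB _ (triple_subset h1 h2 (hyinv ▸ h3))⟩
  have H6 (h1 : t⁻¹ ∈ B) (h2 : (t ^ d * x)⁻¹ ∈ B) :
      ∃ C ∈ elemRings t t⁻¹ x (t ^ d * x), C ≤ B :=
    ⟨_, Or.inr (Or.inr (Or.inr (Or.inr (Or.inr rfl)))), hAB _ (pair_subset h1 h2)⟩
  -- When one factor supplies `t` and the other `t⁻¹`, powers of `t` may be cancelled, which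
  -- identifies the fibre coordinates over the two halves of the base.
  have m1 {k : ℕ} {z : K} (h1 : t⁻¹ ∈ B) (h2 : t ^ k * z ∈ B) : z ∈ B :=
    pow_mul_pow_mem h1 h2 k 1 (by rw [pow_one, inv_pow, inv_mul_cancel_left₀ (pow_ne_zero k ht)])
  have m2 {k : ℕ} {z : K} (h1 : t ∈ B) (h2 : (t ^ k * z)⁻¹ ∈ B) : z⁻¹ ∈ B :=
    pow_mul_pow_mem h1 h2 k 1
      (by rw [pow_one, mul_inv, mul_inv_cancel_left₀ (pow_ne_zero k ht)])
  obtain h1 | h1 | h1 | h1 := hVec_cases ht hx d i h.1 <;>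
    obtain h2 | h2 | h2 | h2 := hVec_cases ht hx' (d + 2) j h.2
  · exact H1 h2.1 h2.2
  · exact H1 h1.1 (m1 h2.1 h2.2)
  · exact H2 h1.1 h1.2 h2.2
  · exact H2 h1.1 h1.2 (m2 h1.1 h2.2)
  · exact H1 h2.1 h2.2
  · exact H4 h2.1 h2.2
  · exact H2 h2.1 (m1 h1.1 h1.2) h2.2
  · exact H5 h1.1 h1.2 h2.2
  · exact H3 h1.1 h1.2
  · exact H3 h1.1 h1.2
  · exact H3 h1.1 h1.2
  · exact H3 h1.1 h1.2
  · exact H6 h1.1 h1.2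
  · exact H6 h1.1 h1.2
  · exact H6 h1.1 h1.2
  · exact H6 h1.1 h1.2

end ElemModel

/-! ### Ideal sheaves on affine charts -/

section Restr

variable {R S : Type} [CommRing R] [CommRing S] {X Y : Scheme.{0}}

/-- The ideal of an ideal sheaf on an affine scheme. -/
def topIdeal (I : (Spec (.of R)).IdealSheafData) : Ideal R :=
  (I.ideal ⟨⊤, isAffineOpen_top _⟩).comap (Scheme.ΓSpecIso (.of R)).inv.hom

lemma bijective_ΓSpecIso_inv : Function.Bijective (Scheme.ΓSpecIso (.of R)).inv.hom :=
  ConcreteCategory.bijective_of_isIso (Scheme.ΓSpecIso (.of R)).inv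

lemma topIdeal_le_iff {I J : (Spec (.of R)).IdealSheafData} :
    topIdeal I ≤ topIdeal J ↔ I ≤ J := by
  rw [topIdeal, topIdeal,
    Ideal.comap_le_comap_iff_of_surjective _ bijective_ΓSpecIso_inv.surjective]
  exact ⟨Scheme.IdealSheafData.le_of_isAffine, fun h ↦ h _⟩

lemma topIdeal_injective : Function.Injective (topIdeal (R := R)) := fun _ _ h ↦
  le_antisymm (topIdeal_le_iff.1 h.le) (topIdeal_le_iff.1 h.ge)

lemma exists_topIdeal_eq (J : Ideal R) : ∃ I, topIdeal I = J := by
  refine ⟨Scheme.IdealSheafData.ofIdealTop (J.map (Scheme.ΓSpecIso (.of R)).inv.hom), ?_⟩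
  have e : (Scheme.IdealSheafData.ofIdealTop (J.map (Scheme.ΓSpecIso (.of R)).inv.hom)).ideal
      ⟨⊤, isAffineOpen_top _⟩ = J.map (Scheme.ΓSpecIso (.of R)).inv.hom := by simp
  rw [topIdeal, e]
  exact Ideal.comap_map_of_bijective _ bijective_ΓSpecIso_inv

@[simp] lemma topIdeal_top : topIdeal (⊤ : (Spec (.of R)).IdealSheafData) = ⊤ := rfl

lemma topIdeal_map (I : (Spec (.of S)).IdealSheafData) (ψ : R →+* S) :
    topIdeal (I.map (Spec.map (CommRingCat.ofHom ψ))) = (topIdeal I).comap ψ := by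
  rw [topIdeal, Scheme.IdealSheafData.ideal_map_of_isAffineHom, Ideal.comap_comap, topIdeal,
    Ideal.comap_comap]
  congr 1
  exact congr(($(Scheme.ΓSpecIso_inv_naturality (CommRingCat.ofHom ψ))).hom).symm

/-- Pullback of ideal sheaves is left adjoint to pushforward. On affine schemes pushforward is
contraction, so pullback must be extension of ideals. -/
lemma topIdeal_comap (I : (Spec (.of R)).IdealSheafData) (ψ : R →+* S) :
    topIdeal (I.comap (Spec.map (CommRingCat.ofHom ψ))) = (topIdeal I).map ψ := by
  have key (J : (Spec (.of S)).IdealSheafData) :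
      topIdeal (I.comap (Spec.map (CommRingCat.ofHom ψ))) ≤ topIdeal J ↔
        (topIdeal I).map ψ ≤ topIdeal J := by
    rw [topIdeal_le_iff, ← Scheme.IdealSheafData.le_map_iff_comap_le, ← topIdeal_le_iff,
      topIdeal_map, Ideal.map_le_iff_le_comap]
  obtain ⟨J, hJ⟩ := exists_topIdeal_eq ((topIdeal I).map ψ)
  refine le_antisymm ?_ ((key _).1 le_rfl)
  rw [← hJ, key, hJ]

lemma topIdeal_ker_specMap (ψ : R →+* S) :
    topIdeal (Spec.map (CommRingCat.ofHom ψ)).ker = RingHom.ker ψ := by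
  rw [topIdeal, Scheme.Hom.ker_apply, RingHom.comap_ker]
  have := congr(($(Scheme.ΓSpecIso_inv_naturality (CommRingCat.ofHom ψ))).hom)
  refine (congrArg RingHom.ker this.symm).trans ?_
  ext a
  exact map_eq_zero_iff _ bijective_ΓSpecIso_inv.injective

/-- The ideal defined by an ideal sheaf on an affine chart. -/
def restr (I : Y.IdealSheafData) (c : Spec (.of R) ⟶ Y) : Ideal R := topIdeal (I.comap c)

lemma restr_specMap_comp (I : Y.IdealSheafData) (c : Spec (.of R) ⟶ Y) (ψ : R →+* S) :
    restr I (Spec.map (CommRingCat.ofHom ψ) ≫ c) = (restr I c).map ψ := by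
  rw [restr, Scheme.IdealSheafData.comap_comp, topIdeal_comap, restr]

lemma restr_comap (I : Y.IdealSheafData) (f : X ⟶ Y) (c : Spec (.of R) ⟶ X) :
    restr (I.comap f) c = restr I (c ≫ f) := by
  rw [restr, restr, Scheme.IdealSheafData.comap_comp]

/-- Since `p` factors through the monomorphism `c`, its base change along `c` is `Spec φ`, and
kernels are compatible with restriction to opens. -/
lemma restr_ker (p : Spec (.of S) ⟶ Y) (φ : R →+* S) (c : Spec (.of R) ⟶ Y) [IsOpenImmersion c]
    (hp : Spec.map (CommRingCat.ofHom φ) ≫ c = p) [QuasiCompact p] :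
    restr p.ker c = RingHom.ker φ := by
  have H : IsPullback (Spec.map (CommRingCat.ofHom φ)) (𝟙 _) c p :=
    ⟨⟨by rw [hp, Category.id_comp]⟩, ⟨PullbackCone.IsLimit.mk _
      (fun s ↦ s.snd) (fun s ↦ by
        rw [← cancel_mono c, Category.assoc, hp, s.condition]) (fun s ↦ Category.comp_id _)
      fun s m h h' ↦ by rw [← h', Category.comp_id]⟩⟩
  rw [← topIdeal_ker_specMap, restr]
  congr 1
  refine Scheme.IdealSheafData.ext_of_isAffine ?_
  rw [Scheme.IdealSheafData.ideal_comap_of_isOpenImmersion,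
    Scheme.ker_ideal_of_isPullback_of_isOpenImmersion _ _ _ _ H]

lemma restr_eq_top_of_notMem_range (I : Y.IdealSheafData) (c : Spec (.of R) ⟶ Y)
    (h : ∀ x ∈ I.support, x ∉ Set.range c) : restr I c = ⊤ := by
  have : I.comap c = ⊤ := by
    rw [← Scheme.IdealSheafData.support_eq_bot_iff, Scheme.IdealSheafData.support_comap]
    ext x
    simpa using fun hx ↦ h _ hx ⟨x, rfl⟩
  rw [restr, this, topIdeal_top]

lemma exists_equiv_of_isOpenImmersion (I : Y.IdealSheafData) (j : Spec (.of R) ⟶ Y)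
    [IsOpenImmersion j] : ∃ θ : R ≃+* Γ(Y, j ''ᵁ ⊤), restr I j =
      (I.ideal ⟨j ''ᵁ ⊤, (isAffineOpen_top _).image_of_isOpenImmersion _⟩).comap (θ : R →+* _) := by
  have e := Scheme.IdealSheafData.ideal_comap_of_isOpenImmersion I j ⟨⊤, isAffineOpen_top _⟩
  refine ⟨((j.appIso ⊤).trans (Scheme.ΓSpecIso (.of R))).symm.commRingCatIsoToRingEquiv, ?_⟩
  rw [restr, topIdeal, e, Ideal.comap_comap]
  rfl

lemma comap_equiv_eq_span_singleton_iff (θ : R ≃+* S) (J : Ideal S) :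
    (∃ f ∈ nonZeroDivisors S, J = Ideal.span {f}) ↔
      ∃ f ∈ nonZeroDivisors R, J.comap (θ : R →+* S) = Ideal.span {f} := by
  constructor
  · rintro ⟨f, hf, rfl⟩
    refine ⟨θ.symm f, ?_, ?_⟩
    · simpa [mem_nonZeroDivisors_iff, ← θ.symm.forall_congr_right, ← map_mul] using hf
    · ext a
      simp only [Ideal.mem_comap, Ideal.mem_span_singleton]
      rw [← map_dvd_iff θ]
      simp
  · rintro ⟨f, hf, h⟩
    refine ⟨θ f, ?_, ?_⟩
    · simpa [mem_nonZeroDivisors_iff, ← θ.forall_congr_right, ← map_mul] using hf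
    · ext a
      obtain ⟨a, rfl⟩ := θ.surjective a
      have := congr(a ∈ $h)
      simp only [Ideal.mem_comap, Ideal.mem_span_singleton, RingEquiv.coe_toRingHom] at this
      rw [this, Ideal.mem_span_singleton, map_dvd_iff]

/-- Invertibility of an ideal sheaf can be checked on affine charts. -/
lemma isInvertibleIdeal_iff {I : Y.IdealSheafData} : IsInvertibleIdeal I ↔
    ∀ y : Y, ∃ (C : Type) (_ : CommRing C) (j : Spec (.of C) ⟶ Y) (_ : IsOpenImmersion j),
      y ∈ Set.range j ∧ ∃ f ∈ nonZeroDivisors C, restr I j = Ideal.span {f} := by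
  constructor
  · intro h y
    obtain ⟨U, hyU, h⟩ := h y
    let j : Spec (.of Γ(Y, U.1)) ⟶ Y := U.2.fromSpec
    have : IsOpenImmersion j := U.2.isOpenImmersion_fromSpec
    have hU : U = ⟨j ''ᵁ ⊤, (isAffineOpen_top _).image_of_isOpenImmersion _⟩ := by
      refine Subtype.ext (SetLike.coe_injective ?_)
      change _ = j '' Set.univ
      rw [Set.image_univ]
      exact U.2.range_fromSpec.symm
    refine ⟨Γ(Y, U.1), inferInstance, j, inferInstance, ?_, ?_⟩
    · exact U.2.range_fromSpec.ge hyU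
    · obtain ⟨θ, hθ⟩ := exists_equiv_of_isOpenImmersion I j
      rw [hθ, ← comap_equiv_eq_span_singleton_iff]
      generalize j ''ᵁ ⊤ = V, (isAffineOpen_top _).image_of_isOpenImmersion j = hV at hU ⊢
      subst hU
      exact h
  · intro h y
    obtain ⟨C, _, j, _, hy, h⟩ := h y
    obtain ⟨θ, hθ⟩ := exists_equiv_of_isOpenImmersion I j
    rw [hθ, ← comap_equiv_eq_span_singleton_iff] at h
    exact ⟨⟨j ''ᵁ ⊤, (isAffineOpen_top _).image_of_isOpenImmersion _⟩, by simpa using hy, h⟩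

end Restr

/-! ### A criterion for blowing-ups -/

/-- The equalizer is a closed subscheme through which `ι` factors, hence all of `X`. Reducedness of
`X` is not required, which matters because the test schemes in the universal property are arbitrary.
-/
lemma ext_of_isSchemeTheoreticallyDominant {W X Y : Scheme.{0}} [Y.IsSeparated] {f g : X ⟶ Y}
    (ι : W ⟶ X) [IsSchemeTheoreticallyDominant ι] (h : ι ≫ f = ι ≫ g) : f = g := by
  have : IsIso (equalizer.ι f g) := by
    rw [IsClosedImmersion.isIso_iff_ker_eq_bot, ← le_bot_iff, ← ι.ker_eq_bot]
    rw [← equalizer.lift_ι ι h, Scheme.Hom.ker_comp, ← Scheme.IdealSheafData.map_bot]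
    exact Scheme.IdealSheafData.map_mono _ bot_le
  exact (cancel_epi (equalizer.ι f g)).1 (equalizer.condition f g)

lemma isSchemeTheoreticallyDominant_specMap {R S : Type} [CommRing R] [CommRing S] (ψ : R →+* S)
    (hψ : Function.Injective ψ) :
    IsSchemeTheoreticallyDominant (Spec.map (CommRingCat.ofHom ψ)) := by
  refine ⟨topIdeal_injective ?_⟩
  rw [topIdeal_ker_specMap, (RingHom.injective_iff_ker_eq_bot ψ).1 hψ]
  exact (Ideal.comap_bot_of_injective _ bijective_ΓSpecIso_inv.injective).symm

/-- The inclusion of the open set where `r` does not vanish. -/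
abbrev specAway {R : Type} [CommRing R] (r : R) : Spec (.of (Localization.Away r)) ⟶ Spec (.of R) :=
  Spec.map (CommRingCat.ofHom (algebraMap R (Localization.Away r)))

instance {R : Type} [CommRing R] (r : R) : IsOpenImmersion (specAway r) :=
  IsOpenImmersion.of_isLocalization r

lemma range_specAway {R : Type} [CommRing R] (r : R) :
    Set.range (specAway r) = (PrimeSpectrum.basicOpen r : Set (PrimeSpectrum R)) :=
  PrimeSpectrum.localization_away_comap_range _ r

/-- A morphism from an affine scheme to an open chart factors through it. -/
lemma exists_factor {Y : Scheme.{0}} {A C : Type} [CommRing A] [CommRing C] (c : Spec (.of A) ⟶ Y)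
    [IsOpenImmersion c] (f : Spec (.of C) ⟶ Y) (h : Set.range f ⊆ Set.range c) :
    ∃ φ : A →+* C, f = Spec.map (CommRingCat.ofHom φ) ≫ c := by
  refine ⟨(Spec.preimage (IsOpenImmersion.lift c f h)).hom, ?_⟩
  rw [CommRingCat.ofHom_hom, Spec.map_preimage, IsOpenImmersion.lift_fac]

lemma exists_specAway_range_subset {C : Type} [CommRing C] (z : Spec (.of C))
    {W : Set (Spec (.of C))} (hW : IsOpen W) (hz : z ∈ W) :
    ∃ r : C, z ∈ Set.range (specAway r) ∧ Set.range (specAway r) ⊆ W := by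
  obtain ⟨_, ⟨r, rfl⟩, hr, hr'⟩ :=
    PrimeSpectrum.isTopologicalBasis_basic_opens.exists_subset_of_mem_open hz hW
  exact ⟨r, by rw [range_specAway]; exact hr, by rw [range_specAway]; exact hr'⟩

/-- Locally, a morphism for which the inverse image ideal is invertible is given on a chart by a
homomorphism for which one of the generators of the ideal divides the others. -/
lemma exists_local_generator {Y Z : Scheme.{0}} {A : Type} [CommRing A] (c : Spec (.of A) ⟶ Y)
    [IsOpenImmersion c] (I : Y.IdealSheafData) (G : Set A) (hG : restr I c = Ideal.span G)
    (g : Z ⟶ Y) (hI : IsInvertibleIdeal (I.comap g)) (z : Z) (hz : g z ∈ Set.range c) :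
    ∃ (C : Type) (_ : CommRing C) (j : Spec (.of C) ⟶ Z) (_ : IsOpenImmersion j),
      z ∈ Set.range j ∧ ∃ φ : A →+* C, j ≫ g = Spec.map (CommRingCat.ofHom φ) ≫ c ∧
        ∃ a ∈ G, φ a ∈ nonZeroDivisors C ∧ ∀ b ∈ G, φ a ∣ φ b := by
  obtain ⟨C, _, j, _, ⟨z, rfl⟩, f, hf, hIf⟩ := isInvertibleIdeal_iff.1 hI z
  obtain ⟨r, ⟨z, rfl⟩, hr⟩ := exists_specAway_range_subset z
    (c.isOpenEmbedding.isOpen_range.preimage (j ≫ g).continuous) hz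
  obtain ⟨φ, hφ⟩ := exists_factor c (specAway r ≫ j ≫ g) (by
    rintro _ ⟨y, rfl⟩
    exact hr ⟨y, rfl⟩)
  set f' := algebraMap C (Localization.Away r) f with hf'
  have hf'0 : f' ∈ nonZeroDivisors (Localization.Away r) :=
    IsLocalization.map_nonZeroDivisors_le (Submonoid.powers r) _ ⟨f, hf, rfl⟩
  have hspan : (Ideal.span G).map φ = Ideal.span {f'} := by
    rw [← hG, ← restr_specMap_comp, ← hφ, restr_specMap_comp, ← restr_comap, hIf, Ideal.map_span,
      Set.image_singleton]
  -- A Nakayama argument: if every coefficient `e` vanished at `z`, the generator `f'` would lie in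
  -- the prime of `z` times `f'`, and cancelling the nonzerodivisor would put 1 in that prime.
  obtain ⟨a, ha, e, he, hez⟩ : ∃ a ∈ G, ∃ e, φ a = e * f' ∧ e ∉ z.asIdeal := by
    by_contra! hcon
    have h1 : (Ideal.span G).map φ ≤ z.asIdeal * Ideal.span {f'} := by
      rw [Ideal.map_span, Ideal.span_le]
      rintro _ ⟨a, ha, rfl⟩
      have h2 : φ a ∈ Ideal.span {f'} := by
        rw [← hspan]; exact Ideal.mem_map_of_mem _ (Ideal.subset_span ha)
      obtain ⟨e, he⟩ := Ideal.mem_span_singleton'.1 h2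
      rw [← he]
      exact Ideal.mul_mem_mul (hcon a ha e he.symm) (Ideal.mem_span_singleton_self _)
    obtain ⟨e, he, he'⟩ := Ideal.mem_mul_span_singleton.1
      (h1 (hspan ▸ Ideal.mem_span_singleton_self f'))
    have : e = 1 := by
      rw [← sub_eq_zero]
      exact (mem_nonZeroDivisors_iff.1 hf'0).2 _ (by rw [sub_mul, he', one_mul, sub_self])
    exact z.2.ne_top ((Ideal.eq_top_iff_one _).2 (this ▸ he))
  have hze : z ∈ Set.range (specAway e) := by rw [range_specAway]; exact hez
  obtain ⟨z, rfl⟩ := hze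
  refine ⟨Localization.Away e, inferInstance, specAway e ≫ specAway r ≫ j, inferInstance,
    ⟨z, rfl⟩,
    (algebraMap (Localization.Away r) (Localization.Away e)).comp φ, ?_, a, ha, ?_, fun b hb ↦ ?_⟩
  · rw [Category.assoc, Category.assoc, hφ, CommRingCat.ofHom_comp, Spec.map_comp, Category.assoc]
  · rw [RingHom.comp_apply, he, map_mul]
    exact mul_mem (IsLocalization.Away.algebraMap_isUnit e).mem_nonZeroDivisors
      (IsLocalization.map_nonZeroDivisors_le (Submonoid.powers e) _ ⟨f', hf'0, rfl⟩)
  · have h2 : φ b ∈ Ideal.span {f'} := by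
      rw [← hspan]; exact Ideal.mem_map_of_mem _ (Ideal.subset_span hb)
    obtain ⟨k, hk⟩ := Ideal.mem_span_singleton'.1 h2
    rw [RingHom.comp_apply, RingHom.comp_apply, he, ← hk, map_mul, map_mul]
    exact mul_dvd_mul_right (IsLocalization.Away.algebraMap_isUnit e).dvd _

section Blowup

variable {K : Type} [Field K]

/-- The ring `A[h / g : h ∈ G]`. -/
def affineBlowup (A : Subring K) (G : Set A) (g : A) : Subring K :=
  Subring.closure (A ∪ (fun h : A ↦ (h : K) / g) '' G)

lemma le_affineBlowup (A : Subring K) (G : Set A) (g : A) : A ≤ affineBlowup A G g :=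
  fun _ ha ↦ Subring.subset_closure (Or.inl ha)

lemma affineBlowup_le {A B : Subring K} {G : Set A} {g : A} (h : A ≤ B)
    (hG : ∀ a ∈ G, (a : K) / g ∈ B) : affineBlowup A G g ≤ B := by
  refine Subring.closure_le.2 (Set.union_subset h ?_)
  rintro _ ⟨a, ha, rfl⟩
  exact hG a ha

/-- A homomorphism for which the image of `g` is a nonzerodivisor that divides the images of the
elements of `G` extends to `A[h / g : h ∈ G]`. -/
lemma exists_extension {A : Subring K} {G : Set A} {g : A} (hg : g ≠ 0) {C : Type} [CommRing C]
    (φ : A →+* C) (hφg : φ g ∈ nonZeroDivisors C) (hφ : ∀ h ∈ G, φ g ∣ φ h) :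
    ∃ ψ : affineBlowup A G g →+* C, ψ.comp (Subring.inclusion (le_affineBlowup A G g)) = φ := by
  have hg' : (g : K) ≠ 0 := by simpa using hg
  -- The graph of the extension to be built: pairs `(k, c)` that become `(a, φ a)` after
  -- multiplication by a power of `g` on the left and of `φ g` on the right.
  let R : Subring (K × C) :=
    { carrier := {p | ∃ (n : ℕ) (a : A), (g : K) ^ n * p.1 = a ∧ φ a = φ g ^ n * p.2}
      zero_mem' := ⟨0, 0, by simp, by simp⟩
      one_mem' := ⟨0, 1, by simp, by simp⟩
      add_mem' := by
        rintro p q ⟨n, a, h1, h2⟩ ⟨m, b, h3, h4⟩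
        refine ⟨n + m, g ^ m * a + g ^ n * b, ?_, ?_⟩
        · simp only [Prod.fst_add, Subring.coe_add, Subring.coe_mul, SubmonoidClass.coe_pow, ← h1,
            ← h3]
          ring
        · simp only [map_add, map_mul, map_pow, h2, h4, Prod.snd_add]
          ring
      neg_mem' := by
        rintro p ⟨n, a, h1, h2⟩
        exact ⟨n, -a, by simp [h1], by simp [h2]⟩
      mul_mem' := by
        rintro p q ⟨n, a, h1, h2⟩ ⟨m, b, h3, h4⟩
        refine ⟨n + m, a * b, ?_, ?_⟩
        · simp only [Prod.fst_mul, Subring.coe_mul, ← h1, ← h3]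
          ring
        · simp only [map_mul, h2, h4, Prod.snd_mul]
          ring }
  -- The graph is single-valued because powers of `φ g` are nonzerodivisors.
  have huniq {k : K} {c c' : C} (h : (k, c) ∈ R) (h' : (k, c') ∈ R) : c = c' := by
    obtain ⟨n, a, h1, h2⟩ := h
    obtain ⟨m, b, h3, h4⟩ := h'
    have hab : g ^ m * a = g ^ n * b := Subtype.ext (by
      simp only [Subring.coe_mul, SubmonoidClass.coe_pow, ← h1, ← h3]
      ring)
    have := congrArg φ hab
    rw [map_mul, map_mul, map_pow, map_pow, h2, h4] at this
    have h5 := pow_mem hφg (n + m)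
    exact (mul_cancel_left_mem_nonZeroDivisors h5).1 (by
      simp only at this
      rw [pow_add]
      linear_combination this)
  have hA (a : A) : ((a : K), φ a) ∈ R := ⟨0, a, by simp, by simp⟩
  have hle : affineBlowup A G g ≤ R.map (RingHom.fst K C) := by
    refine affineBlowup_le (fun a ha ↦ ⟨_, hA ⟨a, ha⟩, rfl⟩) fun h hh ↦ ?_
    obtain ⟨c, hc⟩ := hφ h hh
    exact ⟨((h : K) / g, c), ⟨1, h, by field_simp, by simpa using hc⟩, rfl⟩
  have hex (b : affineBlowup A G g) : ∃ c, ((b : K), c) ∈ R := by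
    obtain ⟨⟨k, c⟩, h, h'⟩ := hle b.2
    exact ⟨c, by rw [← h']; exact h⟩
  choose ψ hψ using hex
  refine ⟨{ toFun := ψ, map_one' := ?_, map_mul' := ?_, map_zero' := ?_, map_add' := ?_ }, ?_⟩
  · exact huniq (hψ 1) R.one_mem
  · exact fun a b ↦ huniq (hψ (a * b)) (R.mul_mem (hψ a) (hψ b))
  · exact huniq (hψ 0) R.zero_mem
  · exact fun a b ↦ huniq (hψ (a + b)) (R.add_mem (hψ a) (hψ b))
  · ext a
    exact huniq (hψ _) (hA a)

variable {X Y : Scheme.{0}} [X.IsSeparated] [Y.IsSeparated] {ηX : Spec (.of K) ⟶ X}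
  {ηY : Spec (.of K) ⟶ Y} {π : X ⟶ Y}

/-- A birational morphism with a section over an affine chart is an isomorphism there. -/
lemma eq_of_isUnit [IsReduced X] [IsDominant ηX] (hπ : ηX ≫ π = ηY) {A : Subring K}
    {c : Spec (.of A) ⟶ Y} (hc : IsChart ηY A c) {G : Set A} {g : A} (hg : g ≠ 0)
    (hcent : HasCenter ηX (affineBlowup A G g)) {T : Scheme.{0}}
    (u : T ⟶ Spec (.of (Localization.Away g))) {ρ₁ ρ₂ : T ⟶ X} (h₁ : ρ₁ ≫ π = u ≫ specAway g ≫ c)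
    (h₂ : ρ₂ ≫ π = u ≫ specAway g ≫ c) : ρ₁ = ρ₂ := by
  have := hc.1
  have hg' : (g : K) ≠ 0 := by simpa using hg
  let ι : Localization.Away g →+* K :=
    IsLocalization.Away.lift (S := Localization.Away g) g (g := A.subtype) hg'.isUnit
  have hι (a : A) : ι (algebraMap A _ a) = a := IsLocalization.Away.lift_eq _ _ _
  have hιu : IsUnit (ι (algebraMap A _ g)) := (hι g).symm ▸ hg'.isUnit
  -- Once `g` is inverted the fractions `h / g` are already available, so the centre of `A[h/g]`
  -- restricts to a section of `π` over the locus where `g` is invertible.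
  have hle : affineBlowup A G g ≤ ι.range := by
    refine affineBlowup_le (fun a ha ↦ ⟨_, hι ⟨a, ha⟩⟩) fun a _ ↦ ?_
    refine ⟨algebraMap A _ a * IsLocalization.Away.invSelf g, ?_⟩
    rw [eq_div_iff hg', ← hι g, ← map_mul, mul_assoc, mul_comm _ (algebraMap A _ g),
      IsLocalization.Away.mul_invSelf, mul_one, hι]
  obtain ⟨d, hd⟩ := hcent.mono hle
  have hιinj : Function.Injective ι := by
    rw [injective_iff_map_eq_zero]
    intro z hz
    obtain ⟨n, a, ha⟩ := IsLocalization.Away.surj g z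
    have h0 : (a : K) = 0 := by rw [← hι a, ← ha, map_mul, hz, zero_mul]
    rw [(by simpa using h0 : a = 0), map_zero] at ha
    exact ((IsLocalization.Away.algebraMap_isUnit g).pow n).mul_left_eq_zero.1 ha
  let e : Localization.Away g ≃+* ι.range := RingEquiv.ofBijective ι.rangeRestrict
    ⟨fun a b h ↦ hιinj congr(($h : K)), ι.rangeRestrict_surjective⟩
  let d' : Spec (.of (Localization.Away g)) ⟶ X :=
    Spec.map (CommRingCat.ofHom (e.symm : ι.range →+* Localization.Away g)) ≫ d
  have hd' : Spec.map (CommRingCat.ofHom ι) ≫ d' = ηX := by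
    rw [← hd, ← Category.assoc, ← Spec.map_comp, ← CommRingCat.ofHom_comp]
    congr 3
    ext a
    obtain ⟨a, rfl⟩ := e.surjective a
    exact congrArg ι (e.symm_apply_apply a)
  have hιc : Spec.map (CommRingCat.ofHom ι) ≫ specAway g ≫ c = ηY := by
    rw [← hc.2, ← Category.assoc, ← Spec.map_comp, ← CommRingCat.ofHom_comp]
    congr 3
    exact RingHom.ext hι
  have hιdom := isDominant_specMap_of_injective ι hιinj
  have hred : IsReduced (Spec (.of (Localization.Away g))) := by
    have : IsDomain (Localization.Away g) := hιinj.isDomain ι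
    infer_instance
  have hd'π : d' ≫ π = specAway g ≫ c := by
    apply ext_of_isDominant (Spec.map (CommRingCat.ofHom ι))
    rw [reassoc_of% hd', hπ, hιc]
  let P := pullback π (specAway g ≫ c)
  let fst : P ⟶ X := pullback.fst π (specAway g ≫ c)
  let snd : P ⟶ _ := pullback.snd π (specAway g ≫ c)
  have : IsReduced P := isReduced_of_isOpenImmersion fst
  have : P.IsSeparated := ⟨by rw [← terminal.comp_from fst]; infer_instance⟩
  let q : Spec (.of K) ⟶ P := pullback.lift ηX (Spec.map (CommRingCat.ofHom ι))
    (by rw [hπ, hιc])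
  have : IsDominant q := by
    have : IsDominant (q ≫ fst) := by rw [pullback.lift_fst]; infer_instance
    exact IsDominant.of_comp_of_isOpenImmersion _ fst
  let σ : Spec (.of (Localization.Away g)) ⟶ P := pullback.lift d' (𝟙 _)
    (by rw [hd'π, Category.id_comp])
  -- The section is also a left inverse on the preimage, which is reduced and has dense generic
  -- point. Hence a lift is determined by its image downstairs.
  have hσ : snd ≫ σ = 𝟙 P := by
    apply ext_of_isDominant q
    have h1 : q ≫ snd = Spec.map (CommRingCat.ofHom ι) := pullback.lift_snd _ _ _
    rw [reassoc_of% h1, Category.comp_id]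
    apply pullback.hom_ext
    · rw [Category.assoc, pullback.lift_fst, pullback.lift_fst, hd']
    · rw [Category.assoc, pullback.lift_snd, pullback.lift_snd, Category.comp_id]
  have key : pullback.lift ρ₁ u h₁ = pullback.lift ρ₂ u h₂ := by
    rw [← Category.comp_id (pullback.lift ρ₁ u h₁), ← Category.comp_id (pullback.lift ρ₂ u h₂),
      ← hσ, ← Category.assoc, ← Category.assoc, pullback.lift_snd, pullback.lift_snd]
  rw [← pullback.lift_fst ρ₁ u h₁, key, pullback.lift_fst]

/-- Uniqueness of local lifts to a blowing-up. -/
lemma eq_of_mem_nonZeroDivisors [IsReduced X] [IsDominant ηX] (hπ : ηX ≫ π = ηY) {A : Subring K}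
    {c : Spec (.of A) ⟶ Y} (hc : IsChart ηY A c) {G : Set A} {g : A} (hg : g ≠ 0)
    (hcent : HasCenter ηX (affineBlowup A G g)) {C : Type} [CommRing C] (φ : A →+* C)
    (hφ : φ g ∈ nonZeroDivisors C) {T : Scheme.{0}}
    (u : T ⟶ Spec (.of C)) [Flat u] {ρ₁ ρ₂ : T ⟶ X}
    (h₁ : ρ₁ ≫ π = u ≫ Spec.map (CommRingCat.ofHom φ) ≫ c)
    (h₂ : ρ₂ ≫ π = u ≫ Spec.map (CommRingCat.ofHom φ) ≫ c) : ρ₁ = ρ₂ := by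
  have hinj : Function.Injective (algebraMap C (Localization.Away (φ g))) :=
    IsLocalization.injective _ (Submonoid.powers_le.2 hφ)
  have := isSchemeTheoreticallyDominant_specMap _ hinj
  let φ' : Localization.Away g →+* Localization.Away (φ g) :=
    IsLocalization.Away.map (Localization.Away g) (Localization.Away (φ g)) φ g
  have hφ' : specAway (φ g) ≫ Spec.map (CommRingCat.ofHom φ) =
      Spec.map (CommRingCat.ofHom φ') ≫ specAway g := by
    rw [← Spec.map_comp, ← Spec.map_comp, ← CommRingCat.ofHom_comp, ← CommRingCat.ofHom_comp]
    congr 2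
    exact (IsLocalization.map_comp _).symm
  have : IsSchemeTheoreticallyDominant (specAway (φ g)) := this
  -- Inverting a nonzerodivisor is scheme-theoretically dominant and stays so after the flat base
  -- change `u`, so it is enough to compare where `φ g` is invertible.
  apply ext_of_isSchemeTheoreticallyDominant (pullback.snd (specAway (φ g)) u)
  have e : pullback.snd (specAway (φ g)) u ≫ u ≫ Spec.map (CommRingCat.ofHom φ) ≫ c =
      (pullback.fst (specAway (φ g)) u ≫ Spec.map (CommRingCat.ofHom φ')) ≫ specAway g ≫ c := by
    rw [← pullback.condition_assoc, Category.assoc, reassoc_of% hφ']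
  refine eq_of_isUnit hπ hc hg hcent
    (pullback.fst (specAway (φ g)) u ≫ Spec.map (CommRingCat.ofHom φ')) ?_ ?_
  · rw [Category.assoc, h₁, e]
  · rw [Category.assoc, h₂, e]

/-- The data describing a blowing-up over an affine chart: the centre is given by the ideal
generated by `G`, and the rings `A[h / g : h ∈ G]` have a centre on the blowing-up. -/
structure IsBlowupDatum (ηX : Spec (.of K) ⟶ X) (ηY : Spec (.of K) ⟶ Y) (I : Y.IdealSheafData)
    (A : Subring K) (c : Spec (.of A) ⟶ Y) (G : Set A) : Prop where
  isChart : IsChart ηY A c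
  restr_eq : restr I c = Ideal.span G
  ne_zero : ∀ g ∈ G, g ≠ 0
  hasCenter : ∀ g ∈ G, HasCenter ηX (affineBlowup A G g)

/-- On a chart ring `B` containing all `h / g`, the pulled-back ideal is generated by `g`, which
gives invertibility. Conversely, for a test morphism some `g` locally divides the other generators,
so the map from `A` extends to `A[h/g]` and the centre of that ring supplies the lift. -/
lemma isBlowup_of_isBlowupDatum [IsReduced X] [IsDominant ηX] (hπ : ηX ≫ π = ηY)
    {I : Y.IdealSheafData}
    (hY : ∀ y : Y, ∃ A c G, IsBlowupDatum ηX ηY I A c G ∧ y ∈ Set.range c)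
    (hX : ∀ x : X, ∃ A c G, IsBlowupDatum ηX ηY I A c G ∧ ∃ (B : Subring K) (b : _),
      IsChart ηX B b ∧ x ∈ Set.range b ∧ A ≤ B ∧ ∃ g ∈ G, ∀ h ∈ G, (h : K) / g ∈ B) :
    IsBlowup I π := by
  constructor
  · rw [isInvertibleIdeal_iff]
    intro x
    obtain ⟨A, c, G, hD, B, b, hb, hx, hAB, g, hg, hG⟩ := hX x
    refine ⟨B, inferInstance, b, hb.1, hx, Subring.inclusion hAB g,
      mem_nonZeroDivisors_of_ne_zero ?_, ?_⟩
    · intro h0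
      exact hD.ne_zero g hg (Subring.inclusion_injective hAB (h0.trans (map_zero _).symm))
    · rw [restr_comap, IsChart.comp_eq hπ hAB hb.2 hD.isChart.2, specIncl, restr_specMap_comp,
        hD.restr_eq, Ideal.map_span]
      refine le_antisymm (Ideal.span_le.2 ?_) (Ideal.span_mono ?_)
      · rintro _ ⟨h, hh, rfl⟩
        refine Ideal.mem_span_singleton'.2 ⟨⟨_, hG h hh⟩, Subtype.ext ?_⟩
        have : (g : K) ≠ 0 := by simpa using hD.ne_zero g hg
        exact div_mul_cancel₀ _ this
      · rintro _ rfl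
        exact ⟨g, hg, rfl⟩
  · intro Z f hI
    -- Uniqueness is recorded for every flat `T` over the local piece, so that it applies both to
    -- the overlaps, where lifts are glued, and to the piece itself, where the global lift is
    -- unique.
    have hloc (z : Z) : ∃ (C : Type) (_ : CommRing C) (j : Spec (.of C) ⟶ Z) (_ : IsOpenImmersion j)
        (ρ : Spec (.of C) ⟶ X), z ∈ Set.range j ∧ ρ ≫ π = j ≫ f ∧
        ∀ (T : Scheme.{0}) (u : T ⟶ Spec (.of C)), Flat u → ∀ ρ₁ ρ₂ : T ⟶ X,
          ρ₁ ≫ π = u ≫ j ≫ f → ρ₂ ≫ π = u ≫ j ≫ f → ρ₁ = ρ₂ := by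
      obtain ⟨A, c, G, hD, hz⟩ := hY (f z)
      have := hD.isChart.1
      obtain ⟨C, _, j, hj, hzj, φ, hφ, g, hg, hgn, hgd⟩ :=
        exists_local_generator c I G hD.restr_eq f hI z hz
      obtain ⟨ψ, hψ⟩ := exists_extension (hD.ne_zero g hg) φ hgn hgd
      obtain ⟨d, hd⟩ := hD.hasCenter g hg
      refine ⟨C, inferInstance, j, hj, Spec.map (CommRingCat.ofHom ψ) ≫ d, hzj, ?_,
        fun T u hu ρ₁ ρ₂ h₁ h₂ ↦ ?_⟩
      · rw [Category.assoc, IsChart.comp_eq hπ (le_affineBlowup A G g) hd hD.isChart.2, hφ, ← hψ,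
          specIncl, ← Category.assoc, ← Spec.map_comp, ← CommRingCat.ofHom_comp]
      · rw [hφ] at h₁ h₂
        exact eq_of_mem_nonZeroDivisors hπ hD.isChart (hD.ne_zero g hg) (hD.hasCenter g hg) φ hgn u
          h₁ h₂
    choose C _ j hj ρ hz hρ huniq using hloc
    let 𝒰 : Z.OpenCover := {
      I₀ := Z, X z := Spec (.of (C z)), f z := j z,
      mem₀ := by
        rw [Scheme.presieve₀_mem_precoverage_iff]
        exact ⟨fun z ↦ ⟨z, hz z⟩, fun z ↦ hj z⟩ }
    refine ⟨𝒰.glueMorphisms ρ ?_, 𝒰.hom_ext _ _ fun z ↦ ?_, fun h hh ↦ 𝒰.hom_ext _ _ fun z ↦ ?_⟩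
    · intro z w
      refine huniq z _ (pullback.fst (j z) (j w)) inferInstance _ _ ?_ ?_
      · exact (Category.assoc _ _ _).trans (by rw [hρ])
      · refine (Category.assoc _ _ _).trans ?_
        rw [hρ, pullback.condition_assoc]
    · rw [← Category.assoc, 𝒰.ι_glueMorphisms]
      exact hρ z
    · rw [𝒰.ι_glueMorphisms]
      refine huniq z _ (𝟙 _) inferInstance _ _ ?_ ?_
      · rw [Category.assoc, hh, Category.id_comp]
      · rw [hρ, Category.id_comp]

end Blowup

/-! ### Elementary transformations at a pair of conjugate points -/

section

variable {K : Type} [Field K] [Algebra ℝ K]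

/-- The structure homomorphism of `rng s`. -/
def rngC (s : Set K) : ℝ →+* rng s := (algebraMap ℝ K).codRestrict (rng s) (algebraMap_mem_rng s)

lemma rng_induction {s : Set K} {P : rng s → Prop} (hs : ∀ (a : K) (ha : a ∈ s), P ⟨a, mem_rng ha⟩)
    (hC : ∀ r, P (rngC s r)) (hadd : ∀ a b, P a → P b → P (a + b))
    (hmul : ∀ a b, P a → P b → P (a * b)) (a : rng s) : P a := by
  obtain ⟨a, ha⟩ := a
  induction (show a ∈ Algebra.adjoin ℝ s from ha) using Algebra.adjoin_induction with
  | mem a h => exact hs a h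
  | algebraMap r => exact hC r
  | add a b h h' ih ih' => exact hadd ⟨a, h⟩ ⟨b, h'⟩ (ih h) (ih' h')
  | mul a b h h' ih ih' => exact hmul ⟨a, h⟩ ⟨b, h'⟩ (ih h) (ih' h')

lemma rng_hom_ext {s : Set K} {C : Type} [CommRing C] {φ ψ : rng s →+* C}
    (hC : ∀ r, φ (rngC s r) = ψ (rngC s r))
    (hs : ∀ (a : K) (ha : a ∈ s), φ ⟨a, mem_rng ha⟩ = ψ ⟨a, mem_rng ha⟩) : φ = ψ := by
  ext a
  induction a using rng_induction with
  | hs a ha => exact hs a ha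
  | hC r => exact hC r
  | hadd a b ha hb => rw [map_add, map_add, ha, hb]
  | hmul a b ha hb => rw [map_mul, map_mul, ha, hb]

/-- The first generator of `rng {a, b}`. -/
abbrev genL (a b : K) : rng {a, b} := ⟨a, mem_rng_left a b⟩

/-- The second generator of `rng {a, b}`. -/
abbrev genR (a b : K) : rng {a, b} := ⟨b, mem_rng_right a b⟩

/-- Evaluation of polynomials at `(a, b)`. -/
def evalPair (a b : K) : MvPolynomial (Fin 2) ℝ →+* K :=
  MvPolynomial.eval₂Hom (algebraMap ℝ K) ![a, b]

lemma range_evalPair (a b : K) : (evalPair a b).range = rng {a, b} := by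
  ext k
  rw [rng, Subalgebra.mem_toSubring, ← Matrix.range_cons_cons_empty a b ![],
    Algebra.adjoin_range_eq_range_aeval]
  rfl

lemma Coords.evalPair_injective {a b : K} (h : Coords a b) : Function.Injective (evalPair a b) :=
  h.1

/-- If `a` and `b` are independent then `rng {a, b}` is a polynomial ring. -/
def Coords.equiv {a b : K} (h : Coords a b) : MvPolynomial (Fin 2) ℝ ≃+* rng {a, b} :=
  (RingEquiv.ofBijective (evalPair a b).rangeRestrict
    ⟨fun _ _ hpq ↦ h.evalPair_injective (congrArg Subtype.val hpq),
      RingHom.rangeRestrict_surjective _⟩).trans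
  (RingEquiv.subringCongr (range_evalPair a b))

lemma Coords.equiv_C {a b : K} (h : Coords a b) (r : ℝ) :
    h.equiv (MvPolynomial.C r) = rngC {a, b} r :=
  Subtype.ext (MvPolynomial.eval₂_C (algebraMap ℝ K) ![a, b] r)

lemma Coords.equiv_X_zero {a b : K} (h : Coords a b) :
    h.equiv (MvPolynomial.X 0) = genL a b := Subtype.ext (MvPolynomial.eval₂_X (algebraMap ℝ K) ![a, b] 0)

lemma Coords.equiv_X_one {a b : K} (h : Coords a b) :
    h.equiv (MvPolynomial.X 1) = genR a b := Subtype.ext (MvPolynomial.eval₂_X (algebraMap ℝ K) ![a, b] 1)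

lemma Coords.exists_hom {a b : K} (h : Coords a b) {C : Type} [CommRing C] (ρ : ℝ →+* C)
    (α β : C) : ∃ φ : rng {a, b} →+* C, φ.comp (rngC _) = ρ ∧ φ (genL a b) = α ∧
      φ (genR a b) = β := by
  refine ⟨(MvPolynomial.eval₂Hom ρ ![α, β]).comp h.equiv.symm, ?_, ?_, ?_⟩
  · ext r
    simp [← h.equiv_C]
  · simp [← h.equiv_X_zero]
  · simp [← h.equiv_X_one]

lemma hom_ext_specReal {B : Subring K} {f g : Spec (.of B) ⟶ Spec (.of ℝ)}
    (h : genPt B ≫ f = genPt B ≫ g) : f = g := hom_ext_of_genPt h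

/-- A complex point with `t ^ 2 = -1`, `x = 0` generates the ideal `(1 + t ^ 2, x)`. -/
lemma ker_eq_span {t x : K} (φ : rng {t, x} →+* ℂ) (hC : φ.comp (rngC _) = algebraMap ℝ ℂ)
    (ht : φ (genL t x) ^ 2 = -1) (hx : φ (genR t x) = 0) :
    RingHom.ker φ = Ideal.span {1 + genL t x ^ 2, genR t x} := by
  have hC' (r : ℝ) : φ (rngC _ r) = r := congr($hC r)
  refine le_antisymm (fun a ha ↦ ?_) (Ideal.span_le.2 ?_)
  · set J := Ideal.span {1 + genL t x ^ 2, genR t x} with hJ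
    have h1 : 1 + genL t x ^ 2 ∈ J := Ideal.subset_span (by simp)
    have h2 : genR t x ∈ J := Ideal.subset_span (by simp)
    -- Modulo `J` every function is `α + β t`, and products reduce by `t ^ 2 = -1` exactly as for
    -- complex numbers.
    obtain ⟨α, β, h⟩ : ∃ α β : ℝ, a - (rngC _ α + rngC _ β * genL t x) ∈ J := by
      clear ha
      induction a using rng_induction with
      | hs a ha =>
        rcases ha with rfl | rfl
        · exact ⟨0, 1, by simp⟩
        · exact ⟨0, 0, by simpa using h2⟩
      | hC r => exact ⟨r, 0, by simp⟩
      | hadd a b ha hb =>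
        obtain ⟨α, β, h⟩ := ha
        obtain ⟨γ, δ, h'⟩ := hb
        refine ⟨α + γ, β + δ, ?_⟩
        convert J.add_mem h h' using 1
        rw [map_add, map_add]
        ring
      | hmul a b ha hb =>
        obtain ⟨α, β, h⟩ := ha
        obtain ⟨γ, δ, h'⟩ := hb
        refine ⟨α * γ - β * δ, α * δ + β * γ, ?_⟩
        convert J.add_mem (J.add_mem (J.mul_mem_right b h)
          (J.mul_mem_left (rngC _ α + rngC _ β * genL t x) h'))
          (J.mul_mem_left (rngC _ β * rngC _ δ) h1) using 1
        rw [map_add, map_sub, map_mul, map_mul, map_mul, map_mul]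
        ring
    have hle : J ≤ RingHom.ker φ := by
      rw [hJ, Ideal.span_le]
      rintro _ (rfl | rfl)
      · change φ (1 + genL t x ^ 2) = 0
        rw [map_add, map_pow, ht, map_one, add_neg_cancel]
      · exact hx
    have h3 : φ (rngC _ α + rngC _ β * genL t x) = 0 := by
      have : φ a = 0 := ha
      have h4 : φ (a - (rngC _ α + rngC _ β * genL t x)) = 0 := hle h
      rw [map_sub, this, zero_sub, neg_eq_zero] at h4
      exact h4
    rw [map_add, map_mul, hC', hC'] at h3
    -- Multiply the vanishing value by its formal conjugate `α - β t`.
    have h4 : ((α ^ 2 + β ^ 2 : ℝ) : ℂ) = 0 := by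
      push_cast
      linear_combination (α - β * φ (genL t x)) * h3 + β ^ 2 * ht
    have h5 : α ^ 2 + β ^ 2 = 0 := by exact_mod_cast h4
    have h6 : α = 0 := by nlinarith [sq_nonneg α, sq_nonneg β]
    have h7 : β = 0 := by nlinarith [sq_nonneg α, sq_nonneg β]
    simpa [h6, h7] using h
  · rintro _ (rfl | rfl)
    · change φ (1 + genL t x ^ 2) = 0
      rw [map_add, map_pow, ht, map_one, add_neg_cancel]
    · exact hx

variable {X Y : Scheme.{0}} {ηX : Spec (.of K) ⟶ X} {ηY : Spec (.of K) ⟶ Y} {t s x y : K}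

/-- A nonreal complex point with `t ^ 2 = -1`, `x = 0` in a chart with coordinates `t`, `x`. -/
def IsCenter (ηY : Spec (.of K) ⟶ Y) (t x : K) (p : Spec (.of ℂ) ⟶ Y) : Prop :=
  ∃ c, IsChart ηY (rng {t, x}) c ∧ ∃ φ : rng {t, x} →+* ℂ, Spec.map (CommRingCat.ofHom φ) ≫ c = p ∧
    φ.comp (rngC _) = algebraMap ℝ ℂ ∧ φ (genL t x) ^ 2 = -1 ∧ φ (genR t x) = 0

/-- Evaluation at `a = i`, `b = 0` extends to the ring with `1 / a` adjoined because `i` is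
invertible; this is `exists_extension` with `G = {1}`. One homomorphism then serves both halves of
the base. -/
lemma exists_hom_inv {a b c : K} (h : Coords a b) (hac : a * c = 1) :
    ∃ (B : Subring K) (ψ : B →+* ℂ) (hC : ∀ r, algebraMap ℝ K r ∈ B) (ha : a ∈ B) (_hc : c ∈ B)
      (hb : b ∈ B), (∀ r, ψ ⟨_, hC r⟩ = r) ∧ ψ ⟨a, ha⟩ = Complex.I ∧ ψ ⟨b, hb⟩ = 0 := by
  obtain ⟨φ, hφC, hφa, hφb⟩ := h.exists_hom (algebraMap ℝ ℂ) Complex.I 0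
  have ha0 : genL a b ≠ 0 := fun h0 ↦ h.left_ne_zero congr(($h0 : K))
  have h1 : φ (genL a b) ∈ nonZeroDivisors ℂ := by
    rw [hφa]; exact mem_nonZeroDivisors_of_ne_zero Complex.I_ne_zero
  have h2 : ∀ g ∈ ({1} : Set (rng {a, b})), φ (genL a b) ∣ φ g := by
    intro g _
    rw [hφa]
    exact (isUnit_iff_ne_zero.2 Complex.I_ne_zero).dvd
  obtain ⟨ψ, hψ⟩ := exists_extension ha0 φ h1 h2
  have hle := le_affineBlowup (rng {a, b}) {1} (genL a b)
  have key (g : rng {a, b}) : ψ ⟨g, hle g.2⟩ = φ g := congr($hψ g)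
  refine ⟨_, ψ, fun r ↦ hle (algebraMap_mem_rng _ r), hle (mem_rng_left a b), ?_,
    hle (mem_rng_right a b), fun r ↦ ?_, ?_, ?_⟩
  · rw [eq_inv_of_mul_eq_one_right hac]
    exact Subring.subset_closure (Or.inr ⟨1, rfl, by simp⟩)
  · exact (key (rngC _ r)).trans congr($hφC r)
  · exact (key (genL a b)).trans hφa
  · exact (key (genR a b)).trans hφb

lemma isCenter_of_hom {B : Subring K} (ψ : B →+* ℂ) (hC : ∀ r, algebraMap ℝ K r ∈ B)
    (ht : t ∈ B) (hx : x ∈ B) (hψC : ∀ r, ψ ⟨_, hC r⟩ = r) (hψt : ψ ⟨t, ht⟩ ^ 2 = -1)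
    (hψx : ψ ⟨x, hx⟩ = 0) {c : Spec (.of (rng {t, x})) ⟶ Y} (hc : IsChart ηY (rng {t, x}) c)
    (hle : rng {t, x} ≤ B) :
    IsCenter ηY t x (Spec.map (CommRingCat.ofHom ψ) ≫ specIncl hle ≫ c) := by
  refine ⟨c, hc, ψ.comp (Subring.inclusion hle), ?_, ?_, hψt, hψx⟩
  · rw [CommRingCat.ofHom_comp, Spec.map_comp, Category.assoc, specIncl]
  · ext r
    exact hψC r

/-- The point lies over `t = i`, where `s = 1 / t` also has square -1 and `y` is a multiple of `x`.
So the same point is the centre when viewed in either chart. -/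
lemma exists_isCenter (h : IsRuledData t s x y) [Y.IsSeparated]
    (h₁ : ∃ c, IsChart ηY (rng {t, x}) c) (h₂ : ∃ c, IsChart ηY (rng {s, y}) c) :
    ∃ p, IsCenter ηY t x p ∧ IsCenter ηY s y p := by
  obtain ⟨c, hc⟩ := h₁
  obtain ⟨d, hd⟩ := h₂
  obtain ⟨B, ψ, hC, ht, hs, hx, hψC, hψt, hψx⟩ := exists_hom_inv h.coords h.mul_eq_one
  have hψs : ψ ⟨s, hs⟩ ^ 2 = -1 := by
    have h1 : (⟨t, ht⟩ : B) * ⟨s, hs⟩ = 1 := Subtype.ext h.mul_eq_one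
    have h2 := congrArg ψ h1
    rw [map_mul, map_one, hψt] at h2
    linear_combination (-Complex.I * ψ ⟨s, hs⟩ - 1) * h2 + ψ ⟨s, hs⟩ ^ 2 * Complex.I_sq
  have hpow (k : ℤ) : t ^ k ∈ B := by
    cases k with
    | ofNat k => rw [Int.ofNat_eq_natCast, zpow_natCast]; exact B.pow_mem ht k
    | negSucc k => rw [zpow_negSucc, ← inv_pow, ← h.s_eq]; exact B.pow_mem hs _
  obtain ⟨k, hk⟩ := h.exists_zpow
  have hy : y ∈ B := hk ▸ B.mul_mem (hpow k) hx
  have hψy : ψ ⟨y, hy⟩ = 0 := by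
    have h1 : (⟨y, hy⟩ : B) = ⟨t ^ k, hpow k⟩ * ⟨x, hx⟩ := Subtype.ext hk
    rw [h1, map_mul, hψx, mul_zero]
  have hle : rng {t, x} ≤ B := rng_le hC (pair_subset ht hx)
  have hle' : rng {s, y} ≤ B := rng_le hC (pair_subset hs hy)
  have e : specIncl hle ≫ c = specIncl hle' ≫ d := hom_ext_of_genPt (by
    rw [genPt_specIncl_assoc, genPt_specIncl_assoc, hc.2, hd.2])
  refine ⟨_, isCenter_of_hom ψ hC ht hx hψC (by rw [hψt, Complex.I_sq]) hψx hc hle, ?_⟩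
  rw [e]
  exact isCenter_of_hom ψ hC hs hy hψC hψs hψy hd hle'

namespace IsCenter

variable {p : Spec (.of ℂ) ⟶ Y}

/-- The coordinate `t` has square -1 at the point, so it is not real. -/
lemma ne_conj (h : IsCenter ηY t x p) :
    Spec.map (CommRingCat.ofHom (starRingEnd ℂ)) ≫ p ≠ p := by
  obtain ⟨c, hc, φ, hp, hC, ht, hx⟩ := h
  have := hc.1
  intro h
  rw [← hp, ← Category.assoc, cancel_mono, ← Spec.map_comp, ← CommRingCat.ofHom_comp] at h
  have h1 : starRingEnd ℂ (φ (genL t x)) = φ (genL t x) :=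
    congr(($(Spec.map_injective h)).hom (genL t x))
  obtain ⟨r, hr⟩ := Complex.conj_eq_iff_real.1 h1
  rw [hr] at ht
  have : r ^ 2 = -1 := by exact_mod_cast ht
  nlinarith [sq_nonneg r]

lemma comp_hom (h : IsCenter ηY t x p) (f : Y ⟶ Spec (.of ℝ))
    (hf : ηY ≫ f = Spec.map (CommRingCat.ofHom (algebraMap ℝ K))) :
    p ≫ f = Spec.map (CommRingCat.ofHom (algebraMap ℝ ℂ)) := by
  obtain ⟨c, hc, φ, hp, hC, ht, hx⟩ := h
  have e : c ≫ f = Spec.map (CommRingCat.ofHom (rngC _)) := hom_ext_specReal (by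
    rw [reassoc_of% hc.2, hf, genPt, ← Spec.map_comp]; rfl)
  rw [← hp, Category.assoc, e, ← Spec.map_comp, ← CommRingCat.ofHom_comp, hC]

lemma restr_eq (h : IsCenter ηY t x p) : ∃ c, IsChart ηY (rng {t, x}) c ∧
    restr p.ker c = Ideal.span {1 + genL t x ^ 2, genR t x} := by
  obtain ⟨c, hc, φ, hp, hC, ht, hx⟩ := h
  have := hc.1
  exact ⟨c, hc, by rw [restr_ker p φ c hp, ker_eq_span φ hC ht hx]⟩

/-- The function `x` vanishes at the centre while `x⁻¹` is regular on this chart, so the centre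
misses the chart and its ideal there is the unit ideal. -/
lemma restr_inv_eq (h : IsCenter ηY t x p) (hx0 : x ≠ 0) {d : Spec (.of (rng {t, x⁻¹})) ⟶ Y}
    (hd : IsChart ηY (rng {t, x⁻¹}) d) : restr p.ker d = Ideal.span {1} := by
  obtain ⟨c, hc, φ, hp, hC, ht, hx⟩ := h
  have := hc.1
  have := hd.1
  rw [Ideal.span_singleton_one]
  refine restr_eq_top_of_notMem_range _ _ fun z hz hz' ↦ ?_
  have hz2 : z ∈ closure (Set.range p) := by rw [← Scheme.Hom.support_ker]; exact hz
  obtain ⟨_, ⟨q, hq⟩, w, rfl⟩ := mem_closure_iff.1 hz2 _ d.isOpenEmbedding.isOpen_range hz'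
  have h1 : c (Spec.map (CommRingCat.ofHom φ) w) = d q := by
    rw [hq, ← hp]; rfl
  refine hc.notMem_of_mul_eq_one hd h1 (genR t x) (genR t x⁻¹) (mul_inv_cancel₀ hx0) ?_
  change φ (genR t x) ∈ w.asIdeal
  rw [hx]
  exact w.asIdeal.zero_mem

/-- The blow-up data over the two charts with base coordinate `t`. -/
lemma isBlowupDatum [X.IsSeparated] [Y.IsSeparated] (h : IsCenter ηY t x p) (hx : x ≠ 0)
    (ht : 1 + t ^ 2 ≠ 0)
    (hc₁ : HasCenter ηX (rng {t, x / (1 + t ^ 2)})) (hc₂ : HasCenter ηX (rng {t, x, (1 + t ^ 2) / x}))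
    : ∃ c, IsBlowupDatum ηX ηY p.ker (rng {t, x}) c {1 + genL t x ^ 2, genR t x} := by
  obtain ⟨c, hc, he⟩ := h.restr_eq
  refine ⟨c, hc, he, ?_, ?_⟩
  · rintro _ (rfl | rfl)
    · exact fun h0 ↦ ht congr(($h0 : K))
    · exact fun h0 ↦ hx congr(($h0 : K))
  · have key (g : rng {t, x}) {u : Set K}
        (hu : u ⊆ affineBlowup (rng {t, x}) {1 + genL t x ^ 2, genR t x} g) :
        rng u ≤ affineBlowup (rng {t, x}) {1 + genL t x ^ 2, genR t x} g :=
      rng_le (fun r ↦ le_affineBlowup _ _ _ (algebraMap_mem_rng _ r)) hu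
    rintro _ (rfl | rfl)
    · exact hc₁.mono (key _ (pair_subset (le_affineBlowup _ _ _ (mem_rng_left _ _))
        (Subring.subset_closure (Or.inr ⟨genR t x, by simp, rfl⟩))))
    · exact hc₂.mono (key _ (triple_subset (le_affineBlowup _ _ _ (mem_rng_left _ _))
        (le_affineBlowup _ _ _ (mem_rng_right _ _))
        (Subring.subset_closure (Or.inr ⟨1 + genL t x ^ 2, by simp, rfl⟩))))

lemma isBlowupDatum_inv [X.IsSeparated] [Y.IsSeparated] (h : IsCenter ηY t x p) (hx : x ≠ 0)
    (hd : ∃ d, IsChart ηY (rng {t, x⁻¹}) d) (hc : HasCenter ηX (rng {t, x⁻¹})) :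
    ∃ d, IsBlowupDatum ηX ηY p.ker (rng {t, x⁻¹}) d {1} := by
  obtain ⟨d, hd⟩ := hd
  refine ⟨d, hd, h.restr_inv_eq hx hd, ?_, ?_⟩
  · rintro _ rfl
    exact one_ne_zero
  · rintro _ rfl
    exact hc.mono (le_affineBlowup _ _ _)

end IsCenter

lemma one_add_sq_mem {B : Subring K} {a : K} (ha : a ∈ B) : 1 + a ^ 2 ∈ B :=
  B.add_mem B.one_mem (B.pow_mem ha 2)

lemma rng_le_elem {t x : K} (h0 : 1 + t ^ 2 ≠ 0) : rng {t, x} ≤ rng {t, x / (1 + t ^ 2)} := by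
  refine rng_le_rng (pair_subset (mem_rng_left _ _) ?_)
  have := Subring.mul_mem _ (mem_rng_right t (x / (1 + t ^ 2)))
    (one_add_sq_mem (mem_rng_left t (x / (1 + t ^ 2))))
  rwa [div_mul_cancel₀ _ h0] at this

lemma rng_le_elem' (t x : K) : rng {t, x} ≤ rng {t, x, (1 + t ^ 2) / x} :=
  rng_mono (by simp [Set.insert_subset_iff])

/-- The centre lies in both charts of `Y` containing the zero section, with ideal `(1 + t ^ 2, x)`
or `(1 + s ^ 2, y)`. Above each of them sit two charts, one for each choice of generator of the
ideal; the two charts at infinity are unchanged. -/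
lemma isBlowup_elem [X.IsSeparated] [Y.IsSeparated] (h : IsRuledData t s x y)
    (hX : IsElem ηX t s x y) (hY : IsRuled ηY t s x y) :
    ∃ π : X ⟶ Y, ηX ≫ π = ηY ∧ ∃ p, IsCenter ηY t x p ∧ IsBlowup p.ker π := by
  have ht := h.coords.one_add_sq_ne_zero
  have hs := h.symm.coords.one_add_sq_ne_zero
  have hcY (B) (hB : B ∈ ruledRings t s x y) : HasCenter ηY B := by
    obtain ⟨c, hc⟩ := hY.isChart B hB
    exact ⟨c, hc.2⟩
  have hcX (B) (hB : B ∈ elemRings t s x y) : HasCenter ηX B := by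
    obtain ⟨c, hc⟩ := hX.isChart B hB
    exact ⟨c, hc.2⟩
  obtain ⟨π, hπ⟩ := hX.coveredBy.exists_hom (ηY := ηY) (by
    rintro _ (rfl | rfl | rfl | rfl | rfl | rfl)
    · exact (hcY _ (by simp [ruledRings])).mono (rng_le_elem ht)
    · exact (hcY _ (by simp [ruledRings])).mono (rng_le_elem' t x)
    · exact hcY _ (by simp [ruledRings])
    · exact (hcY _ (by simp [ruledRings])).mono (rng_le_elem hs)
    · exact (hcY _ (by simp [ruledRings])).mono (rng_le_elem' s y)
    · exact hcY _ (by simp [ruledRings]))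
  obtain ⟨p, hp, hp'⟩ := exists_isCenter (ηY := ηY) h (hY.isChart _ (by simp [ruledRings]))
    (hY.isChart _ (by simp [ruledRings]))
  obtain ⟨c₁, hc₁⟩ := hp.isBlowupDatum (ηX := ηX) h.x_ne_zero ht (hcX _ (by simp [elemRings]))
    (hcX _ (by simp [elemRings]))
  obtain ⟨c₂, hc₂⟩ := hp'.isBlowupDatum (ηX := ηX) h.y_ne_zero hs (hcX _ (by simp [elemRings]))
    (hcX _ (by simp [elemRings]))
  obtain ⟨c₃, hc₃⟩ := hp.isBlowupDatum_inv (ηX := ηX) h.x_ne_zero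
    (hY.isChart _ (by simp [ruledRings])) (hcX _ (by simp [elemRings]))
  obtain ⟨c₄, hc₄⟩ := hp'.isBlowupDatum_inv (ηX := ηX) h.y_ne_zero
    (hY.isChart _ (by simp [ruledRings])) (hcX _ (by simp [elemRings]))
  have := hX.coveredBy.isReduced
  have := hX.coveredBy.isDominant
  refine ⟨π, hπ, p, hp, isBlowup_of_isBlowupDatum hπ (fun z ↦ ?_) fun z ↦ ?_⟩
  · obtain ⟨B, hB, c, hc, hz⟩ := hY.coveredBy z
    have key {d : Spec (.of B) ⟶ Y} (hd : IsChart ηY B d) : z ∈ Set.range d := by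
      rwa [show d = c from hom_ext_of_genPt (hd.2.trans hc.2.symm)]
    rcases hB with rfl | rfl | rfl | rfl
    · exact ⟨_, _, _, hc₁, key hc₁.1⟩
    · exact ⟨_, _, _, hc₂, key hc₂.1⟩
    · exact ⟨_, _, _, hc₃, key hc₃.1⟩
    · exact ⟨_, _, _, hc₄, key hc₄.1⟩
  · obtain ⟨B, hB, c, hc, hz⟩ := hX.coveredBy z
    -- On this chart the inverse image ideal is generated by `1 + t ^ 2`.
    have key₁ {t x : K} (ht : 1 + t ^ 2 ≠ 0) : ∃ g ∈ ({1 + genL t x ^ 2, genR t x} : Set _),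
        ∀ h ∈ ({1 + genL t x ^ 2, genR t x} : Set _),
          (h : K) / g ∈ rng {t, x / (1 + t ^ 2)} := by
      refine ⟨1 + genL t x ^ 2, by simp, ?_⟩
      rintro _ (rfl | rfl)
      · rw [div_self (show ((1 + genL t x ^ 2 : rng {t, x}) : K) ≠ 0 from ht)]
        exact Subring.one_mem _
      · exact mem_rng_right _ _
    -- On this chart it is generated by `x`.
    have key₂ {t x : K} (hx : x ≠ 0) : ∃ g ∈ ({1 + genL t x ^ 2, genR t x} : Set _),
        ∀ h ∈ ({1 + genL t x ^ 2, genR t x} : Set _),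
          (h : K) / g ∈ rng {t, x, (1 + t ^ 2) / x} := by
      refine ⟨genR t x, by simp, ?_⟩
      rintro _ (rfl | rfl)
      · exact mem_rng (by simp)
      · rw [div_self (show ((genR t x : rng {t, x}) : K) ≠ 0 from hx)]
        exact Subring.one_mem _
    have key₃ (B : Subring K) (A : Subring K) : ∃ g ∈ ({1} : Set A), ∀ h ∈ ({1} : Set A),
        (h : K) / g ∈ B := by
      refine ⟨1, rfl, ?_⟩
      rintro _ rfl
      rw [Subring.coe_one, div_one]
      exact B.one_mem
    rcases hB with rfl | rfl | rfl | rfl | rfl | rfl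
    · exact ⟨_, _, _, hc₁, _, c, hc, hz, rng_le_elem ht, key₁ ht⟩
    · exact ⟨_, _, _, hc₁, _, c, hc, hz, rng_le_elem' t x, key₂ h.x_ne_zero⟩
    · exact ⟨_, _, _, hc₃, _, c, hc, hz, le_rfl, key₃ _ _⟩
    · exact ⟨_, _, _, hc₂, _, c, hc, hz, rng_le_elem hs, key₁ hs⟩
    · exact ⟨_, _, _, hc₂, _, c, hc, hz, rng_le_elem' s y, key₂ h.y_ne_zero⟩
    · exact ⟨_, _, _, hc₄, _, c, hc, hz, le_rfl, key₃ _ _⟩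

end

/-! ### Blowing-ups as morphisms over ℝ -/

section

variable {K : Type} [Field K] [Algebra ℝ K]

/-- The generic point of a scheme over `ℝ` is defined over `ℝ`. -/
def IsRealPt {X : RealScheme} (η : Spec (.of K) ⟶ X.left) : Prop :=
  η ≫ X.hom = Spec.map (CommRingCat.ofHom (algebraMap ℝ K))

lemma CoveredBy.comp_hom_eq {X Y : RealScheme} {ηX : Spec (.of K) ⟶ X.left}
    {ηY : Spec (.of K) ⟶ Y.left} {𝓑 : Set (Subring K)} (hX : CoveredBy ηX 𝓑)
    (hηX : IsRealPt ηX) (hηY : IsRealPt ηY) {f : X.left ⟶ Y.left} (hf : ηX ≫ f = ηY) :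
    f ≫ Y.hom = X.hom := by
  have : (Spec (CommRingCat.of ℝ)).IsSeparated := inferInstance
  exact hX.hom_ext (Y := Spec (CommRingCat.of ℝ)) (by
    rw [reassoc_of% hf]; exact hηY.trans hηX.symm)

lemma exists_isBlowupAtConjugatePair {X Y : RealScheme} [X.left.IsSeparated] [Y.left.IsSeparated]
    {ηX : Spec (.of K) ⟶ X.left} {ηY : Spec (.of K) ⟶ Y.left} {t s x y : K}
    (h : IsRuledData t s x y) (hX : IsElem ηX t s x y) (hY : IsRuled ηY t s x y)
    (hηX : IsRealPt ηX) (hηY : IsRealPt ηY) : ∃ π : X ⟶ Y, IsBlowupAtConjugatePair π := by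
  obtain ⟨π, hπ, p, hp, hb⟩ := isBlowup_elem h hX hY
  exact ⟨Over.homMk π (hX.coveredBy.comp_hom_eq hηX hηY hπ),
    Over.homMk p (hp.comp_hom _ hηY), hp.ne_conj, hb⟩

lemma isRealPt_projModelPt {n : ℕ} (w : Fin (n + 1) → K) (hw : ∃ i, IsUnit (w i)) :
    IsRealPt (X := projModel w hw) (projModelPt w hw) := by
  refine (Category.assoc _ _ _).symm.trans ?_
  refine (congrArg (· ≫ projSpaceToSpec n ℝ) (projModelPt_ι w hw)).trans ?_
  exact projPt_toSpec hw

end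

/-! ### Glueing two models -/

section Glue

variable {K : Type} [Field K]

/-- The open cover given by a jointly surjective family of open immersions. -/
def coverOf {X : Scheme.{0}} {ι : Type} (U : ι → Scheme.{0}) (f : ∀ i, U i ⟶ X)
    (hf : ∀ i, IsOpenImmersion (f i)) (h : ∀ x : X, ∃ i, x ∈ Set.range (f i)) : X.OpenCover where
  I₀ := ι
  X := U
  f := f
  mem₀ := by
    rw [Scheme.presieve₀_mem_precoverage_iff]
    exact ⟨h, hf⟩

lemma CoveredBy.exists_coverOf {X : Scheme.{0}} {η : Spec (.of K) ⟶ X} {𝓑 : Set (Subring K)}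
    (h : CoveredBy η 𝓑) : ∃ (B : X → Subring K) (c : ∀ x, Spec (.of (B x)) ⟶ X),
      (∀ x, B x ∈ 𝓑) ∧ (∀ x, IsChart η (B x) (c x)) ∧ ∀ x, ∃ y, x ∈ Set.range (c y) := by
  choose B hB c hc hx using h
  exact ⟨B, c, hB, hc, fun x ↦ ⟨x, hx x⟩⟩

/-- A morphism from a separated scheme covered by charts of the target is an open immersion. -/
lemma CoveredBy.isOpenImmersion {X Y : Scheme.{0}} [X.IsSeparated] [Y.IsSeparated]
    {ηX : Spec (.of K) ⟶ X} {ηY : Spec (.of K) ⟶ Y} {𝓑 : Set (Subring K)} (h : CoveredBy ηX 𝓑)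
    (h' : ∀ B ∈ 𝓑, ∃ c, IsChart ηY B c) {f : X ⟶ Y} (hf : ηX ≫ f = ηY) : IsOpenImmersion f := by
  obtain ⟨B, c, hB, hc, hx⟩ := h.exists_coverOf
  refine IsOpenImmersion.of_openCover_source f (coverOf _ c (fun x ↦ (hc x).1) hx)
    (h.injective_of_charts h' hf) fun x ↦ ?_
  obtain ⟨d, hd⟩ := h' (B x) (hB x)
  have e : c x ≫ f = d := hom_ext_of_genPt (by rw [reassoc_of% (hc x).2, hf, hd.2])
  change IsOpenImmersion (c x ≫ f)
  rw [e]
  exact hd.1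

/-- The conditions on `C` say that it is the localization of `B` at `b`, whose spectrum is the locus
where `b` does not vanish. -/
lemma mem_range_specIncl {B C : Subring K} (h : B ≤ C) (b : B) (hb : (b : K)⁻¹ ∈ C)
    (hC : ∀ c ∈ C, ∃ n : ℕ, (b : K) ^ n * c ∈ B) {p : Spec (.of B)} (hp : b ∉ p.asIdeal) :
    p ∈ Set.range (specIncl h) := by
  have hb0 : (b : K) ≠ 0 := fun h0 ↦ hp (by
    have : b = 0 := Subtype.ext h0
    rw [this]; exact zero_mem _)
  let _ := (Subring.inclusion h).toAlgebra
  have : IsLocalization.Away b C := by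
    refine ⟨?_, ?_, ?_⟩
    · rintro ⟨_, n, rfl⟩
      rw [map_pow]
      exact (IsUnit.of_mul_eq_one (⟨_, hb⟩ : C) (Subtype.ext (mul_inv_cancel₀ hb0))).pow n
    · rintro ⟨c, hc⟩
      obtain ⟨n, hn⟩ := hC c hc
      exact ⟨(⟨_, hn⟩, ⟨b ^ n, n, rfl⟩), Subtype.ext (mul_comm _ _)⟩
    · intro x y hxy
      have : x = y := Subring.inclusion_injective h hxy
      exact ⟨1, by rw [this]⟩
  have h1 := PrimeSpectrum.localization_away_comap_range C b
  have h2 : p ∈ (PrimeSpectrum.basicOpen b : Set (PrimeSpectrum B)) := hp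
  rw [← h1] at h2
  exact h2

/-- Two separated models glue to a model `X` along a common open part `Q` if the coordinates `t`
and `s = 1/t` cut out `Q`. -/
lemma isPushout_of_charts {P₁ P₂ Q X : Scheme.{0}} [P₁.IsSeparated] [P₂.IsSeparated]
    [X.IsSeparated] {j₁ : Q ⟶ P₁} {j₂ : Q ⟶ P₂} [IsOpenImmersion j₁] [IsOpenImmersion j₂]
    {q : Spec (.of K) ⟶ Q} {η : Spec (.of K) ⟶ X} {𝓑₁ 𝓑₂ : Set (Subring K)}
    (h₁ : CoveredBy (q ≫ j₁) 𝓑₁) (h₂ : CoveredBy (q ≫ j₂) 𝓑₂) (hX : CoveredBy η (𝓑₁ ∪ 𝓑₂))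
    (hc₁ : ∀ B ∈ 𝓑₁, HasCenter (q ≫ j₁) B) (hc₂ : ∀ B ∈ 𝓑₂, HasCenter (q ≫ j₂) B)
    (hc : ∀ B ∈ 𝓑₁ ∪ 𝓑₂, ∃ c, IsChart η B c) {t s : K} (hts : t * s = 1)
    (ht : ∀ B ∈ 𝓑₁, t ∈ B) (hs : ∀ B ∈ 𝓑₂, s ∈ B)
    (hQ : ∀ B ∈ 𝓑₁, ∃ C, B ≤ C ∧ s ∈ C ∧ (∀ c ∈ C, ∃ n : ℕ, t ^ n * c ∈ B) ∧ HasCenter q C) :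
    ∃ (f₁ : P₁ ⟶ X) (f₂ : P₂ ⟶ X), IsPushout j₁ j₂ f₁ f₂ ∧ q ≫ j₁ ≫ f₁ = η := by
  obtain ⟨f₁, hf₁⟩ := h₁.exists_hom (ηY := η) fun B hB ↦ by
    obtain ⟨c, hc⟩ := hc B (Or.inl hB)
    exact ⟨c, hc.2⟩
  obtain ⟨f₂, hf₂⟩ := h₂.exists_hom (ηY := η) fun B hB ↦ by
    obtain ⟨c, hc⟩ := hc B (Or.inr hB)
    exact ⟨c, hc.2⟩
  have i₁ : IsOpenImmersion f₁ := h₁.isOpenImmersion (fun B hB ↦ hc B (Or.inl hB)) hf₁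
  have i₂ : IsOpenImmersion f₂ := h₂.isOpenImmersion (fun B hB ↦ hc B (Or.inr hB)) hf₂
  have : IsReduced P₁ := h₁.isReduced
  have : IsReduced Q := isReduced_of_isOpenImmersion j₁
  have : IsDominant (q ≫ j₁) := h₁.isDominant
  have : IsDominant q := IsDominant.of_comp_of_isOpenImmersion q j₁
  have hw : j₁ ≫ f₁ = j₂ ≫ f₂ := ext_of_isDominant q (by
    rw [← Category.assoc, hf₁, ← Category.assoc, hf₂])
  have hsurj (x : X) : x ∈ Set.range f₁ ∨ x ∈ Set.range f₂ := by
    obtain ⟨B, hB, c, hc, y, rfl⟩ := hX x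
    obtain hB | hB := hB
    · obtain ⟨k, hk⟩ := hc₁ B hB
      have e : c = k ≫ f₁ := hom_ext_of_genPt (by rw [hc.2, reassoc_of% hk, ← hf₁, Category.assoc])
      exact Or.inl ⟨k y, by rw [e]; rfl⟩
    · obtain ⟨k, hk⟩ := hc₂ B hB
      have e : c = k ≫ f₂ := hom_ext_of_genPt (by rw [hc.2, reassoc_of% hk, ← hf₂, Category.assoc])
      exact Or.inr ⟨k y, by rw [e]; rfl⟩
  -- If a point of `P₁` meets `P₂` inside `X`, then `s` is regular near it on the other side, so `t`
  -- does not vanish there and the point comes from `Q`.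
  have hmem (a : P₁) (b : P₂) (hab : f₁ a = f₂ b) : a ∈ Set.range j₁ := by
    obtain ⟨B, hB, c, hcB, p, rfl⟩ := h₁ a
    obtain ⟨B', hB', c', hcB', p', rfl⟩ := h₂ b
    obtain ⟨d, hd⟩ := hc B (Or.inl hB)
    obtain ⟨d', hd'⟩ := hc B' (Or.inr hB')
    have e : c ≫ f₁ = d := hom_ext_of_genPt (by rw [reassoc_of% hcB.2, hd.2, ← hf₁, Category.assoc])
    have e' : c' ≫ f₂ = d' :=
      hom_ext_of_genPt (by rw [reassoc_of% hcB'.2, hd'.2, ← hf₂, Category.assoc])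
    have hp : d p = d' p' := by rw [← e, ← e']; exact hab
    have h3 := hd.notMem_of_mul_eq_one hd' hp ⟨t, ht B hB⟩ ⟨s, hs B' hB'⟩ hts
    obtain ⟨C, hBC, hsC, hC, k, hk⟩ := hQ B hB
    obtain ⟨p₁, rfl⟩ := mem_range_specIncl hBC ⟨t, ht B hB⟩
      (by rw [← eq_inv_of_mul_eq_one_right hts]; exact hsC) hC h3
    have e3 : k ≫ j₁ = specIncl hBC ≫ c := hom_ext_of_genPt (by
      rw [reassoc_of% hk, genPt_specIncl_assoc, hcB.2])
    exact ⟨k p₁, congr($e3 p₁)⟩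
  refine ⟨f₁, f₂, ⟨⟨hw⟩, ⟨?_⟩⟩, by rw [← Category.assoc, hf₁]⟩
  -- The intersection of the two open pieces is exactly `Q`, so glueing of morphisms along the
  -- two-element cover is the pushout property.
  let l : Q ⟶ pullback f₁ f₂ := pullback.lift j₁ j₂ hw
  have hl : IsIso l := by
    have hl1 : l ≫ pullback.fst f₁ f₂ = j₁ := pullback.lift_fst _ _ _
    have : IsOpenImmersion (l ≫ pullback.fst f₁ f₂) := by rw [hl1]; infer_instance
    have : IsOpenImmersion l := IsOpenImmersion.of_comp l (pullback.fst f₁ f₂)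
    refine (isIso_iff_isOpenImmersion_and_surjective l).2 ⟨inferInstance, ⟨fun w ↦ ?_⟩⟩
    obtain ⟨v, hv⟩ := hmem (pullback.fst f₁ f₂ w) (pullback.snd f₁ f₂ w)
      congr($(pullback.condition (f := f₁) (g := f₂)) w)
    refine ⟨v, (pullback.fst f₁ f₂).isOpenEmbedding.injective ?_⟩
    rw [← hv, ← hl1]
    rfl
  let 𝒰 : X.OpenCover := coverOf (fun b : Bool ↦ cond b P₁ P₂)
    (fun b ↦ match b with | true => f₁ | false => f₂)
    (fun b ↦ match b with | true => i₁ | false => i₂)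
    (fun x ↦ (hsurj x).elim (fun h ↦ ⟨true, h⟩) (fun h ↦ ⟨false, h⟩))
  let G (s : PushoutCocone j₁ j₂) (b : Bool) : 𝒰.X b ⟶ s.pt :=
    match b with | true => s.inl | false => s.inr
  have hG (s : PushoutCocone j₁ j₂) (a b : Bool) : pullback.fst (𝒰.f a) (𝒰.f b) ≫ G s a =
      pullback.snd (𝒰.f a) (𝒰.f b) ≫ G s b := by
    have key : pullback.fst f₁ f₂ ≫ s.inl = pullback.snd f₁ f₂ ≫ s.inr := by
      rw [← cancel_epi l, ← Category.assoc, ← Category.assoc, pullback.lift_fst, pullback.lift_snd]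
      exact s.condition
    obtain _ | _ := a <;> obtain _ | _ := b
    · exact congrArg (· ≫ s.inr) (fst_eq_snd_of_mono_eq f₂)
    · change pullback.fst f₂ f₁ ≫ s.inr = pullback.snd f₂ f₁ ≫ s.inl
      rw [← cancel_epi (pullbackSymmetry f₁ f₂).hom, pullbackSymmetry_hom_comp_fst_assoc,
        pullbackSymmetry_hom_comp_snd_assoc, key]
    · exact key
    · exact congrArg (· ≫ s.inl) (fst_eq_snd_of_mono_eq f₁)
  refine PushoutCocone.IsColimit.mk _ (fun s ↦ 𝒰.glueMorphisms (G s) (hG s))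
    (fun s ↦ 𝒰.ι_glueMorphisms (G s) (hG s) true) (fun s ↦ 𝒰.ι_glueMorphisms (G s) (hG s) false)
    fun s m h1 h2 ↦ 𝒰.hom_ext _ _ ?_
  rintro (_ | _)
  · exact h2.trans (𝒰.ι_glueMorphisms (G s) (hG s) false).symm
  · exact h1.trans (𝒰.ι_glueMorphisms (G s) (hG s) true).symm

end Glue

/-! ### Projective spaces as models -/

section ProjSpaceModels

variable {K : Type} [Field K] {A : Type} [CommRing A] {n : ℕ}

/-- A homogeneous polynomial vanishes if its dehomogenization does. -/
lemma eq_zero_of_eval₂_cons (σ : A →+* K) (v : Fin n → K)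
    (h : Function.Injective (MvPolynomial.eval₂Hom σ v)) (k : ℕ)
    (a : MvPolynomial (Fin (n + 1)) A) (ha : a ∈ polyGrading n A k)
    (h0 : MvPolynomial.eval₂ σ (Fin.cons 1 v) a = 0) : a = 0 := by
  let p : MvPolynomial (Fin n) A := ∑ m ∈ a.support, MvPolynomial.monomial m.tail (a.coeff m)
  have hp : p = 0 := by
    apply h
    rw [map_zero, ← h0, map_sum, MvPolynomial.eval₂_eq']
    refine Finset.sum_congr rfl fun m _ ↦ ?_
    rw [MvPolynomial.coe_eval₂Hom, MvPolynomial.eval₂_monomial, Fin.prod_univ_succ,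
      Finsupp.prod_fintype _ _ (by simp)]
    simp [Finsupp.tail_apply]
  by_contra hne
  obtain ⟨m, hm⟩ := MvPolynomial.support_nonempty.2 hne
  have h1 : p.coeff m.tail = a.coeff m := by
    rw [MvPolynomial.coeff_sum, Finset.sum_eq_single m]
    · simp
    · intro m' hm' hne'
      rw [MvPolynomial.coeff_monomial, if_neg]
      intro he
      refine hne' ?_
      -- The total degree recovers the exponent of the first variable from the others, so distinct
      -- monomials stay distinct after dehomogenization.
      have hd {m : Fin (n + 1) →₀ ℕ} (hm : m ∈ a.support) : k = m 0 + ∑ i : Fin n, m i.succ := by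
        rw [MvPolynomial.IsHomogeneous.degree_eq_sum_deg_support ha hm, ← Fin.sum_univ_succ]
        exact Finset.sum_subset (Finset.subset_univ _) fun i _ hi ↦ by simpa using hi
      have hs (i : Fin n) : m' i.succ = m i.succ := by
        simpa [Finsupp.tail_apply] using DFunLike.congr_fun he i
      have d1 := hd hm
      have d2 := hd hm'
      simp only [hs] at d2
      ext i
      refine Fin.cases ?_ hs i
      omega
    · exact fun h ↦ (h hm).elim
  rw [hp, MvPolynomial.coeff_zero] at h1
  exact MvPolynomial.mem_support_iff.1 hm h1.symm

variable [Algebra ℝ K]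

/-- Algebraic independence splits in two: `t` is transcendental over `ℝ`, and `z` is transcendental
over `ℝ[t]`. -/
lemma injective_eval₂Hom_of_coords {t z : K} (h : Coords t z) : Function.Injective
    (MvPolynomial.eval₂Hom (Polynomial.eval₂RingHom (algebraMap ℝ K) t) ![z]) := by
  let S := Algebra.adjoin ℝ (![t, z] '' {0})
  have hS : t ∈ S := Algebra.subset_adjoin ⟨0, rfl, rfl⟩
  have h1 : Transcendental S z := h.1.transcendental_adjoin (s := {0}) (i := 1) (by simp)
  have h2 := algebraicIndependent_iff_transcendental.2 h1
  let φ : Polynomial ℝ →+* S := Polynomial.aeval (R := ℝ) (⟨t, hS⟩ : S)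
  have hφ (p) : (φ p : K) = Polynomial.eval₂RingHom (algebraMap ℝ K) t p := by
    change algebraMap S K (Polynomial.aeval _ p) = _
    rw [← Polynomial.aeval_algebraMap_apply]
    rfl
  have hφi : Function.Injective φ := by
    rw [injective_iff_map_eq_zero]
    intro p hp
    have h3 := hφ p
    rw [hp] at h3
    exact transcendental_iff.1 h.transcendental_left p h3.symm
  have e : MvPolynomial.eval₂Hom (Polynomial.eval₂RingHom (algebraMap ℝ K) t) ![z] =
      (MvPolynomial.aeval (R := S) ![z] : _ →+* K).comp (MvPolynomial.map φ) := by
    refine MvPolynomial.ringHom_ext (fun p ↦ ?_) fun i ↦ ?_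
    · simp [hφ]
    · simp
  rw [e]
  have h3 : Function.Injective (MvPolynomial.aeval (R := S) ![z]) := h2
  rw [RingHom.coe_comp]
  exact h3.comp (MvPolynomial.map_injective φ hφi)

lemma Coords.transcendental_right {t z : K} (h : Coords t z) : Transcendental ℝ z :=
  h.1.transcendental 1

/-- The polynomials in `t`. -/
abbrev evalT (t : K) : Polynomial ℝ →+* K := Polynomial.eval₂RingHom (algebraMap ℝ K) t

lemma evalT_mem {t : K} {B : Subring K} (hr : ∀ r, algebraMap ℝ K r ∈ B) (ht : t ∈ B)
    (p : Polynomial ℝ) : evalT t p ∈ B := by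
  rw [Polynomial.coe_eval₂RingHom, Polynomial.eval₂_eq_sum]
  exact Subring.sum_mem _ fun i _ ↦ B.mul_mem (hr _) (B.pow_mem ht i)

lemma exists_isUnit_cons (v : Fin n → K) :
    ∃ i, IsUnit ((Fin.cons 1 v : Fin (n + 1) → K) i) := ⟨0, isUnit_one⟩

lemma range_evalX_evalT (t z : K) (hz : z ≠ 0) :
    (evalX (evalT t) (Fin.cons 1 ![z]) 0 isUnit_one).range = rng {t, z} ∧
    (evalX (evalT t) (Fin.cons 1 ![z]) 1 hz.isUnit).range = rng {t, z⁻¹} := by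
  constructor
  · refine le_antisymm (range_evalX_le _ _ _
      (evalT_mem (algebraMap_mem_rng _) (mem_rng_left t z)) fun j ↦ ?_) (rng_le (fun r ↦ ?_) ?_)
    · fin_cases j
      · simp
      · simpa using mem_rng_right t z
    · simpa using map_mem_range_evalX (evalT t) (Fin.cons 1 ![z]) 0 isUnit_one (Polynomial.C r)
    · refine pair_subset ?_ ?_
      · simpa using map_mem_range_evalX (evalT t) (Fin.cons 1 ![z]) 0 isUnit_one Polynomial.X
      · simpa using div_mem_range_evalX (evalT t) (Fin.cons 1 ![z]) 0 isUnit_one 1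
  · refine le_antisymm (range_evalX_le _ _ _
      (evalT_mem (algebraMap_mem_rng _) (mem_rng_left t z⁻¹)) fun j ↦ ?_) (rng_le (fun r ↦ ?_) ?_)
    · fin_cases j
      · simpa using mem_rng_right t z⁻¹
      · simp [hz]
    · simpa using map_mem_range_evalX (evalT t) (Fin.cons 1 ![z]) 1 hz.isUnit (Polynomial.C r)
    · refine pair_subset ?_ ?_
      · simpa using map_mem_range_evalX (evalT t) (Fin.cons 1 ![z]) 1 hz.isUnit Polynomial.X
      · simpa using div_mem_range_evalX (evalT t) (Fin.cons 1 ![z]) 1 hz.isUnit 0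

/-- The trivial `ℙ¹`-bundle over the affine line as a model. -/
lemma coveredBy_lineBundle {t z : K} (h : Coords t z) :
    CoveredBy (projPt (evalT t) (Fin.cons 1 ![z]) (exists_isUnit_cons _))
        {rng {t, z}, rng {t, z⁻¹}} ∧
      ∀ B ∈ ({rng {t, z}, rng {t, z⁻¹}} : Set (Subring K)),
        HasCenter (projPt (evalT t) (Fin.cons 1 ![z]) (exists_isUnit_cons _)) B := by
  have hinj := eq_zero_of_eval₂_cons _ _ (injective_eval₂Hom_of_coords h)
  have hz := h.right_ne_zero
  obtain ⟨e0, e1⟩ := range_evalX_evalT t z hz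
  have hu (i : Fin (1 + 1)) : IsUnit ((Fin.cons 1 ![z] : Fin (1 + 1) → K) i) := by
    fin_cases i
    exacts [isUnit_one, hz.isUnit]
  refine ⟨(coveredBy_projSpace hinj hu).mono ?_, ?_⟩
  · rintro _ ⟨i, rfl⟩
    fin_cases i
    · exact Or.inl e0
    · exact Or.inr e1
  · rintro _ (rfl | rfl)
    · obtain ⟨c, hc, -⟩ := isChart_projSpace hinj 0 (hu 0)
      rw [← e0]
      exact ⟨c, hc.2⟩
    · obtain ⟨c, hc, -⟩ := isChart_projSpace hinj 1 (hu 1)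
      rw [← e1]
      exact ⟨c, hc.2⟩

end ProjSpaceModels

/-! ### Hirzebruch surfaces -/

section Hirzebruch

variable {K : Type} [Field K] [Algebra ℝ K] {t x : K}

lemma baseChange_C {n : ℕ} {A B : Type} [CommRing A] [CommRing B] (φ : A →+* B) (a : A) :
    baseChange n φ (MvPolynomial.C a) = MvPolynomial.C (φ a) := MvPolynomial.map_C φ a

lemma baseChange_X {n : ℕ} {A B : Type} [CommRing A] [CommRing B] (φ : A →+* B) (i) :
    baseChange n φ (MvPolynomial.X i) = MvPolynomial.X i := MvPolynomial.map_X φ i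

/-- Evaluation of Laurent polynomials at `t`. -/
abbrev evalL (ht : t ≠ 0) : ℝ[T;T⁻¹] →+* K := LaurentPolynomial.eval₂ (algebraMap ℝ K) (Units.mk0 t ht)

lemma evalL_mem (ht : t ≠ 0) {B : Subring K} (hr : ∀ r, algebraMap ℝ K r ∈ B) (h : t ∈ B)
    (h' : t⁻¹ ∈ B) (p : ℝ[T;T⁻¹]) : evalL ht p ∈ B := by
  obtain ⟨n, p', hp⟩ := LaurentPolynomial.exists_T_pow p
  have e : evalL ht p = evalT t p' * t⁻¹ ^ n := by
    have := congrArg (evalL ht) hp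
    rw [LaurentPolynomial.eval₂_toLaurent, map_mul, LaurentPolynomial.eval₂_T_n] at this
    rw [inv_pow, eq_mul_inv_iff_mul_eq₀ (pow_ne_zero n ht)]
    exact this.symm
  rw [e]
  exact B.mul_mem (evalT_mem hr h p') (B.pow_mem h' n)

lemma exists_isUnit_pair (x : K) : ∃ i, IsUnit ((![x, 1] : Fin (1 + 1) → K) i) := ⟨1, isUnit_one⟩

/-- The generic point of the overlap of the two charts of a Hirzebruch surface. -/
def overlapGen (ht : t ≠ 0) (x : K) : Spec (.of K) ⟶ projSpace 1 ℝ[T;T⁻¹] :=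
  projPt (evalL ht) ![x, 1] (exists_isUnit_pair x)

lemma projPt_pair {A : Type} [CommRing A] (σ : A →+* K) (hx : x ≠ 0) :
    projPt σ ![x, 1] (exists_isUnit_pair x) =
      projPt σ (Fin.cons 1 ![x⁻¹]) (exists_isUnit_cons _) := by
  refine projPt_smul x _ _ fun i ↦ ?_
  fin_cases i
  · simp
  · simp [hx]

/-- The generic point is `[x : 1]`, so its normal form `[1 : z]` has `z = x⁻¹`. This is why inverted
fibre coordinates appear on the bundle charts. -/
lemma overlapGen_overlap (ht : t ≠ 0) (hx : x ≠ 0) : overlapGen ht x ≫ overlap =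
    projPt (evalT t) (Fin.cons 1 ![x⁻¹]) (exists_isUnit_cons _) := by
  rw [← projPt_pair _ hx]
  refine projPt_map _ _ _ _ (fun a ↦ ?_) fun i ↦ ?_
  · rw [baseChange_C]; simp
  · rw [baseChange_X]; simp

/-- The glueing map sends `[x : 1]` over `t` to `[t ^ d x : 1]` over `t⁻¹`, which is the transition
between the charts of `hModel`. -/
lemma overlapGen_twist (ht : t ≠ 0) (hx : x ≠ 0) (d : ℕ) :
    overlapGen ht x ≫ twistMap d ≫ overlap =
      projPt (evalT t⁻¹) (Fin.cons 1 ![(t ^ d * x)⁻¹]) (exists_isUnit_cons _) := by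
  have h1 : overlapGen ht x ≫ twistMap d =
      projPt ((evalL ht).comp invertHom) ![t ^ d * x, 1] (exists_isUnit_pair _) := by
    refine projPt_map _ _ _ _ (fun a ↦ ?_) fun i ↦ ?_
    · rw [twistHom_C]; simp
    · fin_cases i
      · exact (congrArg _ (twistHom_X_zero _ _)).trans (by simp)
      · exact (congrArg _ (twistHom_X_one _ _)).trans (by simp)
  rw [← Category.assoc, h1, ← projPt_pair _ (mul_ne_zero (pow_ne_zero d ht) hx)]
  refine projPt_map _ _ _ _ (fun a ↦ ?_) fun i ↦ ?_
  · rw [baseChange_C, MvPolynomial.eval₂_C]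
    have : ((evalL ht).comp invertHom).comp Polynomial.toLaurent = evalT t⁻¹ := by
      refine Polynomial.ringHom_ext (fun r ↦ ?_) ?_
      · simp [invertHom]
      · simp [invertHom]
    exact congr($this a)
  · rw [baseChange_X]; simp

instance (d : ℕ) (t x : K) : (hModel d t x).left.IsSeparated :=
  inferInstanceAs (projModel (hVec d t x) (exists_isUnit_hVec d t x)).left.IsSeparated

lemma exists_pow_mul_mem_rng (ht : t ≠ 0) (z : K) {c : K} (hc : c ∈ rng {t, t⁻¹, z}) :
    ∃ n : ℕ, t ^ n * c ∈ rng {t, z} := by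
  have h := mem_rng_left t z
  refine rng_induction (P := fun c ↦ ∃ n : ℕ, t ^ n * (c : K) ∈ rng {t, z}) ?_ ?_ ?_ ?_ ⟨c, hc⟩
  · rintro _ (rfl | rfl | rfl)
    · exact ⟨0, by simpa using h⟩
    · exact ⟨1, by simp [ht]⟩
    · exact ⟨0, by simpa using mem_rng_right _ _⟩
  · exact fun r ↦ ⟨0, by rw [pow_zero, one_mul]; exact algebraMap_mem_rng _ r⟩
  · rintro a b ⟨n, hn⟩ ⟨m, hm⟩
    refine ⟨n + m, ?_⟩
    have := Subring.add_mem _ (Subring.mul_mem _ (Subring.pow_mem _ h m) hn)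
      (Subring.mul_mem _ (Subring.pow_mem _ h n) hm)
    convert this using 1
    push_cast
    ring
  · rintro a b ⟨n, hn⟩ ⟨m, hm⟩
    refine ⟨n + m, ?_⟩
    have := Subring.mul_mem _ hn hm
    convert this using 1
    push_cast
    ring

lemma hasCenter_overlapGen (ht : t ≠ 0) (hx : x ≠ 0) :
    HasCenter (overlapGen ht x) (rng {t, t⁻¹, x}) ∧
      HasCenter (overlapGen ht x) (rng {t, t⁻¹, x⁻¹}) := by
  have h {s : Set K} (h1 : t ∈ s) (h2 : t⁻¹ ∈ s) (p) : evalL ht p ∈ rng s :=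
    evalL_mem ht (algebraMap_mem_rng _) (mem_rng h1) (mem_rng h2) p
  constructor
  · refine hasCenter_projPt _ 1 one_ne_zero (h (by simp) (by simp)) fun j ↦ ?_
    fin_cases j
    · simpa using mem_rng (by simp)
    · simp
  · refine hasCenter_projPt _ 0 hx (h (by simp) (by simp)) fun j ↦ ?_
    fin_cases j
    · simp [hx]
    · simpa using mem_rng (by simp)

lemma projPt_evalT_chartToSpec {n : ℕ} (w : Fin (n + 1) → K) (hw : ∃ i, IsUnit (w i)) :
    projPt (evalT t) w hw ≫ projSpaceToSpec n (Polynomial ℝ) ≫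
      Spec.map (CommRingCat.ofHom Polynomial.C) = Spec.map (CommRingCat.ofHom (algebraMap ℝ K)) := by
  rw [← Category.assoc, projPt_toSpec, ← Spec.map_comp, ← CommRingCat.ofHom_comp]
  congr 2
  ext r
  simp

/-- The charts of `hModel` split into those containing `t` and those containing `t⁻¹`. Each half is
a trivial ℙ¹-bundle over a line, and they meet in the locus where `t` is invertible, so `hModel` is
the pushout that defines 𝔽_d. -/
lemma exists_hirzebruch_iso (h : Coords t x) (d : ℕ) : Nonempty (hirzebruch d ≅ hModel d t x) := by
  have ht := h.left_ne_zero
  have hx := h.right_ne_zero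
  have hX := isRuled_hModel ht hx d
  have hdata : IsRuledData t t⁻¹ x (t ^ d * x) := ⟨h, mul_inv_cancel₀ ht, d, by simp⟩
  have h₁ := coveredBy_lineBundle hdata.inv.coords
  have h₂ := coveredBy_lineBundle hdata.inv.symm.coords
  rw [← overlapGen_overlap ht hx] at h₁
  rw [← overlapGen_twist ht hx] at h₂
  have hsub : ruledRings t t⁻¹ x (t ^ d * x) = {rng {t, x⁻¹}, rng {t, x⁻¹⁻¹}} ∪
      {rng {t⁻¹, (t ^ d * x)⁻¹}, rng {t⁻¹, (t ^ d * x)⁻¹⁻¹}} := by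
    ext B
    simp only [ruledRings, inv_inv, Set.mem_insert_iff, Set.mem_singleton_iff, Set.mem_union]
    tauto
  obtain ⟨f₁, f₂, hf, hη⟩ := isPushout_of_charts (j₁ := overlap) (j₂ := twistMap d ≫ overlap)
    h₁.1 h₂.1 (hsub ▸ hX.coveredBy) h₁.2 h₂.2 (hsub ▸ hX.isChart) (mul_inv_cancel₀ ht)
    (by rintro _ (rfl | rfl) <;> exact mem_rng_left _ _)
    (by rintro _ (rfl | rfl) <;> exact mem_rng_left _ _) (by
      have h3 := hasCenter_overlapGen ht hx
      rintro _ (rfl | rfl)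
      · exact ⟨_, rng_mono (by simp [Set.insert_subset_iff]), mem_rng (by simp),
          fun c hc ↦ exists_pow_mul_mem_rng ht _ hc, h3.2⟩
      · rw [inv_inv]
        exact ⟨_, rng_mono (by simp [Set.insert_subset_iff]), mem_rng (by simp),
          fun c hc ↦ exists_pow_mul_mem_rng ht _ hc, h3.1⟩)
  have hη' : hModelPt d t x ≫ (hModel d t x).hom = Spec.map (CommRingCat.ofHom (algebraMap ℝ K)) :=
    isRealPt_projModelPt (hVec d t x) (exists_isUnit_hVec d t x)
  have w₁ : f₁ ≫ (hModel d t x).hom = chartToSpec := by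
    refine h₁.1.hom_ext (Y := Spec (.of ℝ)) ?_
    rw [Category.assoc, reassoc_of% hη, hη', overlapGen_overlap ht hx]
    exact (projPt_evalT_chartToSpec _ _).symm
  have w₂ : f₂ ≫ (hModel d t x).hom = chartToSpec := by
    refine h₂.1.hom_ext (Y := Spec (.of ℝ)) ?_
    rw [Category.assoc, ← hf.w_assoc, reassoc_of% hη, hη', overlapGen_twist ht hx]
    exact (projPt_evalT_chartToSpec _ _).symm
  let e : pushout overlap (twistMap d ≫ overlap) ≅ (hModel d t x).left := hf.isoPushout.symm
  have he : e.hom ≫ (hModel d t x).hom = pushout.desc chartToSpec chartToSpec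
      (overlap_chartToSpec d) := by
    refine pushout.hom_ext ?_ ?_
    · rw [← Category.assoc, show pushout.inl _ _ ≫ e.hom = f₁ from hf.inl_isoPushout_inv, w₁,
        pushout.inl_desc]
    · rw [← Category.assoc, show pushout.inr _ _ ≫ e.hom = f₂ from hf.inr_isoPushout_inv, w₂,
        pushout.inr_desc]
  exact ⟨Over.isoMk e he⟩

end Hirzebruch

/-! ### Products of projective lines -/

section Product

variable {K : Type} [Field K] [Algebra ℝ K] {t x : K}

lemma injective_eval₂Hom_of_transcendental {z : K} (h : Transcendental ℝ z) :
    Function.Injective (MvPolynomial.eval₂Hom (algebraMap ℝ K) ![z]) :=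
  algebraicIndependent_iff_transcendental.2 h

/-- The point `[1 : z]` of the projective line. -/
def linePt (z : K) : Spec (.of K) ⟶ projSpace 1 ℝ :=
  projPt (algebraMap ℝ K) (Fin.cons 1 ![z]) (exists_isUnit_cons _)

lemma linePt_toSpec (z : K) : linePt z ≫ projSpaceToSpec 1 ℝ =
    Spec.map (CommRingCat.ofHom (algebraMap ℝ K)) := projPt_toSpec _

lemma range_evalX_line {z : K} (hz : z ≠ 0) :
    (evalX (algebraMap ℝ K) (Fin.cons 1 ![z]) 0 isUnit_one).range = rng {z} ∧
    (evalX (algebraMap ℝ K) (Fin.cons 1 ![z]) 1 hz.isUnit).range = rng {z⁻¹} := by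
  constructor
  · refine (range_evalX_eq _ _ _).trans (le_antisymm (rng_le_rng ?_) (rng_mono ?_))
    · rintro _ ⟨j, rfl⟩
      fin_cases j
      · simp
      · simpa using mem_rng (s := {z}) rfl
    · rintro _ rfl
      exact ⟨1, by simp⟩
  · refine (range_evalX_eq _ _ _).trans (le_antisymm (rng_le_rng ?_) (rng_mono ?_))
    · rintro _ ⟨j, rfl⟩
      fin_cases j
      · simpa using mem_rng (s := {z⁻¹}) rfl
      · simp [hz]
    · rintro _ rfl
      exact ⟨0, by simp⟩

/-- The projective line as a model. -/
lemma coveredBy_linePt {z : K} (h : Transcendental ℝ z) :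
    CoveredBy (linePt z) {rng {z}, rng {z⁻¹}} ∧ (∃ c, IsChart (linePt z) (rng {z}) c) ∧
      ∃ c, IsChart (linePt z) (rng {z⁻¹}) c := by
  have hinj := eq_zero_of_eval₂_cons _ _ (injective_eval₂Hom_of_transcendental h)
  have hz : z ≠ 0 := by
    rintro rfl
    exact h isAlgebraic_zero
  have hu (i : Fin (1 + 1)) : IsUnit ((Fin.cons 1 ![z] : Fin (1 + 1) → K) i) := by
    fin_cases i
    exacts [isUnit_one, hz.isUnit]
  obtain ⟨e0, e1⟩ := range_evalX_line hz
  refine ⟨(coveredBy_projSpace hinj hu).mono ?_, ?_, ?_⟩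
  · rintro _ ⟨i, rfl⟩
    fin_cases i
    · exact Or.inl e0
    · exact Or.inr e1
  · obtain ⟨c, hc, -⟩ := isChart_projSpace hinj 0 (hu 0)
    rw [← e0]
    exact ⟨c, hc⟩
  · obtain ⟨c, hc, -⟩ := isChart_projSpace hinj 1 (hu 1)
    rw [← e1]
    exact ⟨c, hc⟩

lemma rng_left_le (a b : K) : rng {a} ≤ rng {a, b} := rng_mono (by simp)

lemma rng_right_le (a b : K) : rng {b} ≤ rng {a, b} := rng_mono (by simp)

lemma inclusion_rngC {s s' : Set K} (h : rng s ≤ rng s') (r : ℝ) :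
    Subring.inclusion h (rngC s r) = rngC s' r := rfl

lemma Coords.exists_desc {a b : K} (h : Coords a b) {C : Type} [CommRing C] (f : rng {a} →+* C)
    (g : rng {b} →+* C) (hfg : ∀ r, f (rngC _ r) = g (rngC _ r)) :
    ∃ φ : rng {a, b} →+* C, φ.comp (Subring.inclusion (rng_left_le a b)) = f ∧
      φ.comp (Subring.inclusion (rng_right_le a b)) = g := by
  obtain ⟨φ, hC, ha, hb⟩ := h.exists_hom (f.comp (rngC {a}))
    (f ⟨a, mem_rng rfl⟩) (g ⟨b, mem_rng rfl⟩)
  have hC' (r : ℝ) : φ (rngC _ r) = f (rngC _ r) := RingHom.congr_fun hC r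
  refine ⟨φ, rng_hom_ext (fun r ↦ ?_) ?_, rng_hom_ext (fun r ↦ ?_) ?_⟩
  · rw [RingHom.comp_apply, inclusion_rngC, hC']
  · rintro _ rfl
    exact ha
  · rw [RingHom.comp_apply, inclusion_rngC, hC', hfg]
  · rintro _ rfl
    exact hb

lemma rng_pair_hom_ext {a b : K} {C : Type} [CommRing C] {φ ψ : rng {a, b} →+* C}
    (h : φ.comp (Subring.inclusion (rng_left_le a b)) = ψ.comp (Subring.inclusion (rng_left_le a b)))
    (h' : φ.comp (Subring.inclusion (rng_right_le a b)) =
      ψ.comp (Subring.inclusion (rng_right_le a b))) : φ = ψ := by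
  refine rng_hom_ext (fun r ↦ RingHom.congr_fun h (rngC {a} r)) ?_
  rintro c (rfl | rfl)
  · exact RingHom.congr_fun h ⟨c, mem_rng rfl⟩
  · exact RingHom.congr_fun h' ⟨c, mem_rng rfl⟩

lemma isPushout_of_exists_desc {C : Type*} [Category* C] {X Y Z W : C} {f : X ⟶ Y} {g : X ⟶ Z}
    {i : Y ⟶ W} {j : Z ⟶ W} (w : f ≫ i = g ≫ j)
    (h : ∀ T (u : Y ⟶ T) (v : Z ⟶ T), f ≫ u = g ≫ v → ∃ φ : W ⟶ T, i ≫ φ = u ∧ j ≫ φ = v)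
    (h' : ∀ T (u v : W ⟶ T), i ≫ u = i ≫ v → j ≫ u = j ≫ v → u = v) : IsPushout f g i j := by
  refine ⟨⟨w⟩, ⟨?_⟩⟩
  choose φ h1 h2 using fun s : PushoutCocone f g ↦ h s.pt s.inl s.inr s.condition
  exact PushoutCocone.IsColimit.mk _ φ h1 h2 fun s m hm1 hm2 ↦
    h' _ _ _ (hm1.trans (h1 s).symm) (hm2.trans (h2 s).symm)

/-- A polynomial ring in two variables is a pushout of polynomial rings. -/
lemma Coords.isPushout {a b : K} (h : Coords a b) :
    IsPushout (CommRingCat.ofHom (rngC {a})) (CommRingCat.ofHom (rngC {b}))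
      (CommRingCat.ofHom (Subring.inclusion (rng_left_le a b)))
      (CommRingCat.ofHom (Subring.inclusion (rng_right_le a b))) := by
  refine isPushout_of_exists_desc (CommRingCat.hom_ext (RingHom.ext fun r ↦ ?_))
    (fun T u v huv ↦ ?_) fun T u v h1 h2 ↦ ?_
  · exact (inclusion_rngC (rng_left_le a b) r).trans (inclusion_rngC (rng_right_le a b) r).symm
  · have huv' (r : ℝ) : u.hom (rngC _ r) = v.hom (rngC _ r) :=
      RingHom.congr_fun (congrArg CommRingCat.Hom.hom huv) r
    obtain ⟨φ, h1, h2⟩ := h.exists_desc u.hom v.hom huv'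
    exact ⟨CommRingCat.ofHom φ, CommRingCat.hom_ext h1, CommRingCat.hom_ext h2⟩
  · exact CommRingCat.hom_ext (rng_pair_hom_ext (congrArg CommRingCat.Hom.hom h1)
      (congrArg CommRingCat.Hom.hom h2))

/-- Charts of a product. -/
lemma exists_isChart_pullback {P₁ P₂ : RealScheme} {η₁ : Spec (.of K) ⟶ P₁.left}
    {η₂ : Spec (.of K) ⟶ P₂.left} (h₁ : IsRealPt η₁) (h₂ : IsRealPt η₂)
    {a b : K} (h : Coords a b) {c₁ : Spec (.of (rng {a})) ⟶ P₁.left}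
    {c₂ : Spec (.of (rng {b})) ⟶ P₂.left} (hc₁ : IsChart η₁ _ c₁) (hc₂ : IsChart η₂ _ c₂) :
    ∃ c, IsChart (pullback.lift η₁ η₂ (h₁.trans h₂.symm)) (rng {a, b}) c ∧
      Set.range c = pullback.fst P₁.hom P₂.hom ⁻¹' Set.range c₁ ∩
        pullback.snd P₁.hom P₂.hom ⁻¹' Set.range c₂ := by
  have := hc₁.1
  have := hc₂.1
  have e₁ : c₁ ≫ P₁.hom = Spec.map (CommRingCat.ofHom (rngC {a})) := hom_ext_specReal (by
    rw [reassoc_of% hc₁.2]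
    refine h₁.trans ?_
    rw [genPt, ← Spec.map_comp]; rfl)
  have e₂ : c₂ ≫ P₂.hom = Spec.map (CommRingCat.ofHom (rngC {b})) := hom_ext_specReal (by
    rw [reassoc_of% hc₂.2]
    refine h₂.trans ?_
    rw [genPt, ← Spec.map_comp]; rfl)
  have hp := isPullback_SpecMap_of_isPushout _ _ _ _ h.isPushout
  let m : pullback (Spec.map (CommRingCat.ofHom (rngC {a}))) (Spec.map (CommRingCat.ofHom (rngC {b})))
      ⟶ pullback P₁.hom P₂.hom :=
    pullback.map _ _ _ _ c₁ c₂ (𝟙 _) (by rw [e₁, Category.comp_id]) (by rw [e₂, Category.comp_id])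
  have hm : IsOpenImmersion m := inferInstance
  refine ⟨hp.isoPullback.hom ≫ m, ⟨inferInstance, ?_⟩, ?_⟩
  · refine pullback.hom_ext ?_ ?_
    · rw [pullback.lift_fst, Category.assoc, Category.assoc, pullback.lift_fst,
        hp.isoPullback_hom_fst_assoc]
      exact (genPt_specIncl_assoc (rng_left_le a b) c₁).trans hc₁.2
    · rw [pullback.lift_snd, Category.assoc, Category.assoc, pullback.lift_snd,
        hp.isoPullback_hom_snd_assoc]
      exact (genPt_specIncl_assoc (rng_right_le a b) c₂).trans hc₂.2
  · rw [Scheme.Hom.comp_base, TopCat.coe_comp, Set.range_comp,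
      hp.isoPullback.hom.surjective.range_eq, Set.image_univ]
    exact Scheme.Pullback.range_map _ _ _ _ _ _ _ _ _

/-- For `d = 0` the fibre coordinates over the two halves of the base agree, so the four charts are
the products of the standard affine lines. The isomorphism is read off from the equality of the
families of chart rings. -/
lemma exists_realP1xP1_iso (h : Coords t x) : Nonempty (realP1xP1 ≅ hModel 0 t x) := by
  have ht := h.left_ne_zero
  have hx := h.right_ne_zero
  have hX := isRuled_hModel ht hx 0
  have hdata : IsRuledData t t⁻¹ x (t ^ 0 * x) := ⟨h, mul_inv_cancel₀ ht, 0, by simp⟩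
  rw [pow_zero, one_mul] at hX hdata
  let P : RealScheme := realProjSpace 1
  have h₁ : IsRealPt (X := P) (linePt t) := linePt_toSpec t
  have h₂ : IsRealPt (X := P) (linePt x) := linePt_toSpec x
  let η : Spec (.of K) ⟶ pullback P.hom P.hom := pullback.lift (linePt t) (linePt x) (h₁.trans h₂.symm)
  have hη : IsRealPt (X := realP1xP1) η := by
    refine (Category.assoc _ _ _).symm.trans ?_
    exact (congrArg (· ≫ projSpaceToSpec 1 ℝ) (pullback.lift_fst _ _ _)).trans h₁
  have hcov : CoveredBy η (ruledRings t t⁻¹ x x) := by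
    intro w
    obtain ⟨B₁, hB₁, c₁, hc₁, hw₁⟩ := (coveredBy_linePt h.transcendental_left).1 (pullback.fst P.hom P.hom w)
    obtain ⟨B₂, hB₂, c₂, hc₂, hw₂⟩ := (coveredBy_linePt h.transcendental_right).1 (pullback.snd P.hom P.hom w)
    obtain rfl | rfl := hB₁ <;> obtain rfl | rfl := hB₂
    · obtain ⟨c, hc, hr⟩ := exists_isChart_pullback h₁ h₂ h hc₁ hc₂
      exact ⟨_, Or.inl rfl, c, hc, hr ▸ ⟨hw₁, hw₂⟩⟩
    · obtain ⟨c, hc, hr⟩ := exists_isChart_pullback h₁ h₂ hdata.inv.coords hc₁ hc₂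
      exact ⟨_, Or.inr (Or.inr (Or.inl rfl)), c, hc, hr ▸ ⟨hw₁, hw₂⟩⟩
    · obtain ⟨c, hc, hr⟩ := exists_isChart_pullback h₁ h₂ hdata.symm.coords hc₁ hc₂
      exact ⟨_, Or.inr (Or.inl rfl), c, hc, hr ▸ ⟨hw₁, hw₂⟩⟩
    · obtain ⟨c, hc, hr⟩ := exists_isChart_pullback h₁ h₂ hdata.inv.symm.coords hc₁ hc₂
      exact ⟨_, Or.inr (Or.inr (Or.inr rfl)), c, hc, hr ▸ ⟨hw₁, hw₂⟩⟩
  have hsep : (pullback P.hom P.hom).IsSeparated := by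
    have hP : (projSpace 1 ℝ).IsSeparated := inferInstance
    have : IsSeparated P.hom := by
      have : IsSeparated (P.hom ≫ terminal.from _) := by
        rw [terminal.comp_from]; exact hP.1
      exact IsSeparated.of_comp P.hom (terminal.from _)
    exact ⟨by rw [← terminal.comp_from (pullback.fst P.hom P.hom ≫ P.hom)]; infer_instance⟩
  have hchart (B) (hB : B ∈ ruledRings t t⁻¹ x x) : HasCenter (hModelPt 0 t x) B := by
    obtain ⟨c, hc⟩ := hX.isChart B hB
    exact ⟨c, hc.2⟩
  have hcent (B) (hB : B ∈ ruledRings t t⁻¹ x x) : HasCenter η B := by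
    obtain ⟨-, ⟨c₁, hc₁⟩, ⟨d₁, hd₁⟩⟩ := coveredBy_linePt h.transcendental_left
    obtain ⟨-, ⟨c₂, hc₂⟩, ⟨d₂, hd₂⟩⟩ := coveredBy_linePt h.transcendental_right
    obtain rfl | rfl | rfl | rfl := hB
    · obtain ⟨c, hc, -⟩ := exists_isChart_pullback h₁ h₂ h hc₁ hc₂
      exact ⟨c, hc.2⟩
    · obtain ⟨c, hc, -⟩ := exists_isChart_pullback h₁ h₂ hdata.symm.coords hd₁ hc₂
      exact ⟨c, hc.2⟩
    · obtain ⟨c, hc, -⟩ := exists_isChart_pullback h₁ h₂ hdata.inv.coords hc₁ hd₂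
      exact ⟨c, hc.2⟩
    · obtain ⟨c, hc, -⟩ := exists_isChart_pullback h₁ h₂ hdata.inv.symm.coords hd₁ hd₂
      exact ⟨c, hc.2⟩
  obtain ⟨e, he⟩ := hcov.exists_iso hX.coveredBy hchart hcent
  exact ⟨Over.isoMk (show realP1xP1.left ≅ (hModel 0 t x).left from e)
    (hcov.comp_hom_eq (X := realP1xP1) (Y := hModel 0 t x) hη (isRealPt_projModelPt _ _) he)⟩

end Product

/-! ### Real points of projective spaces -/

section Points

open HomogeneousLocalization

variable {n : ℕ} {A : Type} [CommRing A]

/-- The constants in the coordinate ring of the chart `D₊(x_i)`. -/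
def constX (i : Fin (n + 1)) : A →+* awayX n A i :=
  (fromZeroRingHom (polyGrading n A) _).comp (algebraMap A (polyGrading n A 0))

/-- The function `x_j / x_i` on the chart `D₊(x_i)`. -/
def coordX (i j : Fin (n + 1)) : awayX n A i :=
  Away.mk _ (X_mem i) 1 (MvPolynomial.X j) (by rw [one_smul]; exact X_mem j)

lemma coordX_self (i : Fin (n + 1)) : coordX (A := A) i i = 1 := by
  apply HomogeneousLocalization.val_injective
  rw [coordX, Away.val_mk, HomogeneousLocalization.val_one]
  simp

lemma isUnit_coordX (i : Fin (n + 1)) : IsUnit (coordX (A := A) i i) := by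
  rw [coordX_self]; exact isUnit_one

/-- Evaluating at the tautological coordinates `x_j / x_i` changes nothing. Hence the chart
inclusion is itself a point with homogeneous coordinates, and so is any point factoring through it.
-/
lemma evalX_coordX (i : Fin (n + 1)) :
    evalX (constX i) (coordX (A := A) i) i (isUnit_coordX i) = RingHom.id _ := by
  ext z
  obtain ⟨k, a, ha, rfl⟩ := Away.mk_surjective _ (X_mem i) z
  have h := evalX_mk (constX i) (coordX (A := A) i) i (isUnit_coordX i) k a ha
  rw [coordX_self, one_pow, mul_one] at h
  rw [h]
  let S := Submonoid.powers (MvPolynomial.X i : MvPolynomial (Fin (n + 1)) A)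
  let v : awayX n A i →+* Localization S := algebraMap _ _
  have hv (z) : v z = z.val := rfl
  rw [← hv, RingHom.id_apply, Away.val_mk, MvPolynomial.hom_eval₂]
  have e1 : v.comp (constX i) = (algebraMap (MvPolynomial (Fin (n + 1)) A) (Localization S)).comp MvPolynomial.C := by
    ext r
    rfl
  let u : Localization S := Localization.mk 1 ⟨MvPolynomial.X i, 1, pow_one _⟩
  have e2 : (fun j ↦ v (coordX i j)) = fun j ↦ u * algebraMap (MvPolynomial (Fin (n + 1)) A) (Localization S) (MvPolynomial.X j) := by
    ext j
    change (coordX i j).val = _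
    rw [coordX, Away.val_mk, ← Localization.mk_one_eq_algebraMap, Localization.mk_mul]
    congr 1
    · rw [one_mul]
    · ext; simp
  rw [e1, e2, eval₂_mul_of_mem _ _ _ ha, ← MvPolynomial.hom_eval₂,
    Localization.mk_pow, ← Localization.mk_one_eq_algebraMap, Localization.mk_mul,
    MvPolynomial.eval₂_eta]
  congr 1
  · simp
  · ext; simp

lemma chartX_eq_projPt (i : Fin (n + 1)) :
    chartX (A := A) i = projPt (constX i) (coordX i) ⟨i, isUnit_coordX i⟩ := by
  rw [projPt_eq i (isUnit_coordX i), evalX_coordX]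
  simp

/-- Points of projective space have homogeneous coordinates. -/
lemma exists_eq_projPt {F : Type} [Field F] {σ : A →+* F} {p : Spec (.of F) ⟶ projSpace n A}
    (hp : p ≫ projSpaceToSpec n A = Spec.map (CommRingCat.ofHom σ)) :
    ∃ (v : Fin (n + 1) → F) (hv : ∃ i, IsUnit (v i)), p = projPt σ v hv := by
  obtain ⟨i, hi⟩ := exists_mem_range_chartX (p default)
  have hr : Set.range p ⊆ Set.range (chartX (A := A) i) := by
    rintro _ ⟨z, rfl⟩
    rwa [Unique.eq_default z]
  let k := IsOpenImmersion.lift (chartX (A := A) i) p hr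
  have hk : k ≫ chartX i = p := IsOpenImmersion.lift_fac _ _ _
  obtain ⟨φ, hφ⟩ := Spec.map_surjective k
  have hv : IsUnit (φ.hom (coordX i i)) := (isUnit_coordX i).map φ.hom
  refine ⟨fun j ↦ φ.hom (coordX i j), ⟨i, hv⟩, ?_⟩
  have h1 : p = projPt (φ.hom.comp (constX i)) (fun j ↦ φ.hom (coordX i j)) ⟨i, hv⟩ := by
    rw [← hk, ← hφ, chartX_eq_projPt]
    exact specMap_projPt φ.hom _ _
  have h2 : φ.hom.comp (constX i) = σ := by
    rw [h1, projPt_toSpec] at hp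
    exact congrArg CommRingCat.Hom.hom (Spec.map_injective hp)
  subst h2
  exact h1

end Points

/-! ### Linear automorphisms -/

section Linear

variable {n : ℕ}

/-- The graded homomorphism given by a linear substitution. -/
def linHom (M : Matrix (Fin (n + 1)) (Fin (n + 1)) ℝ) : polyGrading n ℝ →+*ᵍ polyGrading n ℝ where
  __ := MvPolynomial.eval₂Hom MvPolynomial.C fun j ↦ ∑ k, MvPolynomial.C (M j k) * MvPolynomial.X k
  map_mem {i} x hx := by
    have := MvPolynomial.IsHomogeneous.eval₂ (m := i) (n := 1) hx MvPolynomial.C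
      (fun j ↦ ∑ k, MvPolynomial.C (M j k) * MvPolynomial.X k)
      (fun r ↦ MvPolynomial.isHomogeneous_C _ _)
      (fun j ↦ MvPolynomial.IsHomogeneous.sum _ _ _ fun k _ ↦ MvPolynomial.isHomogeneous_C_mul_X _ _)
    rw [one_mul] at this
    exact this

variable (M N : Matrix (Fin (n + 1)) (Fin (n + 1)) ℝ)

lemma linHom_C (a : ℝ) : linHom M (MvPolynomial.C a) = MvPolynomial.C a := MvPolynomial.eval₂_C _ _ a

lemma linHom_X (j : Fin (n + 1)) :
    linHom M (MvPolynomial.X j) = ∑ k, MvPolynomial.C (M j k) * MvPolynomial.X k :=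
  MvPolynomial.eval₂_X _ _ j

/-- Substitution is contravariant, so substituting by `N` and then by `M` corresponds to the product
`N * M`. -/
lemma linHom_comp (h : N * M = 1) : (linHom M).comp (linHom N) = .id _ := by
  have h : (linHom M).toRingHom.comp (linHom N).toRingHom = .id _ := by
    refine MvPolynomial.ringHom_ext (fun r ↦ ?_) (fun j ↦ ?_)
    · change linHom M (linHom N (MvPolynomial.C r)) = MvPolynomial.C r
      rw [linHom_C, linHom_C]
    · change linHom M (linHom N (MvPolynomial.X j)) = MvPolynomial.X j
      have e (l) : ∑ k, MvPolynomial.C (N j k) * MvPolynomial.C (M k l) =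
          (MvPolynomial.C ((1 : Matrix (Fin (n + 1)) (Fin (n + 1)) ℝ) j l) :
            MvPolynomial (Fin (n + 1)) ℝ) := by
        rw [← h, Matrix.mul_apply, map_sum]
        simp
      simp only [linHom_X, map_sum, map_mul, linHom_C, Finset.mul_sum, ← mul_assoc]
      rw [Finset.sum_comm]
      simp only [← Finset.sum_mul, e]
      rw [Finset.sum_eq_single j]
      · simp
      · intro l _ hl
        rw [Matrix.one_apply_ne hl.symm, map_zero, zero_mul]
      · simp
  exact GradedRingHom.ext fun x ↦ congr($h x)

lemma linHom_irrelevant (h : N * M = 1) :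
    HomogeneousIdeal.irrelevant (polyGrading n ℝ) ≤
      (HomogeneousIdeal.irrelevant (polyGrading n ℝ)).map (linHom M) := by
  refine irrelevant_le_map_of_X_mem _ fun i ↦ ?_
  have h1 := Ideal.mem_map_of_mem (linHom M)
    (HomogeneousIdeal.mem_irrelevant_of_mem (polyGrading n ℝ) zero_lt_one
      ((linHom N).map_mem (X_mem i)))
  have e : linHom M (linHom N (MvPolynomial.X i)) = MvPolynomial.X i :=
    congr($(linHom_comp M N h) (MvPolynomial.X i))
  have h2 : linHom M (linHom N (MvPolynomial.X i)) ∈ _ := h1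
  rwa [e] at h2

/-- A linear automorphism of projective space. -/
def linIso (h : N * M = 1) (h' : M * N = 1) : projSpace n ℝ ≅ projSpace n ℝ where
  hom := Proj.map (linHom M) (linHom_irrelevant M N h)
  inv := Proj.map (linHom N) (linHom_irrelevant N M h')
  hom_inv_id := by
    rw [← Proj.map_comp, ← Proj.map_id]
    congr 1
    exact linHom_comp M N h
  inv_hom_id := by
    rw [← Proj.map_comp, ← Proj.map_id]
    congr 1
    exact linHom_comp N M h'

lemma linIso_toSpec (h : N * M = 1) (h' : M * N = 1) :
    (linIso M N h h').hom ≫ projSpaceToSpec n ℝ = projSpaceToSpec n ℝ := by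
  refine (projMap_comp_projSpaceToSpec n (RingHom.id ℝ) _ _ (linHom_C M)).trans ?_
  rw [CommRingCat.ofHom_id, Spec.map_id, Category.comp_id]

lemma projPt_linIso (h : N * M = 1) (h' : M * N = 1) {R : Type} [CommRing R] {σ : ℝ →+* R}
    {v : Fin (n + 1) → R} (hv : ∃ i, IsUnit (v i)) (hw : ∃ i, IsUnit (∑ k, σ (M i k) * v k)) :
    projPt σ v hv ≫ (linIso M N h h').hom = projPt σ (fun i ↦ ∑ k, σ (M i k) * v k) hw := by
  refine projPt_map _ _ _ _ (fun a ↦ ?_) fun i ↦ ?_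
  · rw [linHom_C, MvPolynomial.eval₂_C]
  · rw [linHom_X, MvPolynomial.eval₂_sum]
    simp

/-- Linear automorphisms act transitively on the real points of projective space. -/
lemma exists_linIso (O : RealPoint (realProjSpace n)) :
    ∃ α : projSpace n ℝ ≅ projSpace n ℝ, α.hom ≫ projSpaceToSpec n ℝ = projSpaceToSpec n ℝ ∧
      projPt (RingHom.id ℝ) (Fin.cons 1 0) (exists_isUnit_cons _) ≫ α.hom = O.left := by
  obtain ⟨v, hv, h⟩ := exists_eq_projPt (σ := RingHom.id ℝ) (p := O.left) (by
    rw [CommRingCat.ofHom_id, Spec.map_id]; exact Over.w O)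
  obtain ⟨j, hj⟩ := hv
  have hv0 : v ≠ 0 := fun h0 ↦ hj.ne_zero (congrFun h0 j)
  have he0 : (Pi.single 0 1 : Fin (n + 1) → ℝ) ≠ 0 := by simp
  -- A linear automorphism carrying the first basis vector to the coordinate vector of `O`.
  obtain ⟨A, hA⟩ := SeparatingDual.exists_continuousLinearEquiv_apply_eq (R := ℝ) he0 hv0
  let e : (Fin (n + 1) → ℝ) ≃ₗ[ℝ] (Fin (n + 1) → ℝ) := A.toLinearEquiv
  let M := LinearMap.toMatrix' (e : (Fin (n + 1) → ℝ) →ₗ[ℝ] (Fin (n + 1) → ℝ))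
  let N := LinearMap.toMatrix' (e.symm : (Fin (n + 1) → ℝ) →ₗ[ℝ] (Fin (n + 1) → ℝ))
  have h1 : N * M = 1 := by
    rw [← LinearMap.toMatrix'_comp]; simp
  have h2 : M * N = 1 := by
    rw [← LinearMap.toMatrix'_comp]; simp
  refine ⟨linIso M N h1 h2, linIso_toSpec M N h1 h2, ?_⟩
  have hM (i) : ∑ k, RingHom.id ℝ (M i k) * (Fin.cons 1 0 : Fin (n + 1) → ℝ) k = v i := by
    rw [Fin.sum_univ_succ]
    simp only [RingHom.id_apply, Fin.cons_zero, Fin.cons_succ, Pi.zero_apply, mul_zero,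
      Finset.sum_const_zero, add_zero, mul_one]
    rw [← hA]
    exact LinearMap.toMatrix'_apply _ _ _
  rw [projPt_linIso M N h1 h2 _ ⟨j, by rw [hM]; exact hj⟩, h]
  congr 1
  exact funext hM

end Linear

/-! ### The blowing-up of the plane at a real point -/

section Plane

variable {K : Type} [Field K] [Algebra ℝ K] {t x : K}

/-- The charts of the projective plane with coordinates `x`, `t x`. -/
def planeRings (t x : K) : Set (Subring K) :=
  {rng {x, t * x}, rng {t, x⁻¹}, rng {t⁻¹, (t * x)⁻¹}}

lemma Coords.plane (h : Coords t x) : Coords x (t * x) := by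
  refine h.of_isAlgebraic ?_ (Coords.isAlgebraic_left _ _)
  have h1 := (Coords.isAlgebraic_right x (t * x)).mul (Coords.isAlgebraic_left x (t * x)).inv
  rwa [mul_inv_cancel_right₀ h.right_ne_zero] at h1

lemma range_evalX_plane (h : Coords t x) (i : Fin 3)
    (hi : IsUnit ((Fin.cons 1 ![x, t * x] : Fin (2 + 1) → K) i)) :
    (evalX (algebraMap ℝ K) (Fin.cons 1 ![x, t * x]) i hi).range =
      ![rng {x, t * x}, rng {t, x⁻¹}, rng {t⁻¹, (t * x)⁻¹}] i := by
  have ht := h.left_ne_zero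
  have hx := h.right_ne_zero
  have c1 : (Fin.cons 1 ![x, t * x] : Fin 3 → K) 1 = x := rfl
  have c2 : (Fin.cons 1 ![x, t * x] : Fin 3 → K) 2 = t * x := rfl
  refine (range_evalX_eq _ _ _).trans ?_
  fin_cases i
  · refine le_antisymm (rng_le_rng ?_) (rng_le_rng (pair_subset ?_ ?_))
    · rintro _ ⟨j, rfl⟩
      fin_cases j
      · exact mem_rng_pair 0 0 (by simp)
      · exact mem_rng_pair 1 0 (by simp)
      · exact mem_rng_pair 0 1 (by simp [c2])
    · exact mem_rng ⟨1, by simp⟩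
    · exact mem_rng ⟨2, by simp [c2]⟩
  · refine le_antisymm (rng_le_rng ?_) (rng_le_rng (pair_subset ?_ ?_))
    · rintro _ ⟨j, rfl⟩
      fin_cases j
      · exact mem_rng_pair 0 1 (by simp)
      · exact mem_rng_pair 0 0 (by simp [c1, hx])
      · exact mem_rng_pair 1 0 (by simp [c1, c2, hx])
    · exact mem_rng ⟨2, by simp [c1, c2, hx]⟩
    · exact mem_rng ⟨0, by simp⟩
  · refine le_antisymm (rng_le_rng ?_) (rng_le_rng (pair_subset ?_ ?_))
    · rintro _ ⟨j, rfl⟩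
      fin_cases j
      · exact mem_rng_pair 0 1 (by simp [c2])
      · exact mem_rng_pair 1 0 (by simp [c1, c2]; field_simp)
      · exact mem_rng_pair 0 0 (by simp [c2, hx, ht])
    · exact mem_rng ⟨1, by simp [c1, c2]; field_simp⟩
    · exact mem_rng ⟨0, by simp [c2]⟩

/-- The generic point of the projective plane. -/
def planePt (t x : K) : Spec (.of K) ⟶ projSpace 2 ℝ :=
  projPt (algebraMap ℝ K) (Fin.cons 1 ![x, t * x]) (exists_isUnit_cons _)

lemma coveredBy_planePt (h : Coords t x) : CoveredBy (planePt t x) (planeRings t x) ∧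
    ∀ B ∈ planeRings t x, ∃ c, IsChart (planePt t x) B c := by
  have hinj := eq_zero_of_eval₂_cons (algebraMap ℝ K) ![x, t * x] h.plane.evalPair_injective
  have hu (i : Fin (2 + 1)) : IsUnit ((Fin.cons 1 ![x, t * x] : Fin (2 + 1) → K) i) := by
    fin_cases i
    exacts [isUnit_one, h.right_ne_zero.isUnit, (mul_ne_zero h.left_ne_zero h.right_ne_zero).isUnit]
  have e (i) := range_evalX_plane h i (hu i)
  refine ⟨(coveredBy_projSpace hinj hu).mono ?_, ?_⟩
  · rintro _ ⟨i, rfl⟩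
    dsimp only
    rw [e]
    fin_cases i
    exacts [Or.inl rfl, Or.inr (Or.inl rfl), Or.inr (Or.inr rfl)]
  · have key (i : Fin 3) : ∃ c, IsChart (planePt t x)
        (![rng {x, t * x}, rng {t, x⁻¹}, rng {t⁻¹, (t * x)⁻¹}] i) c := by
      obtain ⟨c, hc, -⟩ := isChart_projSpace hinj i (hu i)
      rw [← e]
      exact ⟨c, hc⟩
    rintro _ (rfl | rfl | rfl)
    exacts [key 0, key 1, key 2]

lemma IsChart.comp_iso {X Y : Scheme.{0}} {η : Spec (.of K) ⟶ X} {B : Subring K}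
    {c : Spec (.of B) ⟶ X} (h : IsChart η B c) (α : X ≅ Y) : IsChart (η ≫ α.hom) B (c ≫ α.hom) := by
  have := h.1
  exact ⟨inferInstance, by rw [← Category.assoc, h.2]⟩

lemma CoveredBy.comp_iso {X Y : Scheme.{0}} {η : Spec (.of K) ⟶ X} {𝓑 : Set (Subring K)}
    (h : CoveredBy η 𝓑) (α : X ≅ Y) : CoveredBy (η ≫ α.hom) 𝓑 := by
  intro y
  obtain ⟨z, rfl⟩ := α.hom.surjective y
  obtain ⟨B, hB, c, hc, w, rfl⟩ := h z
  exact ⟨B, hB, c ≫ α.hom, hc.comp_iso α, w, rfl⟩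

lemma ker_eq_span_pair {a b : K} (φ : rng {a, b} →+* ℝ) (hC : ∀ r, φ (rngC _ r) = r)
    (ha : φ (genL a b) = 0) (hb : φ (genR a b) = 0) :
    RingHom.ker φ = Ideal.span {genL a b, genR a b} := by
  refine le_antisymm (fun z hz ↦ ?_) (Ideal.span_le.2 ?_)
  · set J := Ideal.span {genL a b, genR a b} with hJ
    have h1 : genL a b ∈ J := Ideal.subset_span (by simp)
    have h2 : genR a b ∈ J := Ideal.subset_span (by simp)
    obtain ⟨α, h⟩ : ∃ α : ℝ, z - rngC _ α ∈ J := by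
      clear hz
      induction z using rng_induction with
      | hs c hc =>
        obtain rfl | rfl := hc
        · exact ⟨0, by simpa using h1⟩
        · exact ⟨0, by simpa using h2⟩
      | hC r => exact ⟨r, by simp⟩
      | hadd u v hu hv =>
        obtain ⟨α, h⟩ := hu
        obtain ⟨β, h'⟩ := hv
        refine ⟨α + β, ?_⟩
        convert J.add_mem h h' using 1
        rw [map_add]
        ring
      | hmul u v hu hv =>
        obtain ⟨α, h⟩ := hu
        obtain ⟨β, h'⟩ := hv
        refine ⟨α * β, ?_⟩
        convert J.add_mem (J.mul_mem_right v h) (J.mul_mem_left (rngC _ α) h') using 1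
        rw [map_mul]
        ring
    have hle : J ≤ RingHom.ker φ := by
      rw [hJ, Ideal.span_le]
      rintro _ (rfl | rfl)
      exacts [ha, hb]
    have h3 : φ (z - rngC _ α) = 0 := hle h
    have hz' : φ z = 0 := hz
    rw [map_sub, hz', hC, zero_sub, neg_eq_zero] at h3
    simpa [h3] using h
  · rintro _ (rfl | rfl)
    exacts [ha, hb]

/-- The chart has affine coordinates `x`, `t x`, so evaluation at the origin is the point `[1 : 0 :
0]`. -/
lemma exists_hom_plane (h : Coords t x) {c : Spec (.of (rng {x, t * x})) ⟶ projSpace 2 ℝ}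
    (hc : genPt _ ≫ c = planePt t x) : ∃ φ : rng {x, t * x} →+* ℝ, (∀ r, φ (rngC _ r) = r) ∧
      φ (genL x (t * x)) = 0 ∧ φ (genR x (t * x)) = 0 ∧
      Spec.map (CommRingCat.ofHom φ) ≫ c =
        projPt (RingHom.id ℝ) (Fin.cons 1 0) (exists_isUnit_cons _) := by
  obtain ⟨φ, h1, h2, h3⟩ := h.plane.exists_hom (RingHom.id ℝ) 0 0
  refine ⟨φ, fun r ↦ RingHom.congr_fun h1 r, h2, h3, ?_⟩
  let w : Fin (2 + 1) → rng {x, t * x} := Fin.cons 1 ![genL x (t * x), genR x (t * x)]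
  have hw : ∃ i, IsUnit (w i) := ⟨0, isUnit_one⟩
  have e : c = projPt (rngC _) w hw := by
    refine hom_ext_of_genPt (hc.trans ?_)
    rw [genPt, specMap_projPt (rng {x, t * x}).subtype hw ⟨0, by simp [w]⟩, planePt]
    congr 1
    ext i
    fin_cases i <;> rfl
  rw [e, specMap_projPt φ hw ⟨0, by simp [w]⟩]
  congr 1
  ext i
  fin_cases i
  exacts [map_one φ, h2, h3]

/-- The function `a` vanishes at `p`, while its inverse `b` is regular on the chart `d`, so `p` does
not meet that chart. -/
lemma restr_ker_eq_top {Y : Scheme.{0}} {η : Spec (.of K) ⟶ Y} {A B : Subring K} {c : Spec (.of A) ⟶ Y}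
    {d : Spec (.of B) ⟶ Y} (hc : IsChart η A c) (hd : IsChart η B d) {S : Type} [CommRing S]
    (φ : A →+* S) (a : A) (b : B) (hab : (a : K) * b = 1) (ha : φ a = 0) {p : Spec (.of S) ⟶ Y}
    (hp : Spec.map (CommRingCat.ofHom φ) ≫ c = p) [QuasiCompact p] : restr p.ker d = Ideal.span {1} := by
  have := hd.1
  rw [Ideal.span_singleton_one]
  refine restr_eq_top_of_notMem_range _ _ fun z hz hz' ↦ ?_
  have hz2 : z ∈ closure (Set.range p) := by rw [← Scheme.Hom.support_ker]; exact hz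
  obtain ⟨_, ⟨q, hq⟩, w, rfl⟩ := mem_closure_iff.1 hz2 _ d.isOpenEmbedding.isOpen_range hz'
  have h1 : c (Spec.map (CommRingCat.ofHom φ) w) = d q := by
    rw [hq, ← hp]; rfl
  refine hc.notMem_of_mul_eq_one hd h1 a b hab ?_
  change φ a ∈ w.asIdeal
  rw [ha]
  exact w.asIdeal.zero_mem

lemma IsBlowupDatum.of_eq_span_one {X Y : Scheme.{0}} {ηX : Spec (.of K) ⟶ X}
    {ηY : Spec (.of K) ⟶ Y} {I : Y.IdealSheafData} {A : Subring K} {c : Spec (.of A) ⟶ Y}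
    (hc : IsChart ηY A c) (hI : restr I c = Ideal.span {1}) (hA : HasCenter ηX A) :
    IsBlowupDatum ηX ηY I A c {1} := by
  refine ⟨hc, hI, ?_, ?_⟩
  · rintro _ rfl
    exact one_ne_zero
  · rintro _ rfl
    exact hA.mono (le_affineBlowup _ _ _)

/-- With affine coordinates `x` and `t x`, the blowing-up of the origin adjoins `t` or `t⁻¹`, giving
the charts `(t, x)` and `(t⁻¹, t x)`. The other two charts of the degree 1 surface are the charts of
the plane away from the origin. -/
lemma isBlowup_plane {X Y : Scheme.{0}} [X.IsSeparated] [Y.IsSeparated] {ηX : Spec (.of K) ⟶ X}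
    {ηY : Spec (.of K) ⟶ Y} (h : Coords t x) (hX : IsRuled ηX t t⁻¹ x (t * x))
    (hY : CoveredBy ηY (planeRings t x)) (hY' : ∀ B ∈ planeRings t x, ∃ c, IsChart ηY B c)
    {p : Spec (.of ℝ) ⟶ Y} {c : Spec (.of (rng {x, t * x})) ⟶ Y} (hc : IsChart ηY _ c)
    (φ : rng {x, t * x} →+* ℝ) (hφC : ∀ r, φ (rngC _ r) = r) (hφx : φ (genL x (t * x)) = 0)
    (hφy : φ (genR x (t * x)) = 0) (hp : Spec.map (CommRingCat.ofHom φ) ≫ c = p) :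
    ∃ π : X ⟶ Y, ηX ≫ π = ηY ∧ IsBlowup p.ker π := by
  have ht := h.left_ne_zero
  have hx := h.right_ne_zero
  have hcX (B) (hB : B ∈ ruledRings t t⁻¹ x (t * x)) : HasCenter ηX B := by
    obtain ⟨c, hc⟩ := hX.isChart B hB
    exact ⟨c, hc.2⟩
  obtain ⟨d₁, hd₁⟩ := hY' (rng {t, x⁻¹}) (Or.inr (Or.inl rfl))
  obtain ⟨d₂, hd₂⟩ := hY' (rng {t⁻¹, (t * x)⁻¹}) (Or.inr (Or.inr rfl))
  have hle₁ : rng {x, t * x} ≤ rng {t, x} :=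
    rng_le_rng (pair_subset (mem_rng_right _ _) (mem_rng_pair 1 1 (by simp)))
  have hle₂ : rng {x, t * x} ≤ rng {t⁻¹, t * x} :=
    rng_le_rng (pair_subset (mem_rng_pair 1 1 (by field_simp)) (mem_rng_right _ _))
  obtain ⟨π, hπ⟩ := hX.coveredBy.exists_hom (ηY := ηY) (by
    rintro _ (rfl | rfl | rfl | rfl)
    · exact HasCenter.mono ⟨c, hc.2⟩ hle₁
    · exact HasCenter.mono ⟨c, hc.2⟩ hle₂
    · exact ⟨d₁, hd₁.2⟩
    · exact ⟨d₂, hd₂.2⟩)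
  have := hc.1
  have key (g : rng {x, t * x}) {u : Set K}
      (hu : u ⊆ affineBlowup (rng {x, t * x}) {genL x (t * x), genR x (t * x)} g) :
      rng u ≤ affineBlowup (rng {x, t * x}) {genL x (t * x), genR x (t * x)} g :=
    rng_le (fun r ↦ le_affineBlowup _ _ _ (algebraMap_mem_rng _ r)) hu
  have hD : IsBlowupDatum ηX ηY p.ker _ c {genL x (t * x), genR x (t * x)} := by
    refine ⟨hc, by rw [restr_ker p φ c hp, ker_eq_span_pair φ hφC hφx hφy], ?_, ?_⟩
    · rintro _ (rfl | rfl)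
      · exact fun h0 ↦ hx congr(($h0 : K))
      · exact fun h0 ↦ mul_ne_zero ht hx congr(($h0 : K))
    · rintro _ (rfl | rfl)
      · refine (hcX _ (Or.inl rfl)).mono (key _ (pair_subset ?_ (le_affineBlowup _ _ _ (mem_rng_left _ _))))
        exact Subring.subset_closure (Or.inr ⟨genR x (t * x), by simp, mul_div_cancel_right₀ t hx⟩)
      · refine (hcX _ (Or.inr (Or.inl rfl))).mono
          (key _ (pair_subset ?_ (le_affineBlowup _ _ _ (mem_rng_right _ _))))
        exact Subring.subset_closure (Or.inr ⟨genL x (t * x), by simp, by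
          change x / (t * x) = t⁻¹
          field_simp⟩)
  have hD₁ : IsBlowupDatum ηX ηY p.ker _ d₁ {1} := .of_eq_span_one hd₁
    (restr_ker_eq_top hc hd₁ φ (genL _ _) (genR _ _) (mul_inv_cancel₀ hx) hφx hp)
    (hcX _ (by simp [ruledRings]))
  have hD₂ : IsBlowupDatum ηX ηY p.ker _ d₂ {1} := .of_eq_span_one hd₂
    (restr_ker_eq_top hc hd₂ φ (genR _ _) (genR _ _) (mul_inv_cancel₀ (mul_ne_zero ht hx)) hφy hp)
    (hcX _ (by simp [ruledRings]))
  have := hX.coveredBy.isReduced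
  have := hX.coveredBy.isDominant
  refine ⟨π, hπ, isBlowup_of_isBlowupDatum hπ (fun z ↦ ?_) fun z ↦ ?_⟩
  · obtain ⟨B, hB, e, he, hz⟩ := hY z
    have key {d : Spec (.of B) ⟶ Y} (hd : IsChart ηY B d) : z ∈ Set.range d := by
      rwa [show d = e from hom_ext_of_genPt (hd.2.trans he.2.symm)]
    obtain rfl | rfl | rfl := hB
    · exact ⟨_, _, _, hD, key hD.1⟩
    · exact ⟨_, _, _, hD₁, key hD₁.1⟩
    · exact ⟨_, _, _, hD₂, key hD₂.1⟩
  · obtain ⟨B, hB, e, he, hz⟩ := hX.coveredBy z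
    have key₃ (B : Subring K) (A : Subring K) : ∃ g ∈ ({1} : Set A), ∀ h ∈ ({1} : Set A),
        (h : K) / g ∈ B := by
      refine ⟨1, rfl, ?_⟩
      rintro _ rfl
      rw [Subring.coe_one, div_one]
      exact B.one_mem
    obtain rfl | rfl | rfl | rfl := hB
    · refine ⟨_, _, _, hD, _, e, he, hz, hle₁, genL _ _, by simp, ?_⟩
      rintro _ (rfl | rfl)
      · exact mem_rng_pair 0 0 (by simp [hx])
      · exact mem_rng_pair 1 0 (by simp [hx])
    · refine ⟨_, _, _, hD, _, e, he, hz, hle₂, genR _ _, by simp, ?_⟩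
      rintro _ (rfl | rfl)
      · exact mem_rng_pair 1 0 (by simp; field_simp)
      · exact mem_rng_pair 0 0 (by simp [hx, ht])
    · exact ⟨_, _, _, hD₁, _, e, he, hz, le_rfl, key₃ _ _⟩
    · exact ⟨_, _, _, hD₂, _, e, he, hz, le_rfl, key₃ _ _⟩

/-- A linear automorphism reduces an arbitrary real point to the origin of the chart with
coordinates `x`, `t x`. -/
lemma exists_isBlowupAtRealPoint (h : Coords t x) (O : RealPoint (realProjSpace 2)) :
    ∃ π : hModel 1 t x ⟶ realProjSpace 2, IsBlowupAtRealPoint O π := by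
  obtain ⟨α, hα, hO⟩ := exists_linIso O
  obtain ⟨hY, hY'⟩ := coveredBy_planePt h
  obtain ⟨c, hc⟩ := hY' _ (Or.inl rfl)
  obtain ⟨φ, hφC, hφx, hφy, hφ⟩ := exists_hom_plane h hc.2
  have hX := isRuled_hModel h.left_ne_zero h.right_ne_zero 1
  rw [pow_one] at hX
  obtain ⟨π, hπ, hb⟩ := isBlowup_plane h hX (hY.comp_iso α)
    (fun B hB ↦ by
      obtain ⟨d, hd⟩ := hY' B hB
      exact ⟨_, hd.comp_iso α⟩) (hc.comp_iso α) φ hφC hφx hφy (p := O.left)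
    (by rw [← hO, ← hφ, Category.assoc])
  have hη : IsRealPt (X := realProjSpace 2) (planePt t x ≫ α.hom) := by
    refine (Category.assoc _ _ _).trans ((congrArg _ hα).trans (projPt_toSpec _))
  exact ⟨Over.homMk π (hX.coveredBy.comp_hom_eq (Y := realProjSpace 2)
    (isRealPt_projModelPt _ _) hη hπ), hb⟩

end Plane

/-! ### Localizations between chart rings -/

section Localization

variable {K : Type} [Field K]

lemma isLocalization_away_of_le {B B' : Subring K} (h : B ≤ B') (g : B) (hg0 : (g : K) ≠ 0)
    (hg : (g : K)⁻¹ ∈ B') (hs : ∀ b ∈ B', ∃ n : ℕ, b * (g : K) ^ n ∈ B) :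
    let _ := (Subring.inclusion h).toAlgebra
    IsLocalization.Away g B' := by
  let _ := (Subring.inclusion h).toAlgebra
  refine ⟨?_, ?_, ?_⟩
  · rintro ⟨_, k, rfl⟩
    rw [map_pow]
    refine IsUnit.pow _ (IsUnit.of_mul_eq_one ⟨_, hg⟩ (Subtype.ext ?_))
    exact mul_inv_cancel₀ hg0
  · intro z
    obtain ⟨n, hn⟩ := hs z z.2
    exact ⟨⟨⟨_, hn⟩, ⟨g ^ n, n, rfl⟩⟩, Subtype.ext rfl⟩
  · intro x y hxy
    have : x = y := Subtype.ext (congrArg Subtype.val hxy :)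
    exact ⟨1, by rw [this]⟩

variable [Algebra ℝ K]

lemma exists_mul_pow_mem {s : Set K} {B : Subring K} (hC : ∀ r, algebraMap ℝ K r ∈ B) {g : K}
    (hg : g ∈ B) (hs : ∀ a ∈ s, ∃ n : ℕ, a * g ^ n ∈ B) {b : K} (hb : b ∈ rng s) :
    ∃ n : ℕ, b * g ^ n ∈ B := by
  induction (show b ∈ Algebra.adjoin ℝ s from hb) using Algebra.adjoin_induction with
  | mem a h => exact hs a h
  | algebraMap r => exact ⟨0, by simpa using hC r⟩
  | add a b h h' ih ih' =>
    obtain ⟨m, hm⟩ := ih h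
    obtain ⟨n, hn⟩ := ih' h'
    refine ⟨m + n, ?_⟩
    have : (a + b) * g ^ (m + n) = (a * g ^ m) * g ^ n + (b * g ^ n) * g ^ m := by ring
    rw [this]
    exact add_mem (mul_mem hm (pow_mem hg n)) (mul_mem hn (pow_mem hg m))
  | mul a b h h' ih ih' =>
    obtain ⟨m, hm⟩ := ih h
    obtain ⟨n, hn⟩ := ih' h'
    refine ⟨m + n, ?_⟩
    have : (a * b) * g ^ (m + n) = (a * g ^ m) * (b * g ^ n) := by ring
    rw [this]
    exact mul_mem hm hn

/-- `rng s'` is the localization of `rng s` at `g`. -/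
structure IsAwayRng (s s' : Set K) (g : K) : Prop where
  ne_zero : g ≠ 0
  mem : g ∈ rng s
  inv_mem : g⁻¹ ∈ rng s'
  subset : s ⊆ rng s'
  exists_mem : ∀ a ∈ s', ∃ n : ℕ, a * g ^ n ∈ rng s

lemma IsAwayRng.isLocalization {s s' : Set K} {g : K} (h : IsAwayRng s s' g) :
    let _ := (Subring.inclusion (rng_le_rng h.subset)).toAlgebra
    IsLocalization.Away (⟨g, h.mem⟩ : rng s) (rng s') :=
  isLocalization_away_of_le _ _ h.ne_zero h.inv_mem fun _ hb ↦
    exists_mul_pow_mem (algebraMap_mem_rng s) h.mem h.exists_mem hb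

end Localization

/-! ### Smoothness of the charts -/

section Smooth

variable {K : Type} [Field K] [Algebra ℝ K]

open RingHom

/-- The two variables with no relations form a submersive presentation; its Jacobian is an empty
determinant. -/
lemma isStandardSmooth_mvPolynomial :
    (algebraMap ℝ (MvPolynomial (Fin 2) ℝ)).IsStandardSmoothOfRelativeDimension 2 := by
  rw [isStandardSmoothOfRelativeDimension_algebraMap]
  let P : Algebra.SubmersivePresentation ℝ (MvPolynomial (Fin 2) ℝ) (Fin 2) PEmpty.{1} :=
    { toGenerators := Algebra.Generators.mvPolynomial ℝ (Fin 2)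
      relation := PEmpty.elim
      span_range_relation_eq_ker := by
        rw [Set.range_eq_empty, Ideal.span_empty, Algebra.Generators.ker_eq_ker_aeval_val]
        symm
        rw [← RingHom.injective_iff_ker_eq_bot]
        intro a b h
        have e (c : MvPolynomial (Fin 2) ℝ) :
            MvPolynomial.aeval (Algebra.Generators.mvPolynomial ℝ (Fin 2)).val c = c := 
          MvPolynomial.aeval_X_left_apply c
        have h' : MvPolynomial.aeval (Algebra.Generators.mvPolynomial ℝ (Fin 2)).val a =
          MvPolynomial.aeval (Algebra.Generators.mvPolynomial ℝ (Fin 2)).val b := h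
        rwa [e, e] at h'
      map := PEmpty.elim
      map_inj := fun a ↦ a.elim
      jacobian_isUnit := by
        rw [Algebra.PreSubmersivePresentation.jacobian_eq_jacobiMatrix_det, Matrix.det_isEmpty,
          map_one]
        exact isUnit_one }
  refine P.isStandardSmoothOfRelativeDimension ?_
  simp [Algebra.Presentation.dimension]

lemma Coords.isStandardSmooth {a b : K} (h : Coords a b) :
    (rngC {a, b}).IsStandardSmoothOfRelativeDimension 2 := by
  have := (isStandardSmoothOfRelativeDimension_respectsIso (n := 2)).1 _ h.equiv
    isStandardSmooth_mvPolynomial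
  convert this using 1
  exact RingHom.ext fun r ↦ (h.equiv_C r).symm

lemma IsAwayRng.isStandardSmooth {s s' : Set K} {g : K} (h : IsAwayRng s s' g)
    (hs : (rngC s).IsStandardSmoothOfRelativeDimension 2) :
    (rngC s').IsStandardSmoothOfRelativeDimension 2 := by
  let _ := (Subring.inclusion (rng_le_rng h.subset)).toAlgebra
  have := h.isLocalization
  have h1 := IsStandardSmoothOfRelativeDimension.algebraMap_isLocalizationAway
    (Rᵣ := rng s') (⟨g, h.mem⟩ : rng s)
  exact h1.comp hs

lemma IsAwayRng.isStandardSmooth_localization {s s' : Set K} {g : K} (h : IsAwayRng s s' g)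
    (hs : (rngC s').IsStandardSmoothOfRelativeDimension 2) :
    ((algebraMap (rng s) (Localization.Away (⟨g, h.mem⟩ : rng s))).comp
      (rngC s)).IsStandardSmoothOfRelativeDimension 2 := by
  let _ := (Subring.inclusion (rng_le_rng h.subset)).toAlgebra
  have := h.isLocalization
  let e := IsLocalization.algEquiv (Submonoid.powers (⟨g, h.mem⟩ : rng s)) (rng s')
    (Localization.Away (⟨g, h.mem⟩ : rng s))
  have := (isStandardSmoothOfRelativeDimension_respectsIso (n := 2)).1 _ e.toRingEquiv hs
  convert this using 1
  exact RingHom.ext fun r ↦ (e.commutes (rngC s r)).symm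

/-- `rng s` is a smooth `ℝ`-algebra of relative dimension `2`. -/
def IsSmoothRng (B : Subring K) : Prop :=
  ∃ s, B = rng s ∧ Locally (IsStandardSmoothOfRelativeDimension 2) (rngC s)

lemma Coords.isSmoothRng {a b : K} (h : Coords a b) : IsSmoothRng (rng {a, b}) :=
  ⟨_, rfl, locally_of isStandardSmoothOfRelativeDimension_respectsIso _ h.isStandardSmooth⟩

/-- The quadric `x u = 1 + t ^ 2` is covered by three opens that are also opens of affine planes:
where `x` is invertible use `(t, x)`, where `u` is invertible use `(t, u)`, and elsewhere project
from the real point `(t, x, u) = (0, 1, 1)`. -/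
lemma isSmoothRng_conic {t x u : K} (h : Coords t x) (hu : x * u = 1 + t ^ 2) :
    IsSmoothRng (rng {t, x, u}) := by
  have ht : t ∈ rng {t, x, u} := mem_rng (by simp)
  have hx : x ∈ rng {t, x, u} := mem_rng (by simp)
  have hu' : u ∈ rng {t, x, u} := mem_rng (by simp)
  have hx0 := h.right_ne_zero
  have hu0 : u ≠ 0 := fun h0 ↦ h.one_add_sq_ne_zero (by rw [← hu, h0, mul_zero])
  have hux : u = (1 + t ^ 2) * x⁻¹ := by rw [← hu]; field_simp
  have hxu : x = (1 + t ^ 2) * u⁻¹ := by rw [← hu]; field_simp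
  -- The equation `D = 0` is the tangent plane to the quadric at `(0, 1, 1)`. Away from it the
  -- slopes `t / D` and `(x - 1) / D` are coordinates.
  set D : K := 2 - x - u with hD
  have two_mem (s : Set K) : (2 : K) ∈ rng s := by
    have := add_mem (one_mem (rng s)) (one_mem (rng s)); rwa [one_add_one_eq_two] at this
  have hDm : D ∈ rng {t, x, u} := sub_mem (sub_mem (two_mem _) hx) hu'
  -- On `D = 0` the equation of the quadric becomes `(x - 1) ^ 2 + t ^ 2 = 0`, which is impossible
  -- for independent `t` and `x`.
  have hD0 : D ≠ 0 := by
    intro h0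
    let P : MvPolynomial (Fin 2) ℝ := (MvPolynomial.X 1 - 1) ^ 2 + MvPolynomial.X 0 ^ 2
    have hP : P = 0 := h.eq_zero_of_aeval (p := P) (by
      simp only [P, map_add, map_pow, map_sub, map_one, MvPolynomial.aeval_X]
      simp only [Matrix.cons_val_zero, Matrix.cons_val_one]
      linear_combination (-x) * h0 - hu + x * hD)
    have := congrArg (MvPolynomial.eval ![1, 1]) hP
    simp [P] at this
  obtain ⟨p, hp⟩ : ∃ p, p = t / D := ⟨_, rfl⟩
  obtain ⟨q, hq⟩ : ∃ q, q = (x - 1) / D := ⟨_, rfl⟩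
  have htp : t = p * D := by rw [hp]; field_simp
  have hxq : x = 1 + q * D := by rw [hq]; field_simp; ring
  -- Inverse projection: substituting `t = p D`, `x = 1 + q D` in the quadric and cancelling `D`
  -- determines `D` from `p` and `q`.
  have hg : D * (p ^ 2 + q + q ^ 2) = -1 := by
    have : D * (D * (p ^ 2 + q + q ^ 2)) = D * (-1) := by
      have : D * (D * (p ^ 2 + q + q ^ 2)) = t ^ 2 + D * (x - 1) + (x - 1) ^ 2 := by
        rw [hp, hq]; field_simp
      rw [this]
      linear_combination (-1) * hu + (x) * hD
    exact mul_left_cancel₀ hD0 this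
  have hg0 : p ^ 2 + q + q ^ 2 ≠ 0 := fun h0 ↦ by
    rw [h0, mul_zero] at hg
    exact one_ne_zero (neg_eq_zero.1 hg.symm)
  have hgi : (p ^ 2 + q + q ^ 2)⁻¹ = -D := by
    refine inv_eq_of_mul_eq_one_right ?_; linear_combination -hg
  have hDi : D⁻¹ = -(p ^ 2 + q + q ^ 2) := by
    refine inv_eq_of_mul_eq_one_right ?_; linear_combination -hg
  have hpq : Coords p q := by
    have hpa := Coords.isAlgebraic_left p q
    have hqa := Coords.isAlgebraic_right p q
    have hDa : IsAlgebraic (Algebra.adjoin ℝ (Set.range ![p, q])) D := by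
      have := (((hpa.pow 2).add hqa).add (hqa.pow 2)).inv.neg
      rwa [hgi, neg_neg] at this
    refine h.of_isAlgebraic ?_ ?_
    · rw [htp]; exact hpa.mul hDa
    · rw [hxq]; exact isAlgebraic_one.add (hqa.mul hDa)
  have htu : Coords t u := by
    have hta := Coords.isAlgebraic_left t u
    refine h.of_isAlgebraic hta ?_
    rw [hxu]
    exact (isAlgebraic_one.add (hta.pow 2)).mul (Coords.isAlgebraic_right t u).inv
  have triple {P : K → Prop} {a b c : K} (ha : P a) (hb : P b) (hc : P c) :
      ∀ z ∈ ({a, b, c} : Set K), P z := by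
    rintro z (rfl | rfl | rfl) <;> assumption
  have pair {P : K → Prop} {a b : K} (ha : P a) (hb : P b) :
      ∀ z ∈ ({a, b} : Set K), P z := by
    rintro z (rfl | rfl) <;> assumption
  have m1 (a b c : K) : a ∈ rng {a, b, c} := mem_rng (by simp)
  have m2 (a b c : K) : b ∈ rng {a, b, c} := mem_rng (by simp)
  have m3 (a b c : K) : c ∈ rng {a, b, c} := mem_rng (by simp)
  have zero {B : Subring K} {a g : K} (ha : a ∈ B) : ∃ n : ℕ, a * g ^ n ∈ B := ⟨0, by simpa⟩
  have invp {B : Subring K} {g : K} (hg : g ≠ 0) : ∃ n : ℕ, g⁻¹ * g ^ n ∈ B :=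
    ⟨1, by rw [pow_one, inv_mul_cancel₀ hg]; exact one_mem B⟩
  have hA1 : IsAwayRng {t, x, u} {t, x, x⁻¹} x := by
    refine ⟨hx0, hx, m3 _ _ _, triple (m1 _ _ _) (m2 _ _ _) ?_,
      triple (zero ht) (zero hx) (invp hx0)⟩
    rw [hux]
    exact mul_mem (one_add_sq_mem (m1 _ _ _)) (m3 _ _ _)
  have hA1' : IsAwayRng {t, x} {t, x, x⁻¹} x :=
    ⟨hx0, mem_rng_right _ _, m3 _ _ _, pair (m1 _ _ _) (m2 _ _ _),
      triple (zero (mem_rng_left _ _)) (zero (mem_rng_right _ _)) (invp hx0)⟩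
  have hA2 : IsAwayRng {t, x, u} {t, u, u⁻¹} u := by
    refine ⟨hu0, hu', m3 _ _ _, triple (m1 _ _ _) ?_ (m2 _ _ _),
      triple (zero ht) (zero hu') (invp hu0)⟩
    rw [hxu]
    exact mul_mem (one_add_sq_mem (m1 _ _ _)) (m3 _ _ _)
  have hA2' : IsAwayRng {t, u} {t, u, u⁻¹} u :=
    ⟨hu0, mem_rng_right _ _, m3 _ _ _, pair (m1 _ _ _) (m2 _ _ _),
      triple (zero (mem_rng_left _ _)) (zero (mem_rng_right _ _)) (invp hu0)⟩
  have gm {B : Subring K} (h1 : p ∈ B) (h2 : q ∈ B) : p ^ 2 + q + q ^ 2 ∈ B :=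
    add_mem (add_mem (pow_mem h1 2) h2) (pow_mem h2 2)
  have hx' : x ∈ rng {p, q, D} := by
    rw [hxq]; exact add_mem (one_mem _) (mul_mem (m2 _ _ _) (m3 _ _ _))
  have hA3 : IsAwayRng {t, x, u} {p, q, D} D := by
    refine ⟨hD0, hDm, ?_, triple ?_ hx' ?_, triple ⟨1, ?_⟩ ⟨1, ?_⟩ (zero hDm)⟩
    · rw [hDi]; exact neg_mem (gm (m1 _ _ _) (m2 _ _ _))
    · rw [htp]; exact mul_mem (m1 _ _ _) (m3 _ _ _)
    · have : u = 2 - x - D := by rw [hD]; ring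
      rw [this]; exact sub_mem (sub_mem (two_mem _) hx') (m3 _ _ _)
    · rwa [pow_one, ← htp]
    · have : q * D ^ 1 = x - 1 := by rw [hxq]; ring
      rw [this]; exact sub_mem hx (one_mem _)
  have hA3' : IsAwayRng {p, q} {p, q, D} (p ^ 2 + q + q ^ 2) := by
    refine ⟨hg0, gm (mem_rng_left _ _) (mem_rng_right _ _), ?_, pair (m1 _ _ _) (m2 _ _ _),
      triple (zero (mem_rng_left _ _)) (zero (mem_rng_right _ _)) ⟨1, ?_⟩⟩
    · rw [hgi]; exact neg_mem (m3 _ _ _)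
    · rw [pow_one, hg]; exact neg_mem (one_mem _)
  refine ⟨_, rfl, {⟨x, hx⟩, ⟨u, hu'⟩, ⟨D, hDm⟩}, ?_, ?_⟩
  · rw [Ideal.eq_top_iff_one]
    -- The three opens cover because `x + u + D = 2` is a unit.
    have e : (1 : rng {t, x, u}) = rngC _ (1 / 2) * (⟨x, hx⟩ + ⟨u, hu'⟩ + ⟨D, hDm⟩) := by
      apply Subtype.ext
      change (1 : K) = algebraMap ℝ K (1 / 2) * (x + u + D)
      have : x + u + D = algebraMap ℝ K 2 := by rw [hD, map_ofNat]; ring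
      rw [this, ← map_mul]
      norm_num
    rw [e]
    refine Ideal.mul_mem_left _ _ (add_mem (add_mem ?_ ?_) ?_) <;>
      exact Ideal.subset_span (by simp)
  · rintro _ (rfl | rfl | rfl)
    · exact hA1.isStandardSmooth_localization (hA1'.isStandardSmooth h.isStandardSmooth)
    · exact hA2.isStandardSmooth_localization (hA2'.isStandardSmooth htu.isStandardSmooth)
    · exact hA3.isStandardSmooth_localization (hA3'.isStandardSmooth hpq.isStandardSmooth)

lemma IsRuledData.isSmoothRng {t s x y : K} (h : IsRuledData t s x y) :
    ∀ B ∈ ruledRings t s x y, IsSmoothRng B := by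
  rintro _ (rfl | rfl | rfl | rfl)
  exacts [h.coords.isSmoothRng, h.symm.coords.isSmoothRng, h.inv.coords.isSmoothRng,
    h.symm.inv.coords.isSmoothRng]

lemma IsRuledData.isSmoothRng_elem {t s x y : K} (h : IsRuledData t s x y) :
    ∀ B ∈ elemRings t s x y, IsSmoothRng B := by
  rintro _ (rfl | rfl | rfl | rfl | rfl | rfl)
  exacts [h.elem.coords.isSmoothRng, isSmoothRng_conic h.coords (mul_div_cancel₀ _ h.x_ne_zero),
    h.inv.coords.isSmoothRng, h.elem.symm.coords.isSmoothRng,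
    isSmoothRng_conic h.symm.coords (mul_div_cancel₀ _ h.y_ne_zero), h.symm.inv.coords.isSmoothRng]

lemma IsRealPt.chart_comp {X : RealScheme} {η : Spec (.of K) ⟶ X.left} (hη : IsRealPt η)
    {s : Set K} {c : Spec (.of (rng s)) ⟶ X.left} (hc : IsChart η (rng s) c) :
    c ≫ X.hom = Spec.map (CommRingCat.ofHom (rngC s)) := by
  refine hom_ext_specReal ?_
  refine (Category.assoc _ _ _).symm.trans ((congrArg (· ≫ X.hom) hc.2).trans (Eq.trans hη ?_))
  rw [genPt, ← Spec.map_comp]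
  rfl

lemma CoveredBy.smooth {X : RealScheme} {η : Spec (.of K) ⟶ X.left} {𝓑 : Set (Subring K)}
    (h : CoveredBy η 𝓑) (hη : IsRealPt η) (hs : ∀ B ∈ 𝓑, IsSmoothRng B) :
    SmoothOfRelativeDimension 2 X.hom := by
  obtain ⟨B, c, hB, hc, hx⟩ := h.exists_coverOf
  have hi (i) : IsOpenImmersion (c i) := (hc i).1
  have : IsZariskiLocalAtSource (@SmoothOfRelativeDimension 2) :=
    HasRingHomProperty.instIsZariskiLocalAtSource
  rw [IsZariskiLocalAtSource.iff_of_openCover (P := @SmoothOfRelativeDimension 2)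
    (coverOf _ c hi hx)]
  intro x
  change SmoothOfRelativeDimension 2 (c x ≫ X.hom)
  obtain ⟨s, hBs, hl⟩ := hs _ (hB x)
  have key {B : Subring K} (hBs : B = rng s) (c : Spec (.of B) ⟶ X.left) (hc : IsChart η B c) :
      SmoothOfRelativeDimension 2 (c ≫ X.hom) := by
    subst hBs
    rw [hη.chart_comp hc]
    exact (HasRingHomProperty.Spec_iff (P := @SmoothOfRelativeDimension 2)).2 hl
  exact key hBs _ (hc x)

end Smooth

/-! ### Rationality -/

section Rational

variable {K : Type} [Field K] [Algebra ℝ K]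

/-- The ring of a chart with independent coordinates is a polynomial ring, so the chart is a dense
open affine plane over `ℝ`. -/
lemma isRationalOver_of_isChart {X : RealScheme} {η : Spec (.of K) ⟶ X.left}
    {𝓑 : Set (Subring K)} (h : CoveredBy η 𝓑) (hη : IsRealPt η) {a b : K} (hab : Coords a b)
    {c : Spec (.of (rng {a, b})) ⟶ X.left} (hc : IsChart η (rng {a, b}) c) :
    Scheme.IsRationalOver X.hom := by
  have := hc.1
  have := h.isDominant
  have hd : IsDominant (genPt _ ≫ c) := by rw [hc.2]; exact this
  have : IsDominant c := .of_comp (genPt _) c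
  let φ := Spec.map (CommRingCat.ofHom (hab.equiv.symm : rng {a, b} →+* MvPolynomial (Fin 2) ℝ))
  have hφ : IsIso φ := by
    rw [isIso_SpecMap_iff]; exact hab.equiv.symm.bijective
  let f : 𝔸(Fin 2; Spec (.of ℝ)) ⟶ X.left := (AffineSpace.SpecIso (Fin 2) (.of ℝ)).hom ≫ φ ≫ c
  refine ⟨Fin 2, (Scheme.Hom.birationalOver f _ _ ?_).symm⟩
  rw [Category.assoc, Category.assoc, hη.chart_comp hc, ← Iso.eq_inv_comp,
    AffineSpace.SpecIso_inv_over, ← Spec.map_comp, ← CommRingCat.ofHom_comp]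
  congr 2
  ext r
  simp [← hab.equiv_C]

lemma isRationalOver_of_iso {X Y : RealScheme} (e : X ≅ Y) (h : Scheme.IsRationalOver Y.hom) :
    Scheme.IsRationalOver X.hom :=
  have : IsIso e.hom.left := inferInstanceAs (IsIso ((Over.forget _).map e.hom))
  Scheme.BirationalOver.isRationalOver _ Y.hom
    (Scheme.Hom.birationalOver e.hom.left _ _ (Over.w e.hom))

end Rational

/-! ### The Euclidean topology on real points -/

section RealPoints

attribute [local instance] euclideanTopology

variable {X Y : RealScheme}

/-- Evaluation at a real point. -/
def RealPoint.evalHom (x : RealPoint X) (U : X.left.Opens) (h : ⊤ ≤ x.left ⁻¹ᵁ U) :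
    Γ(X.left, U) →+* ℝ :=
  (x.left.appLE U ⊤ h ≫ (Scheme.ΓSpecIso (CommRingCat.of ℝ)).hom).hom

lemma RealPoint.eval_comp (f : X ⟶ Y) (x : RealPoint X) (U : Y.left.Opens)
    (h : ⊤ ≤ x.left ⁻¹ᵁ (f.left ⁻¹ᵁ U)) (g : Γ(Y.left, U)) :
    RealPoint.eval (X := Y) (x ≫ f) U h g = x.eval (f.left ⁻¹ᵁ U) h (f.left.app U g) := by
  exact congrArg (fun φ : Γ(Y.left, U) ⟶ Γ(Spec (CommRingCat.of ℝ), ⊤) ↦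
    (Scheme.ΓSpecIso (CommRingCat.of ℝ)).hom (φ g))
    (Scheme.Hom.comp_appLE x.left f.left U ⊤ h)

lemma RealPoint.eval_map (x : RealPoint X) {U U' : X.left.Opens} (i : U' ≤ U)
    (h : ⊤ ≤ x.left ⁻¹ᵁ U') (f : Γ(X.left, U)) :
    x.eval U' h (X.left.presheaf.map (homOfLE i).op f) =
      x.eval U (h.trans (x.left.preimage_mono i)) f := by
  change (Scheme.ΓSpecIso (CommRingCat.of ℝ)).hom
    (x.left.appLE U' ⊤ h (X.left.presheaf.map (homOfLE i).op f)) = _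
  rw [← CommRingCat.comp_apply (X.left.presheaf.map _), Scheme.Hom.map_appLE]
  rfl

/-- The unique point of the spectrum of a field. -/
def specPt (F : Type) [Field F] : Spec (CommRingCat.of F) := (⊥ : PrimeSpectrum F)

lemma eq_specPt {F : Type} [Field F] (p : Spec (CommRingCat.of F)) : p = specPt F :=
  Subsingleton.elim (α := PrimeSpectrum F) _ _

/-- The point of the scheme under a real point. -/
def RealPoint.pt (x : RealPoint X) : X.left := x.left (specPt ℝ)

lemma RealPoint.le_iff (x : RealPoint X) (U : X.left.Opens) : ⊤ ≤ x.left ⁻¹ᵁ U ↔ x.pt ∈ U :=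
  ⟨fun h ↦ h (x := specPt ℝ) trivial, fun h p _ ↦ by rw [eq_specPt p]; exact h⟩

lemma top_le_basicOpen_iff (r : Γ(Spec (CommRingCat.of ℝ), ⊤)) :
    ⊤ ≤ (Spec (CommRingCat.of ℝ)).basicOpen r ↔ (Scheme.ΓSpecIso (CommRingCat.of ℝ)).hom r ≠ 0 := by
  rw [basicOpen_eq_of_affine']
  refine ⟨fun h' h0 ↦ ?_, fun h' p _ hp ↦ ?_⟩
  · exact h' (x := specPt ℝ) trivial (by rw [h0]; exact zero_mem _)
  · exact p.2.ne_top (Ideal.eq_top_of_isUnit_mem _ hp (isUnit_iff_ne_zero.2 h'))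

lemma RealPoint.mem_basicOpen_iff (x : RealPoint X) {U : X.left.Opens} (h : ⊤ ≤ x.left ⁻¹ᵁ U)
    (f : Γ(X.left, U)) : ⊤ ≤ x.left ⁻¹ᵁ X.left.basicOpen f ↔ x.eval U h f ≠ 0 := by
  refine Iff.trans (Iff.of_eq (congrArg (⊤ ≤ ·) ?_)) (top_le_basicOpen_iff (x.left.appLE U ⊤ h f))
  rw [Scheme.basicOpen_appLE, top_inf_eq]

lemma isOpen_eval (U : X.left.Opens) (f : Γ(X.left, U)) {V : Set ℝ} (hV : IsOpen V) :
    IsOpen {x : RealPoint X | ∃ h : ⊤ ≤ x.left ⁻¹ᵁ U, x.eval U h f ∈ V} :=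
  TopologicalSpace.isOpen_generateFrom_of_mem ⟨U, f, V, hV, rfl⟩

lemma continuous_comp (f : X ⟶ Y) : Continuous fun x : RealPoint X ↦ (x ≫ f : RealPoint Y) := by
  refine continuous_generateFrom_iff.2 ?_
  rintro _ ⟨U, g, V, hV, rfl⟩
  convert isOpen_eval (X := X) (f.left ⁻¹ᵁ U) (f.left.app U g) hV using 1
  ext x
  exact exists_congr fun h ↦ Iff.of_eq (congrArg (· ∈ V) (RealPoint.eval_comp f x U h g))

/-- Isomorphic real schemes have homeomorphic sets of real points. -/
def realPointHomeo (e : X ≅ Y) : RealPoint X ≃ₜ RealPoint Y where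
  toFun x := x ≫ e.hom
  invFun y := y ≫ e.inv
  left_inv x := by simp
  right_inv y := by simp
  continuous_toFun := continuous_comp e.hom
  continuous_invFun := continuous_comp e.inv

/-- Open immersions induce inducing maps of real points. -/
lemma isInducing_comp (j : X ⟶ Y) [IsOpenImmersion j.left] :
    Topology.IsInducing fun x : RealPoint X ↦ (x ≫ j : RealPoint Y) := by
  refine ⟨le_antisymm (continuous_comp j).le_induced ?_⟩
  refine le_generateFrom ?_
  rintro _ ⟨U, f, V, hV, rfl⟩
  obtain ⟨g, rfl⟩ := (ConcreteCategory.bijective_of_isIso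
    (j.left.appIso U).hom).2 f
  refine ⟨_, isOpen_eval (X := Y) (j.left ''ᵁ U) g hV, ?_⟩
  ext x
  have e : (j.left ⁻¹ᵁ j.left ''ᵁ U) = U := j.left.preimage_image_eq U
  have he (h : ⊤ ≤ x.left ⁻¹ᵁ U) : x.eval U h ((j.left.appIso U).hom g) =
      RealPoint.eval (X := Y) (x ≫ j) (j.left ''ᵁ U)
        (h.trans (x.left.preimage_mono e.ge)) g := by
    rw [RealPoint.eval_comp _ _ _ (h.trans (x.left.preimage_mono e.ge)), Scheme.Hom.appIso_hom]
    exact RealPoint.eval_map x e.ge h (j.left.app _ g)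
  refine ⟨fun ⟨h, h'⟩ ↦ ?_, fun ⟨h, h'⟩ ↦ ⟨h.trans (x.left.preimage_mono e.ge), ?_⟩⟩
  · have h2 : ⊤ ≤ x.left ⁻¹ᵁ U := le_trans (show ⊤ ≤ x.left ⁻¹ᵁ (j.left ⁻¹ᵁ j.left ''ᵁ U) from h) (x.left.preimage_mono e.le)
    exact ⟨h2, by rw [he]; exact h'⟩
  · rw [he] at h'; exact h'

/-- A map to the real points of an affine open is continuous if the values of all functions are. -/
lemma continuous_of_eval {P : Type} [TopologicalSpace P] {ψ : P → RealPoint X}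
    {W : X.left.Opens} (hW : IsAffineOpen W) (h : ∀ p, ⊤ ≤ (ψ p).left ⁻¹ᵁ W)
    (hc : ∀ f : Γ(X.left, W), Continuous fun p ↦ (ψ p).eval W (h p) f) : Continuous ψ := by
  refine continuous_generateFrom_iff.2 ?_
  rintro _ ⟨U, f, V, hV, rfl⟩
  rw [isOpen_iff_mem_nhds]
  rintro p ⟨hp, hpV⟩
  have hpU : (ψ p).pt ∈ U := (RealPoint.le_iff _ _).1 hp
  obtain ⟨g, hgU, hg⟩ := hW.exists_basicOpen_le ⟨(ψ p).pt, hpU⟩ ((RealPoint.le_iff _ _).1 (h p))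
  have hgW : X.left.basicOpen g ≤ W := X.left.basicOpen_le g
  have := hW.isLocalization_basicOpen g
  -- Near the point `f` is a fraction `a / g ^ n` of functions on `W`, so its values vary
  -- continuously.
  obtain ⟨⟨a, ⟨_, n, rfl⟩⟩, ha⟩ := IsLocalization.surj (Submonoid.powers g)
    (X.left.presheaf.map (homOfLE hgU).op f)
  have key (q : P) (hq : (ψ q).eval W (h q) g ≠ 0) : ∃ h' : ⊤ ≤ (ψ q).left ⁻¹ᵁ U,
      (ψ q).eval U h' f = (ψ q).eval W (h q) a / (ψ q).eval W (h q) g ^ n := by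
    have h1 := ((ψ q).mem_basicOpen_iff (h q) g).2 hq
    refine ⟨h1.trans ((ψ q).left.preimage_mono hgU), ?_⟩
    rw [eq_div_iff (pow_ne_zero _ hq), ← RealPoint.eval_map _ hgU h1]
    have h2 := congrArg ((ψ q).evalHom _ h1) ha
    rw [map_mul] at h2
    have h3 (b : Γ(X.left, W)) : (ψ q).evalHom _ h1 (algebraMap _ _ b) = (ψ q).eval W (h q) b :=
      RealPoint.eval_map _ hgW h1 b
    rw [h3, h3] at h2
    have h4 : (ψ q).eval W (h q) (g ^ n) = (ψ q).eval W (h q) g ^ n :=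
      map_pow ((ψ q).evalHom W (h q)) g n
    rw [h4] at h2
    exact h2
  have hg0 : (ψ p).eval W (h p) g ≠ 0 :=
    ((ψ p).mem_basicOpen_iff (h p) g).1 (((ψ p).le_iff _).2 hg)
  obtain ⟨h', e⟩ := key p hg0
  have hcont : ContinuousAt (fun q ↦ (ψ q).eval W (h q) a / (ψ q).eval W (h q) g ^ n) p :=
    (hc a).continuousAt.div ((hc g).continuousAt.pow n) (pow_ne_zero _ hg0)
  have n1 := hcont.preimage_mem_nhds (hV.mem_nhds (by rw [← e]; exact hpV))
  have n2 := (hc g).continuousAt.preimage_mem_nhds (isOpen_ne.mem_nhds hg0)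
  filter_upwards [n1, n2] with q hq1 hq2
  obtain ⟨h', e⟩ := key q hq2
  exact ⟨h', by rw [e]; exact hq1⟩

/-- Real points in a common affine open are separated by its functions. -/
lemma RealPoint.ext_of_eval {x y : RealPoint X} {W : X.left.Opens} (hW : IsAffineOpen W)
    (hx : ⊤ ≤ x.left ⁻¹ᵁ W) (hy : ⊤ ≤ y.left ⁻¹ᵁ W)
    (h : ∀ f, x.eval W hx f = y.eval W hy f) : x = y := by
  have e : x.left.appLE W ⊤ hx = y.left.appLE W ⊤ hy := by
    rw [← cancel_mono (Scheme.ΓSpecIso (CommRingCat.of ℝ)).hom]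
    ext f
    exact h f
  have hx' := hW.SpecMap_appLE_fromSpec x.left (isAffineOpen_top (Spec (CommRingCat.of ℝ))) hx
  have hy' := hW.SpecMap_appLE_fromSpec y.left (isAffineOpen_top (Spec (CommRingCat.of ℝ))) hy
  rw [e, hy', IsAffineOpen.fromSpec_top (X := Spec (CommRingCat.of ℝ))] at hx'
  replace hx' := (cancel_epi (Spec (CommRingCat.of ℝ)).isoSpec.inv).1 hx'
  exact Over.OverMorphism.ext hx'.symm

/-- Distinct points of an affine open are separated by a regular function, whose values have
disjoint neighbourhoods in `ℝ`. -/
lemma t2Space_of_isAffineOpen (h : ∀ x y : RealPoint X, ∃ W : X.left.Opens, IsAffineOpen W ∧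
    ⊤ ≤ x.left ⁻¹ᵁ W ∧ ⊤ ≤ y.left ⁻¹ᵁ W) : T2Space (RealPoint X) := by
  refine ⟨fun x y hxy ↦ ?_⟩
  obtain ⟨W, hW, hx, hy⟩ := h x y
  obtain ⟨f, hf⟩ : ∃ f, x.eval W hx f ≠ y.eval W hy f := by
    by_contra! h'
    exact hxy (RealPoint.ext_of_eval hW hx hy h')
  obtain ⟨u, v, hu, hv, hxu, hyv, huv⟩ := t2_separation hf
  refine ⟨_, _, isOpen_eval W f hu, isOpen_eval W f hv, ⟨hx, hxu⟩, ⟨hy, hyv⟩, ?_⟩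
  rw [Set.disjoint_left]
  rintro z ⟨h1, h2⟩ ⟨_, h3⟩
  exact Set.disjoint_left.1 huv h2 h3

end RealPoints

/-! ### Blowing-ups at conjugate pairs and real points -/

section Blowup

attribute [local instance] euclideanTopology

variable {X Y : RealScheme}

/-- Every `g` satisfies, at the complex point, the real quadratic equation of `φ g`. If the real
point specializes the complex one, `ε g` is a real root of this quadratic, which forces `φ g` to be
real. -/
lemma comp_conj_eq {A : Type} [CommRing A] (κ : ℝ →+* A) (φ : A →+* ℂ) (ε : A →+* ℝ)
    (hφ : φ.comp κ = algebraMap ℝ ℂ) (hε : ε.comp κ = RingHom.id ℝ)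
    (h : RingHom.ker φ ≤ RingHom.ker ε) : (starRingEnd ℂ).comp φ = φ := by
  ext g
  have hφ' (r : ℝ) : φ (κ r) = r := congr($hφ r)
  have hε' (r : ℝ) : ε (κ r) = r := congr($hε r)
  set α := φ g with hα
  -- The quadratic with roots `α` and its conjugate, evaluated at `g`.
  have h1 : g ^ 2 - κ (2 * α.re) * g + κ (α.re ^ 2 + α.im ^ 2) ∈ RingHom.ker φ := by
    rw [RingHom.mem_ker, map_add, map_sub, map_mul, map_pow, hφ', hφ', ← hα]
    apply Complex.ext <;> simp [pow_two] <;> ring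
  have h2 := h h1
  rw [RingHom.mem_ker, map_add, map_sub, map_mul, map_pow, hε', hε'] at h2
  have h3 : α.im ^ 2 = 0 := by nlinarith [sq_nonneg (ε g - α.re), sq_nonneg α.im]
  exact Complex.conj_eq_iff_im.2 (pow_eq_zero_iff two_ne_zero |>.1 h3)

/-- A real point in the closure would specialize the complex point. In an affine neighbourhood this
is an inclusion of kernels, and `comp_conj_eq` would make the complex point self-conjugate. -/
lemma IsNonreal.pt_notMem {p : ComplexPoint Y} (hp : p.IsNonreal) (y : RealPoint Y) :
    y.pt ∉ closure (Set.range p.left) := by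
  intro hy
  obtain ⟨W, hW, hyW, -⟩ := exists_isAffineOpen_mem_and_subset
    (U := (⊤ : Y.left.Opens)) (x := y.pt) trivial
  have hrW : Set.range hW.fromSpec = W := hW.range_fromSpec
  obtain ⟨_, hz, q, rfl⟩ := mem_closure_iff.1 hy W W.2 hyW
  have hpr : Set.range p.left ⊆ Set.range hW.fromSpec := by
    rw [hrW]
    rintro _ ⟨r, rfl⟩
    rwa [show r = q from Subsingleton.elim (α := PrimeSpectrum ℂ) _ _]
  have hyr : Set.range y.left ⊆ Set.range hW.fromSpec := by
    rw [hrW]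
    rintro _ ⟨r, rfl⟩
    rwa [show r = specPt ℝ from Subsingleton.elim (α := PrimeSpectrum ℝ) _ _]
  let p' : Spec (CommRingCat.of ℂ) ⟶ Spec Γ(Y.left, W) := IsOpenImmersion.lift hW.fromSpec p.left hpr
  let y' : Spec (CommRingCat.of ℝ) ⟶ Spec Γ(Y.left, W) := IsOpenImmersion.lift hW.fromSpec y.left hyr
  have hp' : p' ≫ hW.fromSpec = p.left := IsOpenImmersion.lift_fac _ _ _
  have hy' : y' ≫ hW.fromSpec = y.left := IsOpenImmersion.lift_fac _ _ _
  obtain ⟨φ, hφ⟩ := Spec.map_surjective p'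
  obtain ⟨ε, hε⟩ := Spec.map_surjective y'
  obtain ⟨κ, hκ⟩ := Spec.map_surjective (hW.fromSpec ≫ Y.hom)
  have e1 : κ ≫ φ = CommRingCat.ofHom (algebraMap ℝ ℂ) := by
    apply Spec.map_injective
    rw [Spec.map_comp, hφ, hκ, reassoc_of% hp']
    exact Over.w p
  have e2 : κ ≫ ε = 𝟙 _ := by
    apply Spec.map_injective
    rw [Spec.map_comp, hε, hκ, reassoc_of% hy', Spec.map_id]
    exact Over.w y
  have hle : RingHom.ker φ.hom ≤ RingHom.ker ε.hom := by
    have hcl : y' (specPt ℝ) ∈ closure {p' (specPt ℂ)} := by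
      have hi := hW.fromSpec.isOpenEmbedding.isInducing
      rw [hi.closure_eq_preimage_closure_image, Set.image_singleton]
      change (y' ≫ hW.fromSpec) (specPt ℝ) ∈ closure {(p' ≫ hW.fromSpec) (specPt ℂ)}
      rw [hy', hp']
      refine (congrArg (fun S ↦ y.pt ∈ closure S) ?_).mpr hy
      ext z
      constructor
      · rintro rfl; exact ⟨_, rfl⟩
      · rintro ⟨r, rfl⟩
        rw [show r = specPt ℂ from Subsingleton.elim (α := PrimeSpectrum ℂ) _ _]; rfl
    have hs : p' (specPt ℂ) ⤳ y' (specPt ℝ) := specializes_iff_mem_closure.2 hcl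
    have hs' := (PrimeSpectrum.le_iff_specializes _ _).2 hs
    rw [← hφ, ← hε] at hs'
    intro a ha
    have h3 : a ∈ (Spec.map φ (specPt ℂ)).asIdeal := by
      change φ.hom a ∈ (⊥ : Ideal ℂ)
      exact ha
    exact hs' h3
  have hconj := comp_conj_eq κ.hom φ.hom ε.hom (congrArg CommRingCat.Hom.hom e1)
    (congrArg CommRingCat.Hom.hom e2) hle
  apply hp
  rw [← hp', ← hφ, ← Category.assoc, ← Spec.map_comp]
  congr 2
  exact CommRingCat.hom_ext hconj

lemma isInvertibleIdeal_top {Z : Scheme.{0}} : IsInvertibleIdeal (⊤ : Z.IdealSheafData) := by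
  intro z
  obtain ⟨W, hW, hz, -⟩ := exists_isAffineOpen_mem_and_subset (U := (⊤ : Z.Opens)) (x := z) trivial
  exact ⟨⟨W, hW⟩, hz, 1, one_mem _, by simp⟩

lemma isInvertibleIdeal_comap {Z Y : Scheme.{0}} {I : Y.IdealSheafData} (g : Z ⟶ Y)
    (h : ∀ z, g z ∉ I.support) : IsInvertibleIdeal (I.comap g) := by
  have : I.comap g = ⊤ := by
    rw [← Scheme.IdealSheafData.support_eq_bot_iff, Scheme.IdealSheafData.support_comap]
    ext z
    simpa using h z
  rw [this]
  exact isInvertibleIdeal_top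

/-- Blowing up a pair of conjugate points does not change the set of real points. -/
lemma IsBlowupAtConjugatePair.nonempty_homeomorph {π : X ⟶ Y} (h : IsBlowupAtConjugatePair π) :
    Nonempty (RealPoint X ≃ₜ RealPoint Y) := by
  obtain ⟨p, hp, hb⟩ := h
  have hqc : QuasiCompact p.left :=
    ⟨fun _ _ _ ↦ (Set.toFinite (α := PrimeSpectrum ℂ) _).isCompact⟩
  have hs : (p.left.ker.support : Set Y.left) = closure (Set.range p.left) :=
    Scheme.Hom.support_ker _
  have hreal (y : RealPoint Y) : y.pt ∉ p.left.ker.support := by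
    rw [← SetLike.mem_coe, hs]
    exact IsNonreal.pt_notMem hp y
  let U : Y.left.Opens := p.left.ker.support.compl
  have hU (z : Y.left) : z ∈ U ↔ z ∉ p.left.ker.support := Iff.rfl
  let UR : RealScheme := Over.mk (U.ι ≫ Y.hom)
  let ι : UR ⟶ Y := Over.homMk U.ι rfl
  have : IsOpenImmersion ι.left := inferInstanceAs (IsOpenImmersion U.ι)
  -- Off the centre the ideal is the unit ideal, so the universal property gives a section over the
  -- complement `U`, through which all real points factor.
  obtain ⟨σ₀, hσ₀, -⟩ := hb.existsUnique_lift _ U.ι (isInvertibleIdeal_comap _ fun z ↦ z.2)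
  let σ : UR ⟶ X := Over.homMk σ₀ (by
    rw [← Over.w π, reassoc_of% hσ₀]; rfl)
  have hσ : σ ≫ π = ι := Over.OverMorphism.ext hσ₀
  have hlift (y : RealPoint Y) : ∃ z : RealPoint UR, z ≫ ι = y := by
    have hr : Set.range y.left ⊆ Set.range U.ι := by
      rw [Scheme.Opens.range_ι]
      rintro _ ⟨r, rfl⟩
      rw [show r = specPt ℝ from Subsingleton.elim (α := PrimeSpectrum ℝ) _ _]
      exact hreal y
    have hk := IsOpenImmersion.lift_fac U.ι y.left hr
    exact ⟨Over.homMk (IsOpenImmersion.lift U.ι y.left hr) (by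
      change _ ≫ U.ι ≫ Y.hom = _
      rw [reassoc_of% hk]
      exact Over.w y), Over.OverMorphism.ext hk⟩
  choose l hl using hlift
  have hlc : Continuous l := by
    rw [(isInducing_comp ι).continuous_iff]
    exact continuous_id.congr fun y ↦ (hl y).symm
  refine ⟨⟨⟨fun x ↦ x ≫ π, fun y ↦ l y ≫ σ, fun x ↦ ?_, fun y ↦ ?_⟩, continuous_comp π,
    (continuous_comp σ).comp hlc⟩⟩
  · have h1 : (l (x ≫ π) ≫ σ) ≫ π = x ≫ π := by rw [Category.assoc, hσ, hl]
    -- The image of a real point avoids the centre, so uniqueness of lifts applies to the real point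
    -- itself and gives the left inverse.
    have hinv : IsInvertibleIdeal (p.left.ker.comap (x ≫ π).left) :=
      isInvertibleIdeal_comap _ fun z ↦ by
        rw [show z = specPt ℝ from Subsingleton.elim (α := PrimeSpectrum ℝ) _ _]
        exact hreal (x ≫ π)
    obtain ⟨k, -, hk⟩ := hb.existsUnique_lift _ _ hinv
    exact Over.OverMorphism.ext
      ((hk _ (congrArg Over.Hom.left h1)).trans (hk x.left rfl).symm)
  · change (l y ≫ σ) ≫ π = y
    rw [Category.assoc, hσ, hl]

end Blowup

/-! ### Real points of projective space -/

section ProjectiveSpace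

attribute [local instance] euclideanTopology

variable {n : ℕ}

/-- The real point `y` of projective space has homogeneous coordinates `v`. -/
def HasCoords (y : RealPoint (realProjSpace n)) (v : Fin (n + 1) → ℝ) : Prop :=
  ∃ hv : ∃ i, IsUnit (v i), y.left = projPt (RingHom.id ℝ) v hv

lemma exists_hasCoords (y : RealPoint (realProjSpace n)) : ∃ v, HasCoords y v := by
  obtain ⟨v, hv, h⟩ := exists_eq_projPt (σ := RingHom.id ℝ) (p := y.left) (by
    rw [CommRingCat.ofHom_id, Spec.map_id]; exact Over.w y)
  exact ⟨v, hv, h⟩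

/-- Both vectors are nonzero at a common index `i`. The ratios `x_j / x_i` are functions on that
chart, so they agree. -/
lemma HasCoords.eq_smul {y : RealPoint (realProjSpace n)} {v w : Fin (n + 1) → ℝ}
    (hv : HasCoords y v) (hw : HasCoords y w) : ∃ u : ℝ, ∀ i, w i = u * v i := by
  obtain ⟨hv, h⟩ := hv
  obtain ⟨hw, h'⟩ := hw
  rw [h] at h'
  obtain ⟨i, hi⟩ := hv
  have h1 := (mem_range_chartX_iff (σ := RingHom.id ℝ) ⟨i, hi⟩ (specPt ℝ) i).2 hi.ne_zero
  rw [h'] at h1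
  have hwi : IsUnit (w i) := ((mem_range_chartX_iff hw (specPt ℝ) i).1 h1).isUnit
  rw [projPt_eq i hi, projPt_eq i hwi] at h'
  replace h' := (cancel_mono (chartX (A := ℝ) i)).1 h'
  have h2 : evalX (RingHom.id ℝ) v i hi = evalX (RingHom.id ℝ) w i hwi :=
    congrArg CommRingCat.Hom.hom (Spec.map_injective h')
  refine ⟨w i / v i, fun j ↦ ?_⟩
  have e1 := evalX_mk (RingHom.id ℝ) v i hi 1 (MvPolynomial.X j) (by rw [one_smul]; exact X_mem j)
  have e2 := evalX_mk (RingHom.id ℝ) w i hwi 1 (MvPolynomial.X j) (by rw [one_smul]; exact X_mem j)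
  rw [← h2, pow_one, MvPolynomial.eval₂_X] at e2
  rw [pow_one, MvPolynomial.eval₂_X] at e1
  rw [← e1, ← e2, mul_comm (evalX _ _ _ _ _) (v i), ← mul_assoc, div_mul_cancel₀ _ hi.ne_zero,
    mul_comm]

lemma HasCoords.ext {y z : RealPoint (realProjSpace n)} {v w : Fin (n + 1) → ℝ}
    (hv : HasCoords y v) (hw : HasCoords z w) (u : ℝ) (h : ∀ i, w i = u * v i) : y = z := by
  obtain ⟨hv, e⟩ := hv
  obtain ⟨hw, e'⟩ := hw
  exact Over.OverMorphism.ext (e.trans ((projPt_smul u hv hw h).symm.trans e'.symm))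

lemma exists_isAffineOpen_chartX (i : Fin (n + 1)) (α : projSpace n ℝ ≅ projSpace n ℝ) :
    ∃ W : (realProjSpace n).left.Opens, IsAffineOpen W ∧ ∀ y : RealPoint (realProjSpace n),
      (y.left ≫ α.hom) (specPt ℝ) ∈ Set.range (chartX (A := ℝ) i) → ⊤ ≤ y.left ⁻¹ᵁ W := by
  let j : Spec (.of (awayX n ℝ i)) ⟶ projSpace n ℝ := chartX i ≫ α.inv
  refine ⟨j.opensRange, isAffineOpen_opensRange j, fun y hy ↦ ?_⟩
  refine (RealPoint.le_iff (X := realProjSpace n) y _).2 ?_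
  obtain ⟨q, hq⟩ := hy
  refine ⟨q, ?_⟩
  change α.inv (chartX i q) = _
  rw [hq]
  change (α.hom ≫ α.inv) (y.left (specPt ℝ)) = _
  rw [α.hom_inv_id]
  rfl

lemma mem_range_chartX_of_linIso (M N : Matrix (Fin (n + 1)) (Fin (n + 1)) ℝ) (h : N * M = 1)
    (h' : M * N = 1) {v : Fin (n + 1) → ℝ} (hv : ∃ i, IsUnit (v i)) {i : Fin (n + 1)}
    (hi : ∑ k, RingHom.id ℝ (M i k) * v k ≠ 0) :
    (projPt (RingHom.id ℝ) v hv ≫ (linIso M N h h').hom) (specPt ℝ) ∈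
      Set.range (chartX (A := ℝ) i) := by
  rw [projPt_linIso M N h h' hv ⟨i, hi.isUnit⟩]
  exact (mem_range_chartX_iff _ (specPt ℝ) i).2 hi

/-- Any two real points lie in the complement of a common hyperplane. If no coordinate is nonzero at
both, then `v` and `w` are nonzero at different indices `i` and `j`, and the form `x_i + x_j` is
nonzero at both points; a transvection makes this form a coordinate. -/
instance t2Space_realProjSpace : T2Space (RealPoint (realProjSpace n)) := by
  refine t2Space_of_isAffineOpen fun y z ↦ ?_
  obtain ⟨v, hv, hy⟩ := exists_hasCoords y
  obtain ⟨w, hw, hz⟩ := exists_hasCoords z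
  have key (i : Fin (n + 1)) (hi : v i ≠ 0) (hi' : w i ≠ 0) : ∃ W : (realProjSpace n).left.Opens,
      IsAffineOpen W ∧ ⊤ ≤ y.left ⁻¹ᵁ W ∧ ⊤ ≤ z.left ⁻¹ᵁ W := by
    obtain ⟨W, hW, h⟩ := exists_isAffineOpen_chartX i (Iso.refl _)
    refine ⟨W, hW, h y ?_, h z ?_⟩
    · rw [hy]
      exact (mem_range_chartX_iff hv (specPt ℝ) i).2 hi
    · rw [hz]
      exact (mem_range_chartX_iff hw (specPt ℝ) i).2 hi'
  obtain ⟨i, hi⟩ := id hv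
  obtain ⟨j, hj⟩ := id hw
  by_cases hwi : w i = 0
  swap
  · exact key i hi.ne_zero hwi
  by_cases hvj : v j = 0
  swap
  · exact key j hvj hj.ne_zero
  have hij : i ≠ j := by
    rintro rfl
    exact hj.ne_zero hwi
  have hT (c d : ℝ) (h : c + d = 0) :
      Matrix.transvection i j c * Matrix.transvection i j d = 1 := by
    rw [Matrix.transvection_mul_transvection_same _ _ hij, h, Matrix.transvection_zero]
  have hM (v : Fin (n + 1) → ℝ) :
      ∑ k, RingHom.id ℝ (Matrix.transvection i j 1 i k) * v k = v i + v j := by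
    simp [Matrix.transvection, Matrix.one_apply, Matrix.single_apply, add_mul,
      Finset.sum_add_distrib]
  obtain ⟨W, hW, h⟩ := exists_isAffineOpen_chartX i
    (linIso (Matrix.transvection i j 1) (Matrix.transvection i j (-1)) (hT _ _ (by ring))
      (hT _ _ (by ring)))
  have hv1 : v i + v j ≠ 0 := by rw [hvj, add_zero]; exact hi.ne_zero
  have hw1 : w i + w j ≠ 0 := by rw [hwi, zero_add]; exact hj.ne_zero
  refine ⟨W, hW, h y ?_, h z ?_⟩
  · rw [hy]
    exact mem_range_chartX_of_linIso _ _ _ _ _ (by rw [hM]; exact hv1)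
  · rw [hz]
    exact mem_range_chartX_of_linIso _ _ _ _ _ (by rw [hM]; exact hw1)

/-- Real points of projective schemes are determined by their homogeneous coordinates. -/
lemma injective_comp {X Y : RealScheme} (f : X ⟶ Y) [Mono f.left] :
    Function.Injective fun x : RealPoint X ↦ (x ≫ f : RealPoint Y) := fun _ _ h ↦
  Over.OverMorphism.ext ((cancel_mono f.left).1 (congrArg Over.Hom.left h))

lemma t2Space_of_isClosedImmersion {X : RealScheme} (f : X ⟶ realProjSpace n) [Mono f.left] :
    T2Space (RealPoint X) :=
  T2Space.of_injective_continuous (injective_comp f) (continuous_comp f)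

/-- A map to the real points of a projective scheme is continuous if it is locally equal to
continuous maps with the same homogeneous coordinates. -/
lemma exists_continuous_of_local {P : Type} [TopologicalSpace P] {X : RealScheme}
    (f : X ⟶ realProjSpace n) [Mono f.left] (V : P → Fin (n + 1) → ℝ)
    (h : ∀ p, ∃ O : Set P, IsOpen O ∧ p ∈ O ∧ ∃ ψ : O → RealPoint X, Continuous ψ ∧
      ∀ q, HasCoords (ψ q ≫ f) (V q)) :
    ∃ ψ : P → RealPoint X, Continuous ψ ∧ ∀ q, HasCoords (ψ q ≫ f) (V q) := by
  have h' (p : P) : ∃ y : RealPoint X, HasCoords (y ≫ f) (V p) := by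
    obtain ⟨O, -, hp, ψ, -, hψ⟩ := h p
    exact ⟨_, hψ ⟨p, hp⟩⟩
  choose ψ hψ using h'
  refine ⟨ψ, continuous_iff_continuousAt.2 fun p ↦ ?_, hψ⟩
  obtain ⟨O, hO, hp, ψ', hc, hψ'⟩ := h p
  -- Homogeneous coordinates determine the point, so the pointwise choice agrees with the local
  -- continuous maps.
  have e : O.domRestrict ψ = ψ' := by
    funext q
    exact injective_comp f ((hψ q).ext (hψ' q) 1 fun i ↦ (one_mul _).symm)
  have hcont : ContinuousOn ψ O := by
    rw [continuousOn_iff_continuous_domRestrict, e]; exact hc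
  exact hcont.continuousAt (hO.mem_nhds hp)

end ProjectiveSpace

/-! ### Real points of charts -/

section ChartPoints

attribute [local instance] euclideanTopology

variable {K : Type} [Field K] [Algebra ℝ K]

/-- The spectrum of `rng s` as a real scheme. -/
def specRng (s : Set K) : RealScheme := Over.mk (Spec.map (CommRingCat.ofHom (rngC s)))

/-- The real point given by a homomorphism of `ℝ`-algebras. -/
def rngPt {s : Set K} (φ : rng s →+* ℝ) (hφ : φ.comp (rngC s) = RingHom.id ℝ) :
    RealPoint (specRng s) :=
  Over.homMk (Spec.map (CommRingCat.ofHom φ)) (by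
    change Spec.map _ ≫ Spec.map _ = 𝟙 _
    rw [← Spec.map_comp, ← CommRingCat.ofHom_comp, hφ, CommRingCat.ofHom_id, Spec.map_id])

lemma rngPt_eval {s : Set K} (φ : rng s →+* ℝ) (hφ : φ.comp (rngC s) = RingHom.id ℝ)
    (h : ⊤ ≤ (rngPt φ hφ).left ⁻¹ᵁ ⊤) (f : Γ(Spec (CommRingCat.of (rng s)), ⊤)) :
    (rngPt φ hφ).eval ⊤ h f = φ ((Scheme.ΓSpecIso (CommRingCat.of (rng s))).hom f) := by
  have e := Scheme.ΓSpecIso_naturality (CommRingCat.ofHom φ)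
  have e1 : (Spec.map (CommRingCat.ofHom φ)).appLE ⊤ ⊤ h = (Spec.map (CommRingCat.ofHom φ)).appTop :=
    Scheme.Hom.appLE_eq_app _
  rw [← e1] at e
  exact congr($e f)

/-- Values on the generators suffice: the functions whose values vary continuously form an
`ℝ`-algebra. -/
lemma continuous_rngPt {P : Type} [TopologicalSpace P] {s : Set K} (φ : P → (rng s →+* ℝ))
    (hφ : ∀ p, (φ p).comp (rngC s) = RingHom.id ℝ)
    (hs : ∀ (a : K) (ha : a ∈ s), Continuous fun p ↦ φ p ⟨a, mem_rng ha⟩) :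
    Continuous fun p ↦ rngPt (φ p) (hφ p) := by
  have key (a : rng s) : Continuous fun p ↦ φ p a := by
    induction a using rng_induction with
    | hs a ha => exact hs a ha
    | hC r =>
      have e : (fun p ↦ φ p (rngC s r)) = fun _ ↦ r := by
        funext p
        exact congr($(hφ p) r)
      rw [e]
      exact continuous_const
    | hadd a b ha hb => exact (ha.add hb).congr fun p ↦ (map_add (φ p) a b).symm
    | hmul a b ha hb => exact (ha.mul hb).congr fun p ↦ (map_mul (φ p) a b).symm
  refine continuous_of_eval (X := specRng s) (W := ⊤)
    (isAffineOpen_top (Spec (CommRingCat.of (rng s)))) (fun _ ↦ le_top) fun f ↦ ?_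
  exact (key _).congr fun p ↦ (rngPt_eval (φ p) (hφ p) le_top f).symm

/-- A chart as a morphism of real schemes. -/
def chartHom {X : RealScheme} {η : Spec (.of K) ⟶ X.left} (hη : IsRealPt η) {s : Set K}
    {c : Spec (.of (rng s)) ⟶ X.left} (hc : IsChart η (rng s) c) : specRng s ⟶ X :=
  Over.homMk c (hη.chart_comp hc)

lemma exists_eq_rngPt {X : RealScheme} {η : Spec (.of K) ⟶ X.left} (hη : IsRealPt η) {s : Set K}
    {c : Spec (.of (rng s)) ⟶ X.left} (hc : IsChart η (rng s) c) (y : RealPoint X)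
    (hy : y.pt ∈ Set.range c) : ∃ φ hφ, y = rngPt φ hφ ≫ chartHom hη hc := by
  have := hc.1
  have hr : Set.range y.left ⊆ Set.range c := by
    rintro _ ⟨r, rfl⟩
    rwa [show r = specPt ℝ from Subsingleton.elim (α := PrimeSpectrum ℝ) _ _]
  have hk := IsOpenImmersion.lift_fac c y.left hr
  obtain ⟨φ, hφ⟩ := Spec.map_surjective (R := .of (rng s)) (S := .of ℝ)
    (IsOpenImmersion.lift c y.left hr)
  rw [← hφ] at hk
  refine ⟨φ.hom, ?_, Over.OverMorphism.ext hk.symm⟩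
  have h1 : CommRingCat.ofHom (rngC s) ≫ φ = 𝟙 (CommRingCat.of ℝ) := by
    apply Spec.map_injective
    rw [Spec.map_comp, ← hη.chart_comp hc, reassoc_of% hk, Spec.map_id]
    exact Over.w y
  exact congrArg CommRingCat.Hom.hom h1

variable {n : ℕ} {w : Fin (n + 1) → K} {hw : ∃ i, IsUnit (w i)}

/-- After division by the common factor `u` the coordinates lie in the chart ring, one of them being
a unit. They then describe the embedding on the whole chart, because they do so generically. -/
lemma IsChart.comp_projModelι {s : Set K} {c : Spec (.of (rng s)) ⟶ (projModel w hw).left}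
    (hc : IsChart (projModelPt w hw) (rng s) c) {w' : Fin (n + 1) → rng s}
    (hw' : ∃ i, IsUnit (w' i)) {u : K} (hu : ∀ j, w j = u * w' j) :
    c ≫ (projModelι w hw).left = projPt (rngC s) w' hw' := by
  have : (projSpace n ℝ).IsSeparated := inferInstance
  refine hom_ext_of_genPt (Y := projSpace n ℝ) ?_
  have e1 : genPt _ ≫ c ≫ (projModelι w hw).left = projPt (algebraMap ℝ K) w hw := by
    rw [reassoc_of% hc.2]
    exact projModelPt_ι w hw
  refine e1.trans ?_
  have hw'' : ∃ i, IsUnit ((rng s).subtype (w' i)) := by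
    obtain ⟨i, hi⟩ := hw'
    exact ⟨i, hi.map _⟩
  rw [genPt, specMap_projPt (rng s).subtype hw' hw'']
  exact projPt_smul u hw'' hw hu

lemma hasCoords_rngPt (hη : IsRealPt (X := projModel w hw) (projModelPt w hw)) {s : Set K}
    {c : Spec (.of (rng s)) ⟶ (projModel w hw).left}
    (hc : IsChart (projModelPt w hw) (rng s) c) {w' : Fin (n + 1) → rng s}
    (hw' : ∃ i, IsUnit (w' i)) {u : K} (hu : ∀ j, w j = u * w' j) (φ : rng s →+* ℝ)
    (hφ : φ.comp (rngC s) = RingHom.id ℝ) :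
    HasCoords ((rngPt φ hφ ≫ chartHom hη hc) ≫ projModelι w hw) fun j ↦ φ (w' j) := by
  have hw'' : ∃ i, IsUnit (φ (w' i)) := by
    obtain ⟨i, hi⟩ := hw'
    exact ⟨i, hi.map _⟩
  refine ⟨hw'', ?_⟩
  have e := specMap_projPt (σ := rngC s) φ hw' hw''
  rw [← hc.comp_projModelι hw' hu, hφ] at e
  exact (Category.assoc _ _ _).trans e

lemma HasCoords.smul {y : RealPoint (realProjSpace n)} {v w : Fin (n + 1) → ℝ}
    (h : HasCoords y v) {r : ℝ} (hr : r ≠ 0) (hw : ∀ j, w j = r * v j) : HasCoords y w := by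
  obtain ⟨⟨i, hi⟩, e⟩ := h
  have hwi : IsUnit (w i) := by rw [hw]; exact (hr.isUnit).mul hi
  exact ⟨⟨i, hwi⟩, e.trans (projPt_smul r ⟨i, hi⟩ ⟨i, hwi⟩ hw).symm⟩

/-- The map to the real points given by two continuous functions on a coordinate chart. -/
lemma exists_continuous_chart (hη : IsRealPt (X := projModel w hw) (projModelPt w hw)) {a b : K}
    (hab : Coords a b) {c : Spec (.of (rng {a, b})) ⟶ (projModel w hw).left}
    (hc : IsChart (projModelPt w hw) (rng {a, b}) c) {w' : Fin (n + 1) → rng {a, b}}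
    (hw' : ∃ i, IsUnit (w' i)) {u : K} (hu : ∀ j, w j = u * w' j)
    {P : Type} [TopologicalSpace P] {α β r : P → ℝ} (hα : Continuous α) (hβ : Continuous β)
    (hr : ∀ p, r p ≠ 0) {V : P → Fin (n + 1) → ℝ}
    (hV : ∀ p (φ : rng {a, b} →+* ℝ), φ (genL a b) = α p → φ (genR a b) = β p →
      ∀ j, V p j = r p * φ (w' j)) :
    ∃ ψ : P → RealPoint (projModel w hw), Continuous ψ ∧
      ∀ q, HasCoords (ψ q ≫ projModelι w hw) (V q) := by
  choose φ h1 h2 h3 using fun p ↦ hab.exists_hom (RingHom.id ℝ) (α p) (β p)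
  refine ⟨fun p ↦ rngPt (φ p) (h1 p) ≫ chartHom hη hc,
    (continuous_comp (chartHom hη hc)).comp (continuous_rngPt φ h1 ?_), fun p ↦
    (hasCoords_rngPt hη hc hw' hu (φ p) (h1 p)).smul (hr p) (hV p _ (h2 p) (h3 p))⟩
  rintro z (rfl | rfl)
  · exact hα.congr fun p ↦ (h2 p).symm
  · exact hβ.congr fun p ↦ (h3 p).symm

end ChartPoints

/-! ### Homogeneous parameters for the real points of 𝔽_d -/

section Parametrization

attribute [local instance] euclideanTopology

variable {K : Type} [Field K] [Algebra ℝ K]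

/-- The point of the Hirzebruch surface of degree `d` with coordinates `(t₀ : t₁)` on the base and
`(m : n)` on the fibre. -/
def pVec {R : Type} [CommRing R] (d : ℕ) (t₀ t₁ m n : R) : Fin (5 + 1) → R :=
  ![m * t₀, m * t₁, n * t₀ ^ (d + 1), n * t₀ ^ d * t₁, n * t₀ * t₁ ^ d, n * t₁ ^ (d + 1)]

lemma map_pVec {R S : Type} [CommRing R] [CommRing S] (φ : R →+* S) (d : ℕ) (t₀ t₁ m n : R) (j) :
    φ (pVec d t₀ t₁ m n j) = pVec d (φ t₀) (φ t₁) (φ m) (φ n) j := by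
  fin_cases j <;> simp [pVec]

/-- A chart of the Hirzebruch surface of degree `d`, with the homogeneous coordinates of its
points. -/
structure IsParamChart (d : ℕ) (t x a b : K) (t₀ t₁ m n : rng {a, b}) : Prop where
  coords : Coords a b
  exists_isChart : ∃ c, IsChart (hModelPt d t x) (rng {a, b}) c
  exists_isUnit : ∃ i, IsUnit (pVec d t₀ t₁ m n i)
  exists_eq : ∃ u : K, ∀ j, hVec d t x j = u * pVec d t₀ t₁ m n j

variable {t x : K}

lemma isRuledData_hModel (h : Coords t x) (d : ℕ) : IsRuledData t t⁻¹ x (t ^ d * x) :=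
  ⟨h, mul_inv_cancel₀ h.left_ne_zero, d, by simp⟩

/-- The parameters correspond to `t = t₁ / t₀` and `x = n t₀ ^ d / m`. Each of the four charts
normalizes one of `t₀`, `t₁` and one of `m`, `n` to 1. -/
lemma isParamChart_one (h : Coords t x) (d : ℕ) :
    IsParamChart d t x t x 1 (genL t x) 1 (genR t x) := by
  refine ⟨h, (isRuled_hModel h.left_ne_zero h.right_ne_zero d).isChart _ (by simp [ruledRings]),
    ⟨0, by simp [pVec]⟩, 1, fun j ↦ ?_⟩
  change _ = 1 * (rng {t, x}).subtype _
  rw [map_pVec]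
  fin_cases j <;> simp [pVec, hVec]

lemma isParamChart_two (h : Coords t x) (d : ℕ) :
    IsParamChart d t x t x⁻¹ 1 (genL t x⁻¹) (genR t x⁻¹) 1 := by
  have hx := h.right_ne_zero
  refine ⟨(isRuledData_hModel h d).inv.coords,
    (isRuled_hModel h.left_ne_zero h.right_ne_zero d).isChart _ (by simp [ruledRings]),
    ⟨2, by simp [pVec]⟩, x, fun j ↦ ?_⟩
  change _ = x * (rng {t, x⁻¹}).subtype _
  rw [map_pVec]
  fin_cases j <;> simp [pVec, hVec, hx]

lemma isParamChart_three (h : Coords t x) (d : ℕ) :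
    IsParamChart d t x t⁻¹ (t ^ d * x) (genL _ _) 1 1 (genR _ _) := by
  have ht := h.left_ne_zero
  refine ⟨(isRuledData_hModel h d).symm.coords,
    (isRuled_hModel h.left_ne_zero h.right_ne_zero d).isChart _ (by simp [ruledRings]),
    ⟨1, by simp [pVec]⟩, t, fun j ↦ ?_⟩
  change _ = t * (rng {t⁻¹, t ^ d * x}).subtype _
  rw [map_pVec]
  fin_cases j <;> simp [pVec, hVec, ht] <;> field_simp <;> ring

lemma isParamChart_four (h : Coords t x) (d : ℕ) :
    IsParamChart d t x t⁻¹ (t ^ d * x)⁻¹ (genL _ _) 1 (genR _ _) 1 := by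
  have ht := h.left_ne_zero
  have hx := h.right_ne_zero
  refine ⟨(isRuledData_hModel h d).symm.inv.coords,
    (isRuled_hModel h.left_ne_zero h.right_ne_zero d).isChart _ (by simp [ruledRings]),
    ⟨5, by simp [pVec]⟩, t * (t ^ d * x), fun j ↦ ?_⟩
  change _ = t * (t ^ d * x) * (rng {t⁻¹, (t ^ d * x)⁻¹}).subtype _
  rw [map_pVec]
  fin_cases j <;> simp [pVec, hVec] <;> field_simp <;> ring

/-- The embedding of `hModel` in projective space. -/
def hModelι (d : ℕ) (t x : K) : hModel d t x ⟶ realProjSpace 5 :=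
  projModelι (hVec d t x) (exists_isUnit_hVec d t x)

instance (d : ℕ) (t x : K) : IsClosedImmersion (hModelι d t x).left :=
  inferInstanceAs (IsClosedImmersion (projModelι (hVec d t x) (exists_isUnit_hVec d t x)).left)

lemma isRealPt_hModelPt (d : ℕ) (t x : K) : IsRealPt (X := hModel d t x) (hModelPt d t x) :=
  isRealPt_projModelPt _ _

namespace IsParamChart

variable {d : ℕ} {a b : K} {t₀ t₁ m n : rng {a, b}} (h : IsParamChart d t x a b t₀ t₁ m n)

include h

lemma exists_continuous {P : Type} [TopologicalSpace P] {α β r : P → ℝ} (hα : Continuous α)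
    (hβ : Continuous β) (hr : ∀ p, r p ≠ 0) {V : P → Fin (5 + 1) → ℝ}
    (hV : ∀ p (φ : rng {a, b} →+* ℝ), φ (genL a b) = α p → φ (genR a b) = β p →
      ∀ j, V p j = r p * pVec d (φ t₀) (φ t₁) (φ m) (φ n) j) :
    ∃ ψ : P → RealPoint (hModel d t x), Continuous ψ ∧
      ∀ q, HasCoords (ψ q ≫ hModelι d t x) (V q) := by
  obtain ⟨hab, ⟨c, hc⟩, hu, u, he⟩ := h
  exact exists_continuous_chart (isRealPt_hModelPt d t x) hab hc hu he hα hβ hr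
    fun p φ h1 h2 j ↦ by rw [map_pVec]; exact hV p φ h1 h2 j

lemma exists_hasCoords {c : Spec (.of (rng {a, b})) ⟶ (hModel d t x).left}
    (hc : IsChart (hModelPt d t x) (rng {a, b}) c) (y : RealPoint (hModel d t x))
    (hy : y.pt ∈ Set.range c) : ∃ φ : rng {a, b} →+* ℝ,
      HasCoords (y ≫ hModelι d t x) (pVec d (φ t₀) (φ t₁) (φ m) (φ n)) := by
  obtain ⟨hab, -, hu, u, he⟩ := h
  obtain ⟨φ, hφ, rfl⟩ := exists_eq_rngPt (isRealPt_hModelPt d t x) hc y hy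
  refine ⟨φ, ?_⟩
  have := hasCoords_rngPt (isRealPt_hModelPt d t x) hc hu he φ hφ
  simp only [map_pVec] at this
  exact this

end IsParamChart

/-- The parametrization of the real points. -/
lemma exists_continuous_pVec (h : Coords t x) (d : ℕ) {P : Type} [TopologicalSpace P]
    {t₀ t₁ m n : P → ℝ} (ht₀ : Continuous t₀) (ht₁ : Continuous t₁) (hm : Continuous m)
    (hn : Continuous n) (ht : ∀ p, t₀ p ≠ 0 ∨ t₁ p ≠ 0) (hmn : ∀ p, m p ≠ 0 ∨ n p ≠ 0) :
    ∃ ψ : P → RealPoint (hModel d t x), Continuous ψ ∧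
      ∀ q, HasCoords (ψ q ≫ hModelι d t x) (pVec d (t₀ q) (t₁ q) (m q) (n q)) := by
  refine exists_continuous_of_local (hModelι d t x)
    (fun q ↦ pVec d (t₀ q) (t₁ q) (m q) (n q)) fun p ↦ ?_
  have hO {f g : P → ℝ} (hf : Continuous f) (hg : Continuous g) :
      IsOpen {q | f q ≠ 0 ∧ g q ≠ 0} :=
    (isOpen_ne.preimage hf).inter (isOpen_ne.preimage hg)
  have hv {f : P → ℝ} (hf : Continuous f) (O : Set P) : Continuous fun q : O ↦ f q :=
    hf.comp continuous_subtype_val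
  obtain h0 | h0 := ht p <;> obtain h1 | h1 := hmn p
  · refine ⟨{q | t₀ q ≠ 0 ∧ m q ≠ 0}, hO ht₀ hm, ⟨h0, h1⟩, ?_⟩
    refine (isParamChart_one h d).exists_continuous (P := ↥{q | t₀ q ≠ 0 ∧ m q ≠ 0}) (α := fun q ↦ t₁ q / t₀ q)
      (β := fun q ↦ n q * t₀ q ^ d / m q) (r := fun q ↦ m q * t₀ q)
      ((hv ht₁ _).div (hv ht₀ _) fun q ↦ q.2.1)
      (((hv hn _).mul ((hv ht₀ _).pow d)).div (hv hm _) fun q ↦ q.2.2)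
      (fun q ↦ mul_ne_zero q.2.2 q.2.1) ?_
    rintro ⟨q, hq1 : t₀ q ≠ 0, hq2 : m q ≠ 0⟩ φ e1 e2 j
    rw [e1, e2, map_one]
    fin_cases j <;> simp [pVec, pow_succ, div_pow] <;> field_simp
  · refine ⟨{q | t₀ q ≠ 0 ∧ n q ≠ 0}, hO ht₀ hn, ⟨h0, h1⟩, ?_⟩
    refine (isParamChart_two h d).exists_continuous (P := ↥{q | t₀ q ≠ 0 ∧ n q ≠ 0}) (α := fun q ↦ t₁ q / t₀ q)
      (β := fun q ↦ m q / (n q * t₀ q ^ d)) (r := fun q ↦ n q * t₀ q ^ (d + 1))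
      ((hv ht₁ _).div (hv ht₀ _) fun q ↦ q.2.1)
      ((hv hm _).div ((hv hn _).mul ((hv ht₀ _).pow d))
        fun q ↦ mul_ne_zero q.2.2 (pow_ne_zero _ q.2.1))
      (fun q ↦ mul_ne_zero q.2.2 (pow_ne_zero _ q.2.1)) ?_
    rintro ⟨q, hq1 : t₀ q ≠ 0, hq2 : n q ≠ 0⟩ φ e1 e2 j
    rw [e1, e2, map_one]
    fin_cases j <;> simp [pVec, pow_succ, div_pow] <;> field_simp
  · refine ⟨{q | t₁ q ≠ 0 ∧ m q ≠ 0}, hO ht₁ hm, ⟨h0, h1⟩, ?_⟩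
    refine (isParamChart_three h d).exists_continuous (P := ↥{q | t₁ q ≠ 0 ∧ m q ≠ 0}) (α := fun q ↦ t₀ q / t₁ q)
      (β := fun q ↦ n q * t₁ q ^ d / m q) (r := fun q ↦ m q * t₁ q)
      ((hv ht₀ _).div (hv ht₁ _) fun q ↦ q.2.1)
      (((hv hn _).mul ((hv ht₁ _).pow d)).div (hv hm _) fun q ↦ q.2.2)
      (fun q ↦ mul_ne_zero q.2.2 q.2.1) ?_
    rintro ⟨q, hq1 : t₁ q ≠ 0, hq2 : m q ≠ 0⟩ φ e1 e2 j
    rw [e1, e2, map_one]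
    fin_cases j <;> simp [pVec, pow_succ, div_pow] <;> field_simp
  · refine ⟨{q | t₁ q ≠ 0 ∧ n q ≠ 0}, hO ht₁ hn, ⟨h0, h1⟩, ?_⟩
    refine (isParamChart_four h d).exists_continuous (P := ↥{q | t₁ q ≠ 0 ∧ n q ≠ 0}) (α := fun q ↦ t₀ q / t₁ q)
      (β := fun q ↦ m q / (n q * t₁ q ^ d)) (r := fun q ↦ n q * t₁ q ^ (d + 1))
      ((hv ht₀ _).div (hv ht₁ _) fun q ↦ q.2.1)
      ((hv hm _).div ((hv hn _).mul ((hv ht₁ _).pow d))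
        fun q ↦ mul_ne_zero q.2.2 (pow_ne_zero _ q.2.1))
      (fun q ↦ mul_ne_zero q.2.2 (pow_ne_zero _ q.2.1)) ?_
    rintro ⟨q, hq1 : t₁ q ≠ 0, hq2 : n q ≠ 0⟩ φ e1 e2 j
    rw [e1, e2, map_one]
    fin_cases j <;> simp [pVec, pow_succ, div_pow] <;> field_simp

lemma exists_hasCoords_pVec (h : Coords t x) (d : ℕ) (y : RealPoint (hModel d t x)) :
    ∃ t₀ t₁ m n : ℝ, (t₀ ≠ 0 ∨ t₁ ≠ 0) ∧ (m ≠ 0 ∨ n ≠ 0) ∧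
      HasCoords (y ≫ hModelι d t x) (pVec d t₀ t₁ m n) := by
  obtain ⟨B, hB, c, hc, hy⟩ :=
    (isRuled_hModel h.left_ne_zero h.right_ne_zero d).coveredBy y.pt
  obtain rfl | rfl | rfl | rfl := hB
  · obtain ⟨φ, e⟩ := (isParamChart_one h d).exists_hasCoords hc y hy
    exact ⟨_, _, _, _, Or.inl (by simp), Or.inl (by simp), e⟩
  · obtain ⟨φ, e⟩ := (isParamChart_three h d).exists_hasCoords hc y hy
    exact ⟨_, _, _, _, Or.inr (by simp), Or.inl (by simp), e⟩
  · obtain ⟨φ, e⟩ := (isParamChart_two h d).exists_hasCoords hc y hy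
    exact ⟨_, _, _, _, Or.inl (by simp), Or.inr (by simp), e⟩
  · obtain ⟨φ, e⟩ := (isParamChart_four h d).exists_hasCoords hc y hy
    exact ⟨_, _, _, _, Or.inr (by simp), Or.inr (by simp), e⟩

/-- Every real point has coordinates on the product of two circles. -/
lemma exists_hasCoords_circle (h : Coords t x) (d : ℕ) (y : RealPoint (hModel d t x)) :
    ∃ p : Circle × Circle, HasCoords (y ≫ hModelι d t x)
      (pVec d (p.1 : ℂ).re (p.1 : ℂ).im (p.2 : ℂ).re (p.2 : ℂ).im) := by
  obtain ⟨t₀, t₁, m, n, h1, h2, e⟩ := exists_hasCoords_pVec h d y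
  have key {a b : ℝ} (hab : a ≠ 0 ∨ b ≠ 0) : ∃ (z : Circle) (r : ℝ), r ≠ 0 ∧ (z : ℂ).re = r * a ∧
      (z : ℂ).im = r * b := by
    have h0 : (⟨a, b⟩ : ℂ) ≠ 0 := fun h0 ↦ by
      have := congrArg Complex.re h0
      have := congrArg Complex.im h0
      simp_all
    have hn : ‖(⟨a, b⟩ : ℂ)‖ ≠ 0 := norm_ne_zero_iff.2 h0
    have hc : ((‖(⟨a, b⟩ : ℂ)‖⁻¹ : ℝ) : ℂ) * ⟨a, b⟩ ∈ Submonoid.unitSphere ℂ := by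
      refine mem_sphere_zero_iff_norm.2 ?_
      rw [norm_mul, Complex.norm_real, norm_inv, norm_norm,
        inv_mul_cancel₀ hn]
    exact ⟨⟨_, hc⟩, ‖(⟨a, b⟩ : ℂ)‖⁻¹, inv_ne_zero hn, Complex.re_ofReal_mul _ _,
      Complex.im_ofReal_mul _ _⟩
  obtain ⟨z, r, hr, hz1, hz2⟩ := key h1
  -- Rescaling the base parameters by `r` must be compensated by `r ^ d` on `m`; then all six
  -- coordinates scale by `r ^ (d + 1)`.
  have h3 : r ^ d * m ≠ 0 ∨ n ≠ 0 := h2.imp_left (mul_ne_zero (pow_ne_zero _ hr))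
  obtain ⟨q, s, hs, hq1, hq2⟩ := key h3
  refine ⟨(z, q), e.smul (r := s * r ^ (d + 1)) (mul_ne_zero hs (pow_ne_zero _ hr)) fun j ↦ ?_⟩
  simp only [hz1, hz2, hq1, hq2]
  fin_cases j <;> simp [pVec] <;> ring

end Parametrization

/-! ### The torus and the Klein bottle as real loci -/

section Topology

attribute [local instance] euclideanTopology

/-- Two quotients of a compact space with the same fibres are homeomorphic if one of them is
Hausdorff. -/
lemma nonempty_homeomorph_of_fibres {P Q Y : Type} [TopologicalSpace P] [TopologicalSpace Q]
    [TopologicalSpace Y] [CompactSpace P] [T2Space Y] {Φ : P → Q} {ψ : P → Y}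
    (hΦ : Topology.IsQuotientMap Φ) (hψ : Continuous ψ) (hs : Function.Surjective ψ)
    (h : ∀ p p', Φ p = Φ p' ↔ ψ p = ψ p') : Nonempty (Y ≃ₜ Q) := by
  choose σ hσ using hΦ.surjective
  have hf (p : P) : ψ (σ (Φ p)) = ψ p := (h _ _).1 (hσ _)
  have hc : Continuous fun q ↦ ψ (σ q) := by
    rw [hΦ.continuous_iff]
    exact hψ.congr fun p ↦ (hf p).symm
  have hb : Function.Bijective fun q ↦ ψ (σ q) := by
    refine ⟨fun q q' hq ↦ ?_, fun y ↦ ?_⟩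
    · rw [← hσ q, ← hσ q']
      exact (h _ _).2 hq
    · obtain ⟨p, rfl⟩ := hs y
      exact ⟨Φ p, hf p⟩
  have : CompactSpace Q := hΦ.surjective.compactSpace hΦ.continuous
  exact ⟨(Continuous.homeoOfEquivCompactToT2 (f := Equiv.ofBijective _ hb) hc).symm⟩

lemma Circle.exists_sq_eq (z : Circle) : ∃ w : Circle, w ^ 2 = z := by
  obtain ⟨r, rfl⟩ : ∃ r : ℝ, Circle.exp r = z := ⟨_, Circle.exp_arg z⟩
  exact ⟨Circle.exp (r / 2), by rw [← Circle.exp_nsmul]; congr 1; rw [nsmul_eq_mul]; push_cast; ring⟩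

lemma Circle.re_sq_add_im_sq (z : Circle) : (z : ℂ).re ^ 2 + (z : ℂ).im ^ 2 = 1 := by
  have := Circle.normSq_coe z
  rw [Complex.normSq_apply] at this
  linarith

lemma Circle.ext_re_im {z w : Circle} (h : (z : ℂ).re = (w : ℂ).re) (h' : (z : ℂ).im = (w : ℂ).im) :
    z = w := Circle.ext (Complex.ext h h')

lemma Circle.ne_zero (z : Circle) : (z : ℂ).re ≠ 0 ∨ (z : ℂ).im ≠ 0 := by
  by_contra! h
  have := Circle.re_sq_add_im_sq z
  rw [h.1, h.2] at this
  norm_num at this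

lemma Circle.sq_re (z : Circle) : ((z ^ 2 : Circle) : ℂ).re = (z : ℂ).re ^ 2 - (z : ℂ).im ^ 2 := by
  rw [Circle.coe_pow, pow_two, Complex.mul_re]; ring

lemma Circle.sq_im (z : Circle) : ((z ^ 2 : Circle) : ℂ).im = 2 * ((z : ℂ).re * (z : ℂ).im) := by
  rw [Circle.coe_pow, pow_two, Complex.mul_im]; ring

lemma isQuotientMap_prod_sq :
    Topology.IsQuotientMap fun p : Circle × Circle ↦ (p.1 ^ 2, p.2 ^ 2) := by
  have hc : Continuous fun p : Circle × Circle ↦ (p.1 ^ 2, p.2 ^ 2) := by fun_prop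
  refine hc.isClosedMap.isQuotientMap hc fun p ↦ ?_
  obtain ⟨z, hz⟩ := Circle.exists_sq_eq p.1
  obtain ⟨w, hw⟩ := Circle.exists_sq_eq p.2
  exact ⟨(z, w), Prod.ext hz hw⟩

lemma isQuotientMap_sq_right :
    Topology.IsQuotientMap fun p : Circle × Circle ↦ (p.1, p.2 ^ 2) := by
  have hc : Continuous fun p : Circle × Circle ↦ (p.1, p.2 ^ 2) := by fun_prop
  refine hc.isClosedMap.isQuotientMap hc fun p ↦ ?_
  obtain ⟨w, hw⟩ := Circle.exists_sq_eq p.2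
  exact ⟨(p.1, w), Prod.ext rfl hw⟩

/-- Squaring the second factor identifies the signs of the fibre parameters; the involution then
accounts for the sign of the base parameters. -/
lemma isQuotientMap_klein : Topology.IsQuotientMap
    fun p : Circle × Circle ↦ (Quotient.mk kleinSetoid (p.1, p.2 ^ 2) : KleinBottle) :=
  (isQuotientMap_quotient_mk' (s := kleinSetoid)).comp isQuotientMap_sq_right

/-- Homogeneous coordinates of the point with parameters `p`. -/
def circleVec (d : ℕ) (p : Circle × Circle) : Fin (5 + 1) → ℝ :=
  pVec d (p.1 : ℂ).re (p.1 : ℂ).im (p.2 : ℂ).re (p.2 : ℂ).im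

lemma Circle.sq_eq_sq {z w : Circle} : z ^ 2 = w ^ 2 ↔ w = z ∨ w = -z := by
  rw [← Circle.coe_inj, Circle.coe_pow, Circle.coe_pow, eq_comm, sq_eq_sq_iff_eq_or_eq_neg]
  rw [← Circle.coe_neg, Circle.coe_inj, Circle.coe_inj]

/-- For `d = 0` the coordinates form a Segre vector, which determines each factor up to sign, and
squaring on the circle removes exactly that sign. -/
lemma torus_fibres (p p' : Circle × Circle) : (p.1 ^ 2, p.2 ^ 2) = (p'.1 ^ 2, p'.2 ^ 2) ↔
    ∃ u : ℝ, ∀ i, circleVec 0 p' i = u * circleVec 0 p i := by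
  obtain ⟨z, q⟩ := p
  obtain ⟨z', q'⟩ := p'
  constructor
  · intro h
    obtain ⟨h1, h2⟩ : z ^ 2 = z' ^ 2 ∧ q ^ 2 = q' ^ 2 := Prod.ext_iff.1 h
    clear h
    obtain rfl | rfl := Circle.sq_eq_sq.1 h1 <;> obtain rfl | rfl := Circle.sq_eq_sq.1 h2
    · exact ⟨1, fun i ↦ (one_mul _).symm⟩
    · refine ⟨-1, fun i ↦ ?_⟩
      fin_cases i <;> simp [circleVec, pVec]
    · refine ⟨-1, fun i ↦ ?_⟩
      fin_cases i <;> simp [circleVec, pVec]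
    · refine ⟨1, fun i ↦ ?_⟩
      fin_cases i <;> simp [circleVec, pVec]
  · rintro ⟨u, hu⟩
    have e0 := hu 0
    have e1 := hu 1
    have e2 := hu 2
    have e3 := hu 3
    simp [circleVec, pVec] at e0 e1 e2 e3
    have a := Circle.re_sq_add_im_sq z
    have b := Circle.re_sq_add_im_sq q
    have a' := Circle.re_sq_add_im_sq z'
    have b' := Circle.re_sq_add_im_sq q'
    have s1 := Circle.sq_re z
    have s2 := Circle.sq_im z
    have s1' := Circle.sq_re z'
    have s2' := Circle.sq_im z'
    have r1 := Circle.sq_re q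
    have r2 := Circle.sq_im q
    have r1' := Circle.sq_re q'
    have r2' := Circle.sq_im q'
    generalize (z : ℂ).re = t₀ at *
    generalize (z : ℂ).im = t₁ at *
    generalize (z' : ℂ).re = t₀' at *
    generalize (z' : ℂ).im = t₁' at *
    generalize (q : ℂ).re = m at *
    generalize (q : ℂ).im = n at *
    generalize (q' : ℂ).re = m' at *
    generalize (q' : ℂ).im = n' at *
    -- Four of the coordinates form a vector whose norm is the product of two norms equal to 1.
    have hu2 : u ^ 2 = 1 := by
      have h1 : (m' * t₀') ^ 2 + (m' * t₁') ^ 2 + (n' * t₀') ^ 2 + (n' * t₁') ^ 2 =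
        (m' ^ 2 + n' ^ 2) * (t₀' ^ 2 + t₁' ^ 2) := by ring
      have h2 : (u * (m * t₀)) ^ 2 + (u * (m * t₁)) ^ 2 + (u * (n * t₀)) ^ 2 +
        (u * (n * t₁)) ^ 2 = u ^ 2 * ((m ^ 2 + n ^ 2) * (t₀ ^ 2 + t₁ ^ 2)) := by ring
      rw [e0, e1, e2, e3, h2, a, b, a', b'] at h1
      linarith
    -- Products of two coordinates do not see `u`, since `u ^ 2 = 1`. Summing over one factor
    -- isolates the quadratic monomials of the other.
    have quad {α β γ δ c : ℝ} (hα : α = u * γ) (hβ : β = u * δ) (hc : c = γ * δ) : α * β = c := by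
      rw [hα, hβ, hc]; linear_combination γ * δ * hu2
    have k1 : t₀' ^ 2 = t₀ ^ 2 := by
      have h1 := quad e0 e0 rfl
      have h2 := quad e2 e2 rfl
      linear_combination h1 + h2 - t₀' ^ 2 * b' + t₀ ^ 2 * b
    have k2 : t₁' ^ 2 = t₁ ^ 2 := by linear_combination a' - a - k1
    have k3 : t₀' * t₁' = t₀ * t₁ := by
      have h1 := quad e0 e1 rfl
      have h2 := quad e2 e3 rfl
      linear_combination h1 + h2 - t₀' * t₁' * b' + t₀ * t₁ * b
    have l1 : m' ^ 2 = m ^ 2 := by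
      have h1 := quad e0 e0 rfl
      have h2 := quad e1 e1 rfl
      linear_combination h1 + h2 - m' ^ 2 * a' + m ^ 2 * a
    have l2 : n' ^ 2 = n ^ 2 := by linear_combination b' - b - l1
    have l3 : m' * n' = m * n := by
      have h1 := quad e0 e2 rfl
      have h2 := quad e1 e3 rfl
      linear_combination h1 + h2 - m' * n' * a' + m * n * a
    exact Prod.ext (Circle.ext_re_im (by rw [s1, s1', k1, k2]) (by rw [s2, s2', k3]))
      (Circle.ext_re_im (by rw [r1, r1', l1, l2]) (by rw [r2, r2', l3]))

lemma Circle.inv_re (z : Circle) : ((z⁻¹ : Circle) : ℂ).re = (z : ℂ).re := by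
  rw [Circle.coe_inv_eq_conj, Complex.conj_re]

lemma Circle.inv_im (z : Circle) : ((z⁻¹ : Circle) : ℂ).im = -(z : ℂ).im := by
  rw [Circle.coe_inv_eq_conj, Complex.conj_im]

lemma eq_zero_of_sq_add_sq {a b : ℝ} (h : a ^ 2 + b ^ 2 = 0) : a = 0 ∧ b = 0 := by
  obtain ⟨h1, h2⟩ := (add_eq_zero_iff_of_nonneg (sq_nonneg a) (sq_nonneg b)).1 h
  exact ⟨(pow_eq_zero_iff two_ne_zero).1 h1, (pow_eq_zero_iff two_ne_zero).1 h2⟩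

/-- The coordinates determine `(t₀, t₁)` up to sign. Reversing this sign must be matched by a
relative sign between `m` and `n`, which changes the sign of `m n` but not the squares. -/
lemma klein_real {t₀ t₁ t₀' t₁' m n m' n' u : ℝ} (a : t₀ ^ 2 + t₁ ^ 2 = 1) (b : m ^ 2 + n ^ 2 = 1)
    (a' : t₀' ^ 2 + t₁' ^ 2 = 1) (b' : m' ^ 2 + n' ^ 2 = 1) (e0 : m' * t₀' = u * (m * t₀))
    (e1 : m' * t₁' = u * (m * t₁)) (e2 : n' * t₀' ^ 2 = u * (n * t₀ ^ 2))
    (e3 : n' * t₀' * t₁' = u * (n * t₀ * t₁)) (e5 : n' * t₁' ^ 2 = u * (n * t₁ ^ 2)) :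
    (t₀' = t₀ ∧ t₁' = t₁ ∧ m' ^ 2 = m ^ 2 ∧ n' ^ 2 = n ^ 2 ∧ m' * n' = m * n) ∨
      (t₀' = -t₀ ∧ t₁' = -t₁ ∧ m' ^ 2 = m ^ 2 ∧ n' ^ 2 = n ^ 2 ∧ m' * n' = -(m * n)) := by
  have f : n' = u * n := by
    linear_combination e2 + e5 - n' * a' + u * n * a
  have hm : m' ^ 2 = u ^ 2 * m ^ 2 := by
    have h0 : (m' * t₀') ^ 2 + (m' * t₁') ^ 2 = u ^ 2 * ((m * t₀) ^ 2 + (m * t₁) ^ 2) := by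
      rw [e0, e1]; ring
    linear_combination h0 - m' ^ 2 * a' + u ^ 2 * m ^ 2 * a
  have hu2 : u ^ 2 = 1 := by
    have h0 : n' ^ 2 = u ^ 2 * n ^ 2 := by rw [f]; ring
    linear_combination b' - hm - h0 - u ^ 2 * b
  have l1 : m' ^ 2 = m ^ 2 := by rw [hm, hu2, one_mul]
  have l2 : n' ^ 2 = n ^ 2 := by rw [f, mul_pow, hu2, one_mul]
  have hu1 : u = 1 ∨ u = -1 := mul_self_eq_one_iff.1 (by rw [← pow_two, hu2])
  -- When `m = 0` only products of the base parameters are visible. Both alternatives for `m n` then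
  -- hold, so it remains to find the sign of `(t₀', t₁')`.
  by_cases hm0 : m = 0
  · have hm0' : m' = 0 := by
      rw [hm0] at l1
      exact pow_eq_zero_iff two_ne_zero |>.1 (by rw [l1]; ring)
    have hn2 : n ^ 2 = 1 := by rw [hm0] at b; linear_combination b
    have hu0 : u * n ≠ 0 := by
      intro h0
      have : (u * n) ^ 2 = 1 := by rw [mul_pow, hu2, hn2, one_mul]
      rw [h0] at this
      norm_num at this
    have k1 : t₀' ^ 2 = t₀ ^ 2 := mul_left_cancel₀ hu0 (by linear_combination e2 - t₀' ^ 2 * f)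
    have k2 : t₀' * t₁' = t₀ * t₁ := mul_left_cancel₀ hu0 (by linear_combination e3 - t₀' * t₁' * f)
    have k3 : t₁' ^ 2 = t₁ ^ 2 := by linear_combination a' - a - k1
    have hmn : m' * n' = m * n := by rw [hm0, hm0', zero_mul, zero_mul]
    have hmn' : m' * n' = -(m * n) := by rw [hm0, hm0', zero_mul, zero_mul, neg_zero]
    have key : (t₀' - t₀ = 0 ∧ t₁' - t₁ = 0) ∨ (t₀' + t₀ = 0 ∧ t₁' + t₁ = 0) := by
      -- The scalar product of the two unit vectors has square 1, so they are equal or opposite.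
      by_cases h : t₀ * t₀' + t₁ * t₁' = 1
      · have h0 : (t₀' - t₀) ^ 2 + (t₁' - t₁) ^ 2 = 0 := by linear_combination a + a' - 2 * h
        exact Or.inl (eq_zero_of_sq_add_sq h0)
      · have h0 : (t₀ * t₀' + t₁ * t₁' - 1) * (t₀ * t₀' + t₁ * t₁' + 1) = 0 := by
          linear_combination t₀ ^ 2 * k1 + t₁ ^ 2 * k3 + 2 * t₀ * t₁ * k2 + (t₀ ^ 2 + t₁ ^ 2 + 1) * a
        have h1 := (mul_eq_zero.1 h0).resolve_left (sub_ne_zero.2 h)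
        have h0 : (t₀' + t₀) ^ 2 + (t₁' + t₁) ^ 2 = 0 := by linear_combination a + a' + 2 * h1
        exact Or.inr (eq_zero_of_sq_add_sq h0)
    obtain ⟨h0, h1⟩ | ⟨h0, h1⟩ := key
    · exact Or.inl ⟨sub_eq_zero.1 h0, sub_eq_zero.1 h1, l1, l2, hmn⟩
    · exact Or.inr ⟨eq_neg_of_add_eq_zero_left h0, eq_neg_of_add_eq_zero_left h1,
        l1, l2, hmn'⟩
  · obtain h | h := sq_eq_sq_iff_eq_or_eq_neg.1 l1
    · have g0 : t₀' = u * t₀ := mul_left_cancel₀ hm0 (by linear_combination e0 - t₀' * h)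
      have g1 : t₁' = u * t₁ := mul_left_cancel₀ hm0 (by linear_combination e1 - t₁' * h)
      obtain rfl | rfl := hu1
      · exact Or.inl ⟨by rw [g0, one_mul], by rw [g1, one_mul], l1, l2, by rw [f, h, one_mul]⟩
      · exact Or.inr ⟨by rw [g0]; ring, by rw [g1]; ring, l1, l2, by rw [f, h]; ring⟩
    · have g0 : t₀' = -u * t₀ := mul_left_cancel₀ hm0 (by linear_combination -e0 + t₀' * h)
      have g1 : t₁' = -u * t₁ := mul_left_cancel₀ hm0 (by linear_combination -e1 + t₁' * h)
      obtain rfl | rfl := hu1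
      · exact Or.inr ⟨by rw [g0]; ring, by rw [g1]; ring, l1, l2, by rw [f, h]; ring⟩
      · exact Or.inl ⟨by rw [g0]; ring, by rw [g1]; ring, l1, l2, by rw [f, h]; ring⟩

/-- For `d = 1` the parameters `(t, m, n)` and `(-t, -m, n)` define the same point. On circles the
second change is `q ↦ -q̄`, which after squaring becomes `q² ↦ (q²)⁻¹`, so together they give the
Klein involution. -/
lemma klein_fibres (p p' : Circle × Circle) :
    (Quotient.mk kleinSetoid (p.1, p.2 ^ 2) : KleinBottle) =
      Quotient.mk kleinSetoid (p'.1, p'.2 ^ 2) ↔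
    ∃ u : ℝ, ∀ i, circleVec 1 p' i = u * circleVec 1 p i := by
  obtain ⟨z, q⟩ := p
  obtain ⟨z', q'⟩ := p'
  have hq : (Quotient.mk kleinSetoid (z, q ^ 2) : KleinBottle) =
      Quotient.mk kleinSetoid (z', q' ^ 2) ↔
      (z' = z ∧ q' ^ 2 = q ^ 2) ∨ (z' = -z ∧ q' ^ 2 = (q⁻¹) ^ 2) := by
    refine (Quotient.eq (r := kleinSetoid)).trans ?_
    change (_ ∨ _) ↔ _
    simp only [kleinInvolution, Prod.mk.injEq, inv_pow]
  refine hq.trans ?_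
  constructor
  · rintro (⟨rfl, h⟩ | ⟨rfl, h⟩)
    · obtain rfl | rfl := Circle.sq_eq_sq.1 h.symm
      · exact ⟨1, fun i ↦ (one_mul _).symm⟩
      · refine ⟨-1, fun i ↦ ?_⟩
        fin_cases i <;> simp [circleVec, pVec]
    · obtain rfl | rfl := Circle.sq_eq_sq.1 h.symm
      · refine ⟨-1, fun i ↦ ?_⟩
        fin_cases i <;> simp [circleVec, pVec, Circle.inv_re, Circle.inv_im, -Circle.coe_inv]
      · refine ⟨1, fun i ↦ ?_⟩
        fin_cases i <;> simp [circleVec, pVec, Circle.inv_re, Circle.inv_im, -Circle.coe_inv]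
  · rintro ⟨u, hu⟩
    have e0 := hu 0
    have e1 := hu 1
    have e2 := hu 2
    have e3 := hu 3
    have e5 := hu 5
    simp [circleVec, pVec] at e0 e1 e2 e3 e5
    have a := Circle.re_sq_add_im_sq z
    have b := Circle.re_sq_add_im_sq q
    have a' := Circle.re_sq_add_im_sq z'
    have b' := Circle.re_sq_add_im_sq q'
    have r1 := Circle.sq_re q
    have r2 := Circle.sq_im q
    have r1' := Circle.sq_re q'
    have r2' := Circle.sq_im q'
    have i1 := Circle.sq_re q⁻¹
    have i2 := Circle.sq_im q⁻¹
    rw [Circle.inv_re, Circle.inv_im] at i1 i2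
    have hz {w : Circle} (h0 : (z' : ℂ).re = (w : ℂ).re) (h1 : (z' : ℂ).im = (w : ℂ).im) :
      z' = w := Circle.ext_re_im h0 h1
    have hz2 (h0 : (z' : ℂ).re = -(z : ℂ).re) (h1 : (z' : ℂ).im = -(z : ℂ).im) : z' = -z :=
      hz (by rw [h0]; simp) (by rw [h1]; simp)
    have hz1 := hz (w := z)
    clear hz hq hu
    have hq1 (h1 : (q' : ℂ).re ^ 2 = (q : ℂ).re ^ 2) (h2 : (q' : ℂ).im ^ 2 = (q : ℂ).im ^ 2)
        (h3 : (q' : ℂ).re * (q' : ℂ).im = (q : ℂ).re * (q : ℂ).im) : q' ^ 2 = q ^ 2 :=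
      Circle.ext_re_im (by rw [r1, r1', h1, h2]) (by rw [r2, r2', h3])
    have hq2 (h1 : (q' : ℂ).re ^ 2 = (q : ℂ).re ^ 2) (h2 : (q' : ℂ).im ^ 2 = (q : ℂ).im ^ 2)
        (h3 : (q' : ℂ).re * (q' : ℂ).im = -((q : ℂ).re * (q : ℂ).im)) : q' ^ 2 = (q⁻¹) ^ 2 :=
      Circle.ext_re_im (by rw [i1, r1', h1, h2]; ring) (by rw [i2, r2', h3]; ring)
    clear r1 r2 r1' r2' i1 i2
    obtain ⟨h0, h1, h2, h3, h4⟩ | ⟨h0, h1, h2, h3, h4⟩ := klein_real a b a' b' e0 e1 e2 e3 e5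
    · exact Or.inl ⟨hz1 h0 h1, hq1 h2 h3 h4⟩
    · exact Or.inr ⟨hz2 h0 h1, hq2 h2 h3 h4⟩

section

variable {K : Type} [Field K] [Algebra ℝ K] {t x : K}

/-- A compact quotient of the torus with the same fibres as the parametrization of the real points
is homeomorphic to the real locus. -/
lemma nonempty_homeomorph_of_circleVec (h : Coords t x) (d : ℕ) {Q : Type} [TopologicalSpace Q]
    {Φ : Circle × Circle → Q} (hΦ : Topology.IsQuotientMap Φ)
    (hf : ∀ p p', Φ p = Φ p' ↔ ∃ u : ℝ, ∀ i, circleVec d p' i = u * circleVec d p i) :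
    Nonempty (RealPoint (hModel d t x) ≃ₜ Q) := by
  have hre (f : Circle × Circle → Circle) (hc : Continuous f) :
      Continuous fun p ↦ (f p : ℂ).re :=
    Complex.continuous_re.comp (continuous_subtype_val.comp hc)
  have him (f : Circle × Circle → Circle) (hc : Continuous f) :
      Continuous fun p ↦ (f p : ℂ).im :=
    Complex.continuous_im.comp (continuous_subtype_val.comp hc)
  obtain ⟨ψ, hψ, hv⟩ := exists_continuous_pVec h d (P := Circle × Circle)
    (hre _ continuous_fst) (him _ continuous_fst) (hre _ continuous_snd) (him _ continuous_snd)
    (fun p ↦ Circle.ne_zero p.1) (fun p ↦ Circle.ne_zero p.2)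
  have hT : T2Space (RealPoint (hModel d t x)) := t2Space_of_isClosedImmersion (hModelι d t x)
  refine nonempty_homeomorph_of_fibres hΦ hψ (fun y ↦ ?_) fun p p' ↦ (hf p p').trans ⟨?_, ?_⟩
  · obtain ⟨p, hp⟩ := exists_hasCoords_circle h d y
    exact ⟨p, injective_comp (hModelι d t x)
      (HasCoords.ext (hv p) hp 1 fun i ↦ (one_mul _).symm)⟩
  · rintro ⟨u, hu⟩
    exact injective_comp (hModelι d t x) (HasCoords.ext (hv p) (hv p') u hu)
  · intro e
    have h' := hv p'
    rw [← e] at h'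
    exact HasCoords.eq_smul (hv p) h'

lemma nonempty_homeomorph_torus (h : Coords t x) :
    Nonempty (RealPoint (hModel 0 t x) ≃ₜ Circle × Circle) :=
  nonempty_homeomorph_of_circleVec h 0 isQuotientMap_prod_sq torus_fibres

lemma nonempty_homeomorph_klein (h : Coords t x) :
    Nonempty (RealPoint (hModel 1 t x) ≃ₜ KleinBottle) :=
  nonempty_homeomorph_of_circleVec h 1 isQuotientMap_klein klein_fibres

end

end Topology

/-! ### Rational models and the chain of blowing-ups -/

section Models

attribute [local instance] euclideanTopology

variable {S : Type} [TopologicalSpace S]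

lemma IsRationalModel.of_iso {X Y : RealScheme} (e : X ≅ Y) (h : IsRationalModel S Y) :
    IsRationalModel S X := by
  have he : IsIso e.hom.left := inferInstanceAs (IsIso ((Over.forget _).map e.hom))
  obtain ⟨hs, ⟨n, i, hi⟩, hr, ⟨φ⟩⟩ := h
  have : IsZariskiLocalAtSource (@SmoothOfRelativeDimension 2) :=
    HasRingHomProperty.instIsZariskiLocalAtSource
  refine ⟨?_, ⟨n, e.hom ≫ i, ?_⟩, isRationalOver_of_iso e hr, ⟨(realPointHomeo e).trans φ⟩⟩
  · rw [← Over.w e.hom]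
    exact IsZariskiLocalAtSource.comp (P := @SmoothOfRelativeDimension 2) hs e.hom.left
  · rw [Over.comp_left]
    infer_instance

/-- Two blowings-up along the same ideal sheaf are isomorphic. -/
lemma IsBlowup.exists_iso {X X' Y : Scheme.{0}} {I : Y.IdealSheafData} {π : X ⟶ Y} {π' : X' ⟶ Y}
    (h : IsBlowup I π) (h' : IsBlowup I π') : ∃ e : X ≅ X', e.hom ≫ π' = π := by
  obtain ⟨f, hf, -⟩ := h'.existsUnique_lift X π h.isInvertibleIdeal
  obtain ⟨g, hg, -⟩ := h.existsUnique_lift X' π' h'.isInvertibleIdeal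
  refine ⟨⟨f, g, (h.existsUnique_lift X π h.isInvertibleIdeal).unique ?_ (Category.id_comp _),
    (h'.existsUnique_lift X' π' h'.isInvertibleIdeal).unique ?_ (Category.id_comp _)⟩, hf⟩
  · rw [Category.assoc, hg, hf]
  · rw [Category.assoc, hf, hg]

lemma IsBlowupAtRealPoint.nonempty_iso {X X' Y : RealScheme} {O : RealPoint Y} {π : X ⟶ Y}
    {π' : X' ⟶ Y} (h : IsBlowupAtRealPoint O π) (h' : IsBlowupAtRealPoint O π') :
    Nonempty (X ≅ X') := by
  obtain ⟨e, he⟩ := IsBlowup.exists_iso h h'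
  refine ⟨Over.isoMk e ?_⟩
  rw [← Over.w π', ← Over.w π, ← he, Category.assoc]

variable {K : Type} [Field K] [Algebra ℝ K] {t x : K}

/-- Supplies the ambient field `K`: the field of rational functions in two variables with its
variables as coordinates. -/
lemma exists_coords : ∃ t x : FractionRing (MvPolynomial (Fin 2) ℝ), Coords t x := by
  have : Algebra.IsAlgebraic (MvPolynomial (Fin 2) ℝ) (FractionRing (MvPolynomial (Fin 2) ℝ)) :=
    IsLocalization.isAlgebraic _ (nonZeroDivisors (MvPolynomial (Fin 2) ℝ))
  have h := (IsTranscendenceBasis.mvPolynomial (Fin 2) ℝ).algebraMap_comp (S := MvPolynomial (Fin 2) ℝ)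
    (A := FractionRing (MvPolynomial (Fin 2) ℝ))
  let A := MvPolynomial (Fin 2) ℝ
  have e : algebraMap A (FractionRing A) ∘ MvPolynomial.X =
      ![algebraMap A (FractionRing A) (MvPolynomial.X 0),
        algebraMap A (FractionRing A) (MvPolynomial.X 1)] := by
    funext i
    fin_cases i <;> rfl
  rw [e] at h
  exact ⟨_, _, h⟩

instance (d : ℕ) (t x : K) : (eModel d t x).left.IsSeparated :=
  inferInstanceAs (projModel (eVec d t x) exists_isUnit_eVec).left.IsSeparated

lemma isRealPt_eModelPt (d : ℕ) (t x : K) : IsRealPt (X := eModel d t x) (eModelPt d t x) :=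
  isRealPt_projModelPt _ _

lemma isRationalModel_hModel (h : Coords t x) (d : ℕ)
    (hS : Nonempty (RealPoint (hModel d t x) ≃ₜ S)) : IsRationalModel S (hModel d t x) := by
  have hX := isRuled_hModel h.left_ne_zero h.right_ne_zero d
  obtain ⟨c, hc⟩ := hX.isChart (rng {t, x}) (Or.inl rfl)
  exact ⟨hX.coveredBy.smooth (isRealPt_hModelPt d t x) (isRuledData_hModel h d).isSmoothRng,
    ⟨5, hModelι d t x, inferInstance⟩,
    isRationalOver_of_isChart hX.coveredBy (isRealPt_hModelPt d t x) h hc, hS⟩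

lemma isRationalModel_eModel (h : Coords t x) (d : ℕ)
    (hS : Nonempty (RealPoint (eModel d t x) ≃ₜ S)) : IsRationalModel S (eModel d t x) := by
  have hX := isElem_eModel h.left_ne_zero h.right_ne_zero h.one_add_sq_ne_zero d
  obtain ⟨c, hc⟩ := hX.isChart (rng {t, x⁻¹}) (Or.inr (Or.inr (Or.inl rfl)))
  exact ⟨hX.coveredBy.smooth (isRealPt_eModelPt d t x) (isRuledData_hModel h d).isSmoothRng_elem,
    ⟨35, projModelι (eVec d t x) exists_isUnit_eVec,
      inferInstanceAs (IsClosedImmersion (projModelι (eVec d t x) exists_isUnit_eVec).left)⟩,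
    isRationalOver_of_isChart hX.coveredBy (isRealPt_eModelPt d t x)
      (isRuledData_hModel h d).inv.coords hc, hS⟩

lemma exists_eModel_hom (h : Coords t x) (d : ℕ) :
    ∃ π : eModel d t x ⟶ hModel d t x, IsBlowupAtConjugatePair π :=
  exists_isBlowupAtConjugatePair (isRuledData_hModel h d)
    (isElem_eModel h.left_ne_zero h.right_ne_zero h.one_add_sq_ne_zero d)
    (isRuled_hModel h.left_ne_zero h.right_ne_zero d) (isRealPt_eModelPt d t x)
    (isRealPt_hModelPt d t x)

/-- The centre on 𝔽_{d+2} lies on the section at infinity. Taking the inverse of the new fibre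
coordinate moves it to the zero section, where the previous construction applies to the same six
charts. -/
lemma exists_eModel_hom_add_two (h : Coords t x) (d : ℕ) :
    ∃ π : eModel d t x ⟶ hModel (d + 2) t (x / (1 + t ^ 2)), IsBlowupAtConjugatePair π := by
  have hr := isRuledData_hModel h d
  have hc := hr.elem.coords
  have hE := isElem_eModel h.left_ne_zero h.right_ne_zero h.one_add_sq_ne_zero d
  have hH := isRuled_hModel hc.left_ne_zero hc.right_ne_zero (d + 2)
  have hy : t ^ (d + 2) * (x / (1 + t ^ 2)) = t ^ d * x / (1 + t⁻¹ ^ 2) := by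
    have h1 := h.one_add_sq_ne_zero
    have h2 := h.left_ne_zero
    have h3 := hr.symm.coords.one_add_sq_ne_zero
    rw [mul_div_assoc', div_eq_div_iff h1 h3]
    field_simp
    ring
  rw [hy] at hH
  have e := elemRings_inv hr
  have e' := ruledRings_inv t t⁻¹ (x / (1 + t ^ 2)) (t ^ d * x / (1 + t⁻¹ ^ 2))
  exact exists_isBlowupAtConjugatePair hr.elem.inv ⟨e ▸ hE.coveredBy, e ▸ hE.isChart⟩
    ⟨e' ▸ hH.coveredBy, e' ▸ hH.isChart⟩ (isRealPt_eModelPt d t x) (isRealPt_hModelPt _ _ _)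

/-- Hirzebruch surfaces whose degrees have the same parity are linked by blowings-up. -/
lemma exists_chain_hModel (h : Coords t x) (d : ℕ)
    (hS : Nonempty (RealPoint (hModel d t x) ≃ₜ S)) (n : ℕ) :
    ∃ (z : K) (X : ℕ → RealScheme), Coords t z ∧ X 0 = hModel (d + 2 * n) t z ∧
      X (2 * n) = hModel d t x ∧ (∀ i ≤ 2 * n, IsRationalModel S (X i)) ∧
      ∀ k < n, (∃ f : X (2 * k + 1) ⟶ X (2 * k), IsBlowupAtConjugatePair f) ∧
        ∃ g : X (2 * k + 1) ⟶ X (2 * k + 2), IsBlowupAtConjugatePair g := by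
  induction n with
  | zero =>
    exact ⟨x, fun _ ↦ hModel d t x, h, rfl, rfl, fun _ _ ↦ isRationalModel_hModel h d hS,
      fun k hk ↦ absurd hk k.not_lt_zero⟩
  | succ n ih =>
    obtain ⟨z, X, hz, h0, hn, hX, hf⟩ := ih
    obtain ⟨π, hπ⟩ := exists_eModel_hom hz (d + 2 * n)
    obtain ⟨ρ, hρ⟩ := exists_eModel_hom_add_two hz (d + 2 * n)
    have hm := hX 0 (Nat.zero_le _)
    rw [h0] at hm
    obtain ⟨a⟩ := hm.realLocus
    obtain ⟨b⟩ := hπ.nonempty_homeomorph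
    obtain ⟨c⟩ := hρ.nonempty_homeomorph
    have hz' := (isRuledData_hModel hz d).elem.coords
    -- The chain grows at the high-degree end. The base coordinate `t` is kept, and the fibre
    -- coordinate is divided by `1 + t ^ 2` at each step.
    let X' : ℕ → RealScheme
      | 0 => hModel (d + 2 * n + 2) t (z / (1 + t ^ 2))
      | 1 => eModel (d + 2 * n) t z
      | i + 2 => X i
    refine ⟨z / (1 + t ^ 2), X', hz', rfl, hn, ?_, ?_⟩
    · rintro (_ | _ | i) hi
      · exact isRationalModel_hModel hz' _ ⟨c.symm.trans (b.trans a)⟩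
      · exact isRationalModel_eModel hz _ ⟨b.trans a⟩
      · exact hX i (by omega)
    · rintro (_ | k) hk
      · refine ⟨⟨ρ, hρ⟩, ?_⟩
        change ∃ g : eModel (d + 2 * n) t z ⟶ X 0, IsBlowupAtConjugatePair g
        rw [h0]
        exact ⟨π, hπ⟩
      · exact hf k (by omega)

/-- The coordinates at the top of the chain are not the original ones. This is harmless, because any
pair of coordinates gives a projective model isomorphic to the Hirzebruch surface. -/
lemma areIsomorphicModels_hirzebruch (h : Coords t x) (d n : ℕ)
    (hS : Nonempty (RealPoint (hModel d t x) ≃ₜ S)) {B : RealScheme}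
    (hB : Nonempty (hModel d t x ≅ B)) : AreIsomorphicModels S (hirzebruch (d + 2 * n)) B := by
  obtain ⟨z, X, hz, h0, hn, hX, hf⟩ := exists_chain_hModel h d hS n
  obtain ⟨e⟩ := exists_hirzebruch_iso hz (d + 2 * n)
  obtain ⟨e'⟩ := hB
  exact ⟨.of_iso e (h0 ▸ hX 0 (Nat.zero_le _)), .of_iso e'.symm (hn ▸ hX _ le_rfl),
    n, X, ⟨e ≪≫ eqToIso h0.symm⟩, ⟨eqToIso hn ≪≫ e'⟩, hX, hf⟩

end Models

end RealModel

end

/-! ### The theorem -/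

theorem mainTheorem7 (d : ℕ) :
    (Even d →
      RealModel.AreIsomorphicModels (Circle × Circle) (RealModel.hirzebruch d)
        RealModel.realP1xP1) ∧
    (Odd d → ∀ O : RealModel.RealPoint (RealModel.realProjSpace 2),
      (∃ (B : RealModel.RealScheme) (β : B ⟶ RealModel.realProjSpace 2),
        RealModel.IsBlowupAtRealPoint O β) ∧
      ∀ (B : RealModel.RealScheme) (β : B ⟶ RealModel.realProjSpace 2),
        RealModel.IsBlowupAtRealPoint O β →
          RealModel.AreIsomorphicModels RealModel.KleinBottle (RealModel.hirzebruch d) B) := by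
  obtain ⟨t, x, h⟩ := RealModel.exists_coords
  refine ⟨fun hd ↦ ?_, fun hd O ↦ ?_⟩
  · obtain ⟨n, rfl⟩ := hd.two_dvd
    rw [← zero_add (2 * n)]
    obtain ⟨e⟩ := RealModel.exists_realP1xP1_iso h
    exact RealModel.areIsomorphicModels_hirzebruch h 0 n (RealModel.nonempty_homeomorph_torus h)
      ⟨e.symm⟩
  · obtain ⟨n, rfl⟩ := hd
    obtain ⟨π, hπ⟩ := RealModel.exists_isBlowupAtRealPoint h O
    -- The degree 1 model shows that a blowing-up at `O` exists; uniqueness up to isomorphism then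
    -- transfers the chain to an arbitrary one.
    refine ⟨⟨_, π, hπ⟩, fun B β hβ ↦ ?_⟩
    rw [add_comm]
    exact RealModel.areIsomorphicModels_hirzebruch h 1 n (RealModel.nonempty_homeomorph_klein h)
      (hπ.nonempty_iso hβ)
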